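/- **Setting.** $G$ is a connected undirected graph on $n\ge 2$ vertices with $m$ edges and edge weights in $[1,W]$; $A$ is its weighted adjacency matrix, $D=\mathrm{diag}(d_u)$ its diagonal matrix of weighted degrees, $L=D-A$ its Laplacian, $L^+$ the pseudoinverse of $L$, $R(u,v)=(\mathbf 1_u-\mathbf 1_v)^\top L^+(\mathbf 1_u-\mathbf 1_v)$ the effective resistance, and $\nu_2$ the second smallest eigenvalue of the normalised Laplacian $D^{-1/2}LD^{-1/2}$. Let $0<\varepsilon\le 1$. A number $r$ is a $(1+\varepsilon)$-approximation of $R$ if $(1-\varepsilon)R\le r\le(1+\varepsilon)R$. Algorithms are programs for a random access machine with unit-cost steps, whose registers and arrays hold natural numbers (addition, truncated subtraction, comparison, indexing) or real numbers (field operations, comparison), and which can draw a uniform natural number below a given one and toss a coin of given bias. Graphs are given by adjacency lists, and a sparse vector is stored as the list of its nonzero coordinates in increasing order of the index. The input of the algorithms contains $G$, $\varepsilon$ and $\nu_2$. Running times are worst-case, over all random choices. **Theorem.** For every $c\in\mathbb N$ there are programs EffectiveResistanceSketch, EffectiveResistanceQuery and a program answering batches of queries, and a constant $C>0$ (depending only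 on $c$), such that for all $G$, $W$, $\varepsilon$ as above the following hold. 1. On input $(G,\varepsilon,\nu_2)$, EffectiveResistanceSketch halts within $C\,\bigl(m+n\varepsilon^{-2}\nu_2^{-3}\log n\,\log^3\tfrac{nW}{\varepsilon}\bigr)$ steps and stores the degrees $d_u$ and sparse vectors $\widetilde\sigma_u\in\mathbb R^V$ $(u\in V)$, each with at most $C\,\nu_2^{-1}\varepsilon^{-1}\log(nW)$ nonzero coordinates. 2. With probability at least $1-n^{-c}$, the number $$\tfrac1{d_u}(\widetilde\sigma_u)_u-\tfrac1{d_v}(\widetilde\sigma_u)_v+\tfrac1{d_v}(\widetilde\sigma_v)_v-\tfrac1{d_u}(\widetilde\sigma_v)_u$$ is a $(1+\varepsilon)$-approximation of $R(u,v)$ simultaneously for all pairs of vertices $u,v$. 3. Given the stored vectors and degrees and a pair $(u,v)$, EffectiveResistanceQuery returns the number displayed in 2 within $C\log n$ steps, leaving the stored data intact. (This holds for any stored family of $n\ge2$ sparse vectors in $\mathbb R^n$ and any $n$ real numbers $d_u$, with $1/0=0$.) 4. Given $(G,\varepsilon,\nu_2)$ and any list of $s$ pairs of vertices, the batch program halts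 within $C\,\bigl(m+n\varepsilon^{-2}\nu_2^{-3}\log n\,\log^3\tfrac{nW}{\varepsilon}+s\log n\bigr)$ steps, and with probability at least $1-n^{-c}$ it outputs a $(1+\varepsilon)$-approximation of $R(u,v)$ for every pair $(u,v)$ of the list. Consequently, on expanders this takes $\widetilde O(m+n\varepsilon^{-2}+s)$ time: for all $\kappa>0$ and $k\in\mathbb N$ there are $C'>0$ and $k'\in\mathbb N$ such that whenever $\nu_2\ge\kappa/\log^k n$, the batch program halts within $C'\log^{k'}\!\bigl(\tfrac{nW}{\varepsilon}\bigr)\,(m+n\varepsilon^{-2}+s)$ steps, with the same guarantee on its output. -/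

import Mathlib

open scoped Matrix

noncomputable section

namespace ResistanceSketch

/-! ### Weighted graphs, Laplacians, effective resistance -/

/-- A finite undirected graph with nonnegative edge weights on the vertices `0, …, n - 1`, given by
its weighted adjacency matrix `A`; the edges are the pairs of nonzero weight. -/
structure WGraph (n : ℕ) where
  A : Matrix (Fin n) (Fin n) ℝ
  symm : ∀ u v, A u v = A v u
  nonneg : ∀ u v, 0 ≤ A u v
  loopless : ∀ u, A u u = 0

namespace WGraph

variable {n : ℕ} (G : WGraph n)

/-- The underlying simple graph. -/
def graph : SimpleGraph (Fin n) where
  Adj u v := G.A u v ≠ 0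
  symm := ⟨fun u v h => by rw [G.symm v u]; exact h⟩
  loopless := ⟨fun u h => h (G.loopless u)⟩

/-- The number `m` of edges. -/
def numEdges : ℕ := G.graph.edgeSet.ncard

/-- The weighted degree of a vertex. -/
def deg (u : Fin n) : ℝ := ∑ v, G.A u v

/-- The Laplacian `L = D - A`. -/
def lap : Matrix (Fin n) (Fin n) ℝ := Matrix.diagonal G.deg - G.A

/-- The normalised Laplacian `D^{-1/2} L D^{-1/2}`. -/
def normLap : Matrix (Fin n) (Fin n) ℝ :=
  Matrix.diagonal (fun u => (Real.sqrt (G.deg u))⁻¹) * G.lap *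
    Matrix.diagonal (fun u => (Real.sqrt (G.deg u))⁻¹)

theorem lap_isHermitian : G.lap.IsHermitian := by
  unfold lap
  apply Matrix.IsHermitian.sub (Matrix.isHermitian_diagonal _)
  ext u v
  simp [Matrix.conjTranspose_apply, G.symm u v]

theorem normLap_isHermitian : G.normLap.IsHermitian := by
  have hl := G.lap_isHermitian
  have hd := Matrix.isHermitian_diagonal (fun u => (Real.sqrt (G.deg u))⁻¹)
  unfold normLap Matrix.IsHermitian at *
  rw [Matrix.conjTranspose_mul, Matrix.conjTranspose_mul, hl, hd, Matrix.mul_assoc]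

/-- The spectral gap `ν₂`: the second smallest eigenvalue of the normalised Laplacian, with
multiplicity. (`eigenvalues₀` lists the eigenvalues in decreasing order.) -/
def specGap (hn : 2 ≤ n) : ℝ :=
  G.normLap_isHermitian.eigenvalues₀ ⟨n - 2, by rw [Fintype.card_fin]; omega⟩

end WGraph

/-- The pseudoinverse `∑_{i : λ i ≠ 0} (1 / λ i) ψ i (ψ i)ᵀ` of a real symmetric matrix with
eigenvalues `λ i` and orthonormal eigenvectors `ψ i`. -/
def pinv {n : ℕ} {M : Matrix (Fin n) (Fin n) ℝ} (hM : M.IsHermitian) : Matrix (Fin n) (Fin n) ℝ :=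
  ∑ i with hM.eigenvalues i ≠ 0,
    (1 / hM.eigenvalues i) • Matrix.vecMulVec (hM.eigenvectorBasis i) (hM.eigenvectorBasis i)

/-- The effective resistance `R(u,v) = (1_u - 1_v)ᵀ L⁺ (1_u - 1_v)`. -/
def WGraph.effRes {n : ℕ} (G : WGraph n) (u v : Fin n) : ℝ :=
  (Pi.single u 1 - Pi.single v 1 : Fin n → ℝ) ⬝ᵥ
    (pinv G.lap_isHermitian *ᵥ (Pi.single u 1 - Pi.single v 1))

/-! ### A randomized random access machine

The machine has registers and one-dimensional arrays holding natural numbers (for indices and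
counters), and registers and arrays holding real numbers. Every instruction and every test takes one
step. On naturals there are only addition, truncated subtraction and comparison (no multiplication,
division or bit operations); on reals the field operations and comparison (no rounding). A natural
can be converted to a real, but not conversely. Randomness: a uniform natural number below a given
one, and a coin of given bias. A program mentions finitely many registers and arrays, each by its
number. -/

/-- The contents of the natural and real registers, and of the natural and real arrays
(array number, then index). -/
structure State where
  nr : ℕ → ℕ
  xr : ℕ → ℝ
  na : ℕ → ℕ → ℕ
  xa : ℕ → ℕ → ℝ

namespace State

def setN (s : State) (r a : ℕ) : State := { s with nr := Function.update s.nr r a }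

def setX (s : State) (r : ℕ) (x : ℝ) : State := { s with xr := Function.update s.xr r x }

def putN (s : State) (t i a : ℕ) : State :=
  { s with na := Function.update s.na t (Function.update (s.na t) i a) }

def putX (s : State) (t i : ℕ) (x : ℝ) : State :=
  { s with xa := Function.update s.xa t (Function.update (s.xa t) i x) }

end State

/-- Elementary instructions; the first argument is the destination. In the array instructions the
array is given by its number and the index is the contents of a natural register. -/
inductive Instr where
  | nconst (r k : ℕ)
  | nadd (r i j : ℕ)
  | nsub (r i j : ℕ)
  | nload (r t i : ℕ)
  | nstore (t i r : ℕ)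
  | nrand (r i : ℕ)
  | coin (r x : ℕ)
  | xconst (x : ℕ) (q : ℚ)
  | xcast (x i : ℕ)
  | xadd (x y z : ℕ)
  | xsub (x y z : ℕ)
  | xmul (x y z : ℕ)
  | xdiv (x y z : ℕ)
  | xload (x t i : ℕ)
  | xstore (t i x : ℕ)

/-- Tests: strict and weak comparison of two natural or two real registers. -/
inductive Test where
  | nlt (i j : ℕ)
  | nle (i j : ℕ)
  | xlt (x y : ℕ)
  | xle (x y : ℕ)

/-- Programs. -/
inductive Prog where
  | skip
  | basic (c : Instr)
  | seq (p q : Prog)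
  | ite (b : Test) (p q : Prog)
  | loop (b : Test) (p : Prog)

/-- A coin that shows heads with probability `x` (read as `0` if `x < 0` and as `1` if `x > 1`). -/
def coinPMF (x : ℝ) : PMF Bool :=
  PMF.ofFintype (fun b => cond b (min (ENNReal.ofReal x) 1) (1 - min (ENNReal.ofReal x) 1)) (by
    simp [add_tsub_cancel_of_le])

/-- The uniform distribution on `{0, …, k - 1}` (the point mass at `0` if `k = 0`). -/
def randPMF (k : ℕ) : PMF ℕ :=
  if h : 0 < k then PMF.uniformOfFinset (Finset.range k) (Finset.nonempty_range_iff.2 h.ne')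
  else PMF.pure 0

/-- The effect of an instruction. Division by zero yields zero. -/
def Instr.exec (s : State) : Instr → PMF State
  | .nconst r k => PMF.pure (s.setN r k)
  | .nadd r i j => PMF.pure (s.setN r (s.nr i + s.nr j))
  | .nsub r i j => PMF.pure (s.setN r (s.nr i - s.nr j))
  | .nload r t i => PMF.pure (s.setN r (s.na t (s.nr i)))
  | .nstore t i r => PMF.pure (s.putN t (s.nr i) (s.nr r))
  | .nrand r i => (randPMF (s.nr i)).map (fun a => s.setN r a)
  | .coin r x => (coinPMF (s.xr x)).map (fun b => s.setN r (cond b 1 0))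
  | .xconst x q => PMF.pure (s.setX x (q : ℝ))
  | .xcast x i => PMF.pure (s.setX x (s.nr i : ℝ))
  | .xadd x y z => PMF.pure (s.setX x (s.xr y + s.xr z))
  | .xsub x y z => PMF.pure (s.setX x (s.xr y - s.xr z))
  | .xmul x y z => PMF.pure (s.setX x (s.xr y * s.xr z))
  | .xdiv x y z => PMF.pure (s.setX x (s.xr y / s.xr z))
  | .xload x t i => PMF.pure (s.setX x (s.xa t (s.nr i)))
  | .xstore t i x => PMF.pure (s.putX t (s.nr i) (s.xr x))

def Test.holds (s : State) : Test → Prop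
  | .nlt i j => s.nr i < s.nr j
  | .nle i j => s.nr i ≤ s.nr j
  | .xlt x y => s.xr x < s.xr y
  | .xle x y => s.xr x ≤ s.xr y

open Classical in
/-- One step of the machine. A configuration consists of the list of programs that remain to be
executed, one after the other, and the state; the machine has halted when the list is empty. -/
def step : List Prog × State → PMF (List Prog × State)
  | ([], s) => PMF.pure ([], s)
  | (.skip :: k, s) => PMF.pure (k, s)
  | (.basic c :: k, s) => (c.exec s).map (fun s' => (k, s'))
  | (.seq p q :: k, s) => PMF.pure (p :: q :: k, s)
  | (.ite b p q :: k, s) => PMF.pure ((if b.holds s then p else q) :: k, s)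
  | (.loop b p :: k, s) => PMF.pure (if b.holds s then p :: .loop b p :: k else k, s)

/-- The distribution of the configuration after `T` steps. -/
def run : ℕ → List Prog × State → PMF (List Prog × State)
  | 0, c => PMF.pure c
  | T + 1, c => (step c).bind (run T)

/-- Started in `s`, the program `p` halts within `T` steps in a state with the property `Q`,
whatever the outcomes of its random choices. -/
def Surely (p : Prog) (s : State) (T : ℝ) (Q : State → Prop) : Prop :=
  ∀ c ∈ (run ⌊T⌋₊ ([p], s)).support, c.1 = [] ∧ Q c.2

/-- The probability that the program `p`, started in `s`, halts within `T` steps in a state with the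
property `Q`. -/
def prob (p : Prog) (s : State) (T : ℝ) (Q : State → Prop) : ℝ :=
  ((run ⌊T⌋₊ ([p], s)).toOuterMeasure {c | c.1 = [] ∧ Q c.2}).toReal

/-! ### Sparse data in memory -/

/-- The position `p` lies in the block of row `u`. -/
def InRow (a : ℕ → ℕ) (u p : ℕ) : Prop := a (u + 1) ≤ p ∧ p < a (u + 2)

/-- The arrays `a`, `b` hold the nonzero entries of the `n × n` matrix `M`, row by row: `a 0 = n`;
`a 1 = n + 2, a 2, …, a (n + 1)` are the boundaries of consecutive blocks of positions, one for each
row; at each position `p` of the block of row `u`, `a p` is a column index and `b p` the entry. Each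
nonzero entry is listed exactly once, in any order inside its row. (For the weighted adjacency
matrix of a graph these are its adjacency lists.) -/
structure StoresRows (n : ℕ) (a : ℕ → ℕ) (b : ℕ → ℝ) (M : Matrix (Fin n) (Fin n) ℝ) : Prop where
  size : a 0 = n
  first : a 1 = n + 2
  mono : ∀ u : Fin n, a (u + 1) ≤ a (u + 2)
  entry : ∀ (u : Fin n) (p : ℕ), InRow a u p → ∃ v : Fin n, a p = v ∧ b p = M u v ∧ M u v ≠ 0
  inj : ∀ (u : Fin n) (p q : ℕ), InRow a u p → InRow a u q → a p = a q → p = q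
  all : ∀ u v : Fin n, M u v ≠ 0 → ∃ p, InRow a u p ∧ a p = v

/-- The arrays `a`, `b` hold the input `(G, ε, ν)`: the adjacency lists of `G`, and the numbers
`ε` and `ν` at the positions `0` and `1` of `b`. -/
structure StoresInput {n : ℕ} (G : WGraph n) (ε ν : ℝ) (a : ℕ → ℕ) (b : ℕ → ℝ) : Prop where
  rows : StoresRows n a b G.A
  eps : b 0 = ε
  gap : b 1 = ν

/-- The array `a`, in which the adjacency lists of a graph on `n` vertices end before the position
`a (n + 1)`, holds from that position on the number `s` of queried pairs and then the pairs. -/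
structure StoresPairs (n s : ℕ) (q : Fin s → Fin n × Fin n) (a : ℕ → ℕ) : Prop where
  count : a (a (n + 1)) = s
  left : ∀ i : Fin s, a (a (n + 1) + 1 + 2 * i) = (q i).1
  right : ∀ i : Fin s, a (a (n + 1) + 2 + 2 * i) = (q i).2

/-- The initial state with input arrays `a`, `b`: they are array number `0`, all else is zero. -/
def startState (a : ℕ → ℕ) (b : ℕ → ℝ) : State where
  nr _ := 0
  xr _ := 0
  na t i := if t = 0 then a i else 0
  xa t i := if t = 0 then b i else 0

/-- Array number `1` holds the sketch: the vectors `σ u` as sparse vectors, each one the list of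
its nonzero coordinates in increasing order of the index, and the numbers `d u`. -/
structure StoresSketch {n : ℕ} (d : Fin n → ℝ) (σ : Fin n → Fin n → ℝ) (s : State) : Prop where
  rows : StoresRows n (s.na 1) (s.xa 1) (Matrix.of σ)
  sorted : ∀ (u : Fin n) (p q : ℕ), InRow (s.na 1) u p → InRow (s.na 1) u q → p < q →
    s.na 1 p < s.na 1 q
  degs : ∀ u : Fin n, s.xa 1 u = d u

/-- The estimate of `R(u,v)` obtained from the vectors `σ u` and `σ v` and the degrees `d`. -/
def estimate {n : ℕ} (d : Fin n → ℝ) (σ : Fin n → Fin n → ℝ) (u v : Fin n) : ℝ :=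
  1 / d u * σ u u - 1 / d v * σ u v + 1 / d v * σ v v - 1 / d u * σ v u

/-- The number of nonzero coordinates of a vector. -/
def nnz {n : ℕ} (x : Fin n → ℝ) : ℕ := {v | x v ≠ 0}.ncard

/-- `r` is a `(1 + ε)`-approximation of `R`. -/
def Approx (ε R r : ℝ) : Prop := (1 - ε) * R ≤ r ∧ r ≤ (1 + ε) * R

/-- `m + n ε⁻² ν⁻³ log n log³(nW/ε)`. -/
def sketchTime (n m : ℕ) (W ε ν : ℝ) : ℝ :=
  m + n * (ε ^ 2)⁻¹ * (ν ^ 3)⁻¹ * Real.log n * Real.log (n * W / ε) ^ 3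

end ResistanceSketch

end

open scoped Matrix

noncomputable section

namespace ResistanceSketch

/-! ### A program logic -/

/-! Let P = (I + D⁻¹A)/2 be the lazy random walk, so that I - P = D⁻¹L/2. If z = L⁺(1_u - 1_v), then
L z = 1_u - 1_v because the graph is connected, and half of the sum of P^k over k < ℓ, applied to
D⁻¹(1_u - 1_v) = D⁻¹L z, telescopes to z - P^ℓ z. Hence the four-term estimate formed from the
expected visit counts, σ_u(v) = half the expected number of visits to v in the first ℓ steps from u,
equals R(u,v) minus the pairing of 1_u - 1_v with P^ℓ z. In an eigenbasis of the normalised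
Laplacian both R and this remainder are sums over the same nonnegative terms, the remainder carrying
the additional factors (1 - λ/2)^ℓ; so the truncation error is at most (1 - ν₂/2)^ℓ R
(`WGraph.estimate_visits`). The error is relative, which is why ℓ of order log(2/ε)/ν₂ suffices.

The expectations are replaced by frequencies. Testing the Laplacian form with the indicator of u
gives 1/d_u ≤ R(u,v), so an additive error of ε/8 in every σ_u(v) costs at most a further (ε/2)
R(u,v) (`WGraph.approx_of_close`). A walk visits v between 0 and ℓ times, and a Chernoff bound with
a union bound over all pairs shows that r of order ℓ² log n / ε² walks from each vertex give
accuracy ε/16 everywhere (`WGraph.table_accurate`). Dropping every count below rε/8 costs another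
ε/16 at most (`sparse_close`); since the counts of a row add up to exactly rℓ, at most 8ℓ/ε of them
remain, whatever the random choices.

On the machine, a step of the walk takes constant time after alias tables have been built in time
linear in the number of edges (`WGraph.Tables.nextPMF_eq`). A vertex enters the list of kept
vertices when its count crosses the threshold. Sorting k kept vertices takes of the order of k² ≤ r
steps, which the walks dominate, so the total is of order m + n r ℓ (`sketch_good`). A query is four
binary searches (`query_ends`), and a batch is the sketch followed by queries (`batch_good`).

Programs and mathematics are linked by `Good`, a coupling of the final state of the machine with an
abstract random variable. The sketch is coupled with the table `WGraph.tablePMF` of visit counts,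
and all probability estimates concern that table only. `sketch_spec` and `batch_spec` combine the
two sides. -/

theorem pmf_bind_congr {α β : Type*} (p : PMF α) {f g : α → PMF β}
    (h : ∀ a ∈ p.support, f a = g a) : p.bind f = p.bind g := by
  ext b
  rw [PMF.bind_apply, PMF.bind_apply]
  refine tsum_congr fun a => ?_
  by_cases ha : a ∈ p.support
  · rw [h a ha]
  · rw [(PMF.apply_eq_zero_iff p a).2 ha, zero_mul, zero_mul]

/-- Every computation of `T` steps started in `(k, s)` has halted. -/
def Halts (k : List Prog) (s : State) (T : ℕ) : Prop := ∀ c ∈ (run T (k, s)).support, c.1 = []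

theorem run_nil (T : ℕ) (s : State) : run T ([], s) = PMF.pure ([], s) := by
  induction T with
  | zero => rfl
  | succ T ih => rw [run, step, PMF.pure_bind, ih]

theorem run_add (T T' : ℕ) (c : List Prog × State) : run (T + T') c = (run T c).bind (run T') := by
  induction T generalizing c with
  | zero => simp [run]
  | succ T ih =>
    rw [Nat.succ_add, run, run, PMF.bind_bind]
    exact pmf_bind_congr _ fun c' _ => ih c'

theorem Halts.run_eq {k : List Prog} {s : State} {T T' : ℕ} (h : Halts k s T) (hT : T ≤ T') :
    run T' (k, s) = run T (k, s) := by
  obtain ⟨d, rfl⟩ := Nat.exists_eq_add_of_le hT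
  rw [run_add]
  conv_rhs => rw [← PMF.bind_pure (run T (k, s))]
  refine pmf_bind_congr _ fun c hc => ?_
  obtain ⟨c1, c2⟩ := c
  obtain rfl : c1 = [] := h _ hc
  exact run_nil d c2

/-- A step inspects only the first pending program, so what lies below it is carried along. -/
theorem step_append (p : Prog) (k k' : List Prog) (s : State) :
    step (p :: (k ++ k'), s) = (step (p :: k, s)).map (fun c => (c.1 ++ k', c.2)) := by
  cases p <;> simp only [step, PMF.pure_map, PMF.map_comp, List.cons_append] <;> try rfl
  split_ifs <;> rfl

/-- Different branches may finish `k` at different times, so some spend part of the first T steps on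
`k'`. Since `k'` halts within T' from every final state of `k`, surplus time does not matter and
both sides agree. -/
theorem run_append {k k' : List Prog} {s : State} {T T' : ℕ}
    (h : ∀ c ∈ (run T (k, s)).support, c.1 = [] ∧ Halts k' c.2 T') :
    run (T + T') (k ++ k', s) = (run T (k, s)).bind (fun c => run T' (k', c.2)) := by
  induction T generalizing k s with
  | zero =>
    have h0 := h (k, s) (by simp [run])
    simp only at h0
    obtain ⟨rfl, -⟩ := h0
    simp [run]
  | succ T ih =>
    cases k with
    | nil =>
      rw [run_nil] at h ⊢
      rw [PMF.pure_bind, List.nil_append]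
      exact (h ([], s) (by simp)).2.run_eq (by omega)
    | cons p k =>
      rw [Nat.succ_add, run, run, List.cons_append, step_append, PMF.bind_map, PMF.bind_bind]
      refine pmf_bind_congr _ fun c hc => ?_
      obtain ⟨k1, s1⟩ := c
      refine ih fun c' hc' => h c' ?_
      rw [run, PMF.mem_support_bind_iff]
      exact ⟨_, hc, hc'⟩

/-- Started with the programs `k` in the state `s`, the machine halts within `T` steps, and its final
state can be coupled with a random variable of distribution `μ` so that `Q` always holds. -/
def Good {α : Type} (k : List Prog) (s : State) (T : ℕ) (μ : PMF α) (Q : α → State → Prop) : Prop :=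
  ∃ J : PMF (α × State), run T (k, s) = J.map (fun x => ([], x.2)) ∧ J.map Prod.fst = μ ∧
    ∀ x ∈ J.support, Q x.1 x.2

/-- `Good` for a trivial random variable: the machine halts within `T` steps and `Q` holds then. -/
abbrev Ends (k : List Prog) (s : State) (T : ℕ) (Q : State → Prop) : Prop :=
  Good k s T (PMF.pure ()) (fun _ => Q)

section rules

variable {α β : Type} {k : List Prog} {s : State} {T T' : ℕ} {μ : PMF α} {Q : α → State → Prop}

theorem Good.halts (h : Good k s T μ Q) : Halts k s T := by
  obtain ⟨J, hJ, -, -⟩ := h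
  intro c hc
  rw [hJ, PMF.mem_support_map_iff] at hc
  obtain ⟨x, -, rfl⟩ := hc
  rfl

theorem Good.mono_time (h : Good k s T μ Q) (hT : T ≤ T') : Good k s T' μ Q := by
  have h1 := h.halts.run_eq hT
  obtain ⟨J, hJ, h2⟩ := h
  exact ⟨J, h1.trans hJ, h2⟩

theorem Good.mono (h : Good k s T μ Q) {Q' : α → State → Prop} (hQ : ∀ a t, Q a t → Q' a t) :
    Good k s T μ Q' := by
  obtain ⟨J, h1, h2, h3⟩ := h
  exact ⟨J, h1, h2, fun x hx => hQ _ _ (h3 x hx)⟩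

theorem Good.mem (h : Good k s T μ Q) : Good k s T μ (fun a t => a ∈ μ.support ∧ Q a t) := by
  obtain ⟨J, h1, h2, h3⟩ := h
  refine ⟨J, h1, h2, fun x hx => ⟨?_, h3 x hx⟩⟩
  rw [← h2, PMF.mem_support_map_iff]
  exact ⟨x, hx, rfl⟩

/-- Properties of all reachable final states may be added to the postcondition. -/
theorem Good.and {P : State → Prop} (h : Good k s T μ Q)
    (hP : ∀ c ∈ (run T (k, s)).support, P c.2) : Good k s T μ (fun a t => Q a t ∧ P t) := by
  obtain ⟨J, h1, h2, h3⟩ := h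
  refine ⟨J, h1, h2, fun x hx => ⟨h3 x hx, hP ([], x.2) ?_⟩⟩
  rw [h1, PMF.mem_support_map_iff]
  exact ⟨x, hx, rfl⟩

theorem Good.map (h : Good k s T μ Q) (f : α → β) {Q' : β → State → Prop}
    (hQ : ∀ a t, Q a t → Q' (f a) t) : Good k s T (μ.map f) Q' := by
  obtain ⟨J, h1, h2, h3⟩ := h
  refine ⟨J.map (fun x => (f x.1, x.2)), ?_, ?_, ?_⟩
  · rw [h1, PMF.map_comp]; rfl
  · rw [← h2, PMF.map_comp, PMF.map_comp]; rfl
  · intro x hx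
    rw [PMF.mem_support_map_iff] at hx
    obtain ⟨y, hy, rfl⟩ := hx
    exact hQ _ _ (h3 y hy)

theorem Good.append {k' : List Prog} {ν : α → PMF β} {Q' : β → State → Prop} (h : Good k s T μ Q)
    (h' : ∀ a t, Q a t → Good k' t T' (ν a) Q') : Good (k ++ k') s (T + T') (μ.bind ν) Q' := by
  classical
  obtain ⟨J, h1, h2, h3⟩ := h
  have hex : ∀ x : α × State, ∃ K : PMF (β × State), K.map Prod.fst = ν x.1 ∧ (Q x.1 x.2 →
      run T' (k', x.2) = K.map (fun y => ([], y.2)) ∧ ∀ y ∈ K.support, Q' y.1 y.2) := by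
    intro x
    by_cases hx : Q x.1 x.2
    · obtain ⟨K, a1, a2, a3⟩ := h' _ _ hx
      exact ⟨K, a2, fun _ => ⟨a1, a3⟩⟩
    -- Pairs violating `Q` have probability zero under `J`; an arbitrary coupling with the right
    -- first marginal makes `K` total.
    · refine ⟨(ν x.1).map (fun b => (b, x.2)), ?_, fun h => absurd h hx⟩
      rw [PMF.map_comp]
      exact PMF.map_id _
  choose K hK1 hK2 using hex
  refine ⟨J.bind K, ?_, ?_, ?_⟩
  · rw [run_append, h1, PMF.bind_map, PMF.map_bind]
    · exact pmf_bind_congr _ fun x hx => (hK2 x (h3 x hx)).1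
    · intro c hc
      rw [h1, PMF.mem_support_map_iff] at hc
      obtain ⟨x, hx, rfl⟩ := hc
      exact ⟨rfl, (h' _ _ (h3 x hx)).halts⟩
  · rw [PMF.map_bind, ← h2, PMF.bind_map]
    exact pmf_bind_congr _ fun x _ => hK1 x
  · intro y hy
    rw [PMF.mem_support_bind_iff] at hy
    obtain ⟨x, hx, hy⟩ := hy
    exact (hK2 x (h3 x hx)).2 y hy

theorem Good.nil {a : α} (h : Q a s) (T : ℕ) : Good [] s T (PMF.pure a) Q :=
  ⟨PMF.pure (a, s), by rw [run_nil, PMF.pure_map], by rw [PMF.pure_map], by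
    intro x hx
    rw [PMF.mem_support_pure_iff] at hx
    rw [hx]; exact h⟩

theorem Good.of_step {c : List Prog × State} {k' : List Prog} {s' : State}
    (hc : step c = PMF.pure (k', s')) (h : Good k' s' T μ Q) : Good c.1 c.2 (T + 1) μ Q := by
  obtain ⟨J, h1, h2, h3⟩ := h
  exact ⟨J, by rw [run, hc, PMF.pure_bind, h1], h2, h3⟩

theorem Good.skip (h : Good k s T μ Q) : Good (.skip :: k) s (T + 1) μ Q :=
  Good.of_step (c := (.skip :: k, s)) rfl h

theorem Good.seq {p q : Prog} (h : Good (p :: q :: k) s T μ Q) :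
    Good (.seq p q :: k) s (T + 1) μ Q :=
  Good.of_step (c := (.seq p q :: k, s)) rfl h

theorem Good.ite {b : Test} {p q : Prog} (h1 : b.holds s → Good (p :: k) s T μ Q)
    (h2 : ¬ b.holds s → Good (q :: k) s T μ Q) : Good (.ite b p q :: k) s (T + 1) μ Q := by
  by_cases hb : b.holds s
  · exact Good.of_step (c := (.ite b p q :: k, s)) (by rw [step, if_pos hb]) (h1 hb)
  · exact Good.of_step (c := (.ite b p q :: k, s)) (by rw [step, if_neg hb]) (h2 hb)

theorem Good.loop_true {b : Test} {p : Prog} (hb : b.holds s)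
    (h : Good (p :: .loop b p :: k) s T μ Q) : Good (.loop b p :: k) s (T + 1) μ Q :=
  Good.of_step (c := (.loop b p :: k, s)) (by rw [step, if_pos hb]) h

theorem Good.loop_false {b : Test} {p : Prog} (hb : ¬ b.holds s)
    (h : Good k s T μ Q) : Good (.loop b p :: k) s (T + 1) μ Q :=
  Good.of_step (c := (.loop b p :: k, s)) (by rw [step, if_neg hb]) h

theorem Good.basic_bind {c : Instr} {ι : Type} {ρ : PMF ι} {f : ι → State} {ν : ι → PMF α}
    (hc : c.exec s = ρ.map f) (h : ∀ i ∈ ρ.support, Good k (f i) T (ν i) Q) :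
    Good (.basic c :: k) s (T + 1) (ρ.bind ν) Q := by
  classical
  have hex : ∀ i, ∃ K : PMF (α × State), K.map Prod.fst = ν i ∧ (i ∈ ρ.support →
      run T (k, f i) = K.map (fun y => ([], y.2)) ∧ ∀ y ∈ K.support, Q y.1 y.2) := by
    intro i
    by_cases hi : i ∈ ρ.support
    · obtain ⟨K, a1, a2, a3⟩ := h i hi
      exact ⟨K, a2, fun _ => ⟨a1, a3⟩⟩
    · refine ⟨(ν i).map (fun b => (b, s)), ?_, fun h => absurd h hi⟩
      rw [PMF.map_comp]
      exact PMF.map_id _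
  choose K hK1 hK2 using hex
  refine ⟨ρ.bind K, ?_, ?_, ?_⟩
  · rw [run, step, hc, PMF.map_comp, PMF.bind_map, PMF.map_bind]
    exact pmf_bind_congr _ fun i hi => (hK2 i hi).1
  · rw [PMF.map_bind]
    exact pmf_bind_congr _ fun i _ => hK1 i
  · intro y hy
    rw [PMF.mem_support_bind_iff] at hy
    obtain ⟨i, hi, hy⟩ := hy
    exact (hK2 i hi).2 y hy

theorem mem_support_randPMF {m j : ℕ} (hm : 0 < m) (h : j ∈ (randPMF m).support) : j < m := by
  rw [randPMF, dif_pos hm, PMF.mem_support_uniformOfFinset_iff] at h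
  exact Finset.mem_range.1 h

theorem Good.nrand {r i : ℕ} {ν : ℕ → PMF α}
    (h : ∀ j ∈ (randPMF (s.nr i)).support, Good k (s.setN r j) T (ν j) Q) :
    Good (.basic (.nrand r i) :: k) s (T + 1) ((randPMF (s.nr i)).bind ν) Q :=
  Good.basic_bind rfl h

theorem Good.coin {r x : ℕ} {ν : Bool → PMF α}
    (h : ∀ b ∈ (coinPMF (s.xr x)).support, Good k (s.setN r (cond b 1 0)) T (ν b) Q) :
    Good (.basic (.coin r x) :: k) s (T + 1) ((coinPMF (s.xr x)).bind ν) Q :=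
  Good.basic_bind rfl h

/-- The `j`-fold iteration of a random step that may depend on the time `i`. -/
def iter (κ : ℕ → α → PMF α) : ℕ → ℕ → α → PMF α
  | _, 0, a => PMF.pure a
  | i, j + 1, a => (κ i a).bind (iter κ (i + 1) j)

/-- Each round costs its body and one step for the test; the last 1 is the test that fails. The
budget may depend on the round, so that a loop over vertices can be charged by degree. -/
theorem Good.loop_from {b : Test} {p : Prog} {K : ℕ} {κ : ℕ → α → PMF α} {B : ℕ → ℕ}
    (I : ℕ → α → State → Prop)
    (hbody : ∀ i a t, i < K → I i a t → b.holds t ∧ Good [p] t (B i) (κ i a) (I (i + 1)))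
    (hend : ∀ a t, I K a t → ¬ b.holds t) (j : ℕ) :
    ∀ i a s, i + j = K → I i a s →
      Good [.loop b p] s (∑ l ∈ Finset.range j, (B (i + l) + 1) + 1) (iter κ i j a) (I K) := by
  induction j with
  | zero =>
    intro i a s hi hI
    obtain rfl : i = K := by omega
    exact Good.loop_false (hend a s hI) (Good.nil hI _)
  | succ j ih =>
    intro i a s hi hI
    obtain ⟨hb, hg⟩ := hbody i a s (by omega) hI
    refine Good.mono_time (Good.loop_true hb (hg.append fun a' t ht =>
      ih (i + 1) a' t (by omega) ht)) ?_
    rw [Finset.sum_range_succ']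
    simp only [add_zero, Nat.add_assoc, Nat.add_comm 1]
    omega

end rules

/-! ### Blocks of deterministic instructions -/

/-- The effect of a deterministic instruction. -/
def Instr.det (s : State) : Instr → State
  | .nconst r k => s.setN r k
  | .nadd r i j => s.setN r (s.nr i + s.nr j)
  | .nsub r i j => s.setN r (s.nr i - s.nr j)
  | .nload r t i => s.setN r (s.na t (s.nr i))
  | .nstore t i r => s.putN t (s.nr i) (s.nr r)
  | .nrand _ _ => s
  | .coin _ _ => s
  | .xconst x q => s.setX x (q : ℝ)
  | .xcast x i => s.setX x (s.nr i : ℝ)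
  | .xadd x y z => s.setX x (s.xr y + s.xr z)
  | .xsub x y z => s.setX x (s.xr y - s.xr z)
  | .xmul x y z => s.setX x (s.xr y * s.xr z)
  | .xdiv x y z => s.setX x (s.xr y / s.xr z)
  | .xload x t i => s.setX x (s.xa t (s.nr i))
  | .xstore t i x => s.putX t (s.nr i) (s.xr x)

def Instr.isDet : Instr → Bool
  | .nrand _ _ => false
  | .coin _ _ => false
  | _ => true

theorem Instr.exec_eq {c : Instr} (h : c.isDet = true) (s : State) :
    c.exec s = PMF.pure (c.det s) := by
  cases c <;> first | rfl | cases h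

/-- The program that executes the instructions of a list one after the other. -/
def blk : List Instr → Prog
  | [] => .skip
  | c :: l => .seq (.basic c) (blk l)

theorem Good.basic {α : Type} {k : List Prog} {s : State} {T : ℕ} {μ : PMF α}
    {Q : α → State → Prop} {c : Instr} (hc : c.isDet = true) (h : Good k (c.det s) T μ Q) :
    Good (.basic c :: k) s (T + 1) μ Q :=
  Good.of_step (c := (.basic c :: k, s)) (by rw [step, Instr.exec_eq hc, PMF.pure_map]) h

theorem Good.blk {α : Type} {k : List Prog} {T : ℕ} {μ : PMF α} {Q : α → State → Prop}
    {l : List Instr} (hl : l.all Instr.isDet = true) {s : State}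
    (h : Good k (l.foldl Instr.det s) T μ Q) : Good (blk l :: k) s (T + (2 * l.length + 1)) μ Q := by
  induction l generalizing s with
  | nil => exact h.skip
  | cons c l ih =>
    rw [List.all_cons, Bool.and_eq_true] at hl
    exact Good.mono_time (Good.seq (Good.basic hl.1 (ih hl.2 h))) (by rw [List.length_cons]; omega)

/-! ### Contents of the memory after an update. -/

namespace State

variable (s : State) (r a t i j : ℕ) (x : ℝ)

@[simp] theorem setN_nr : (s.setN r a).nr j = if j = r then a else s.nr j := by
  simp [setN, Function.update_apply]
@[simp] theorem setN_xr : (s.setN r a).xr = s.xr := rfl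
@[simp] theorem setN_na : (s.setN r a).na = s.na := rfl
@[simp] theorem setN_xa : (s.setN r a).xa = s.xa := rfl
@[simp] theorem setX_nr : (s.setX r x).nr = s.nr := rfl
@[simp] theorem setX_xr : (s.setX r x).xr j = if j = r then x else s.xr j := by
  simp [setX, Function.update_apply]
@[simp] theorem setX_na : (s.setX r x).na = s.na := rfl
@[simp] theorem setX_xa : (s.setX r x).xa = s.xa := rfl
@[simp] theorem putN_nr : (s.putN t i a).nr = s.nr := rfl
@[simp] theorem putN_xr : (s.putN t i a).xr = s.xr := rfl
@[simp] theorem putN_na : (s.putN t i a).na j =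
    if j = t then Function.update (s.na t) i a else s.na j := by
  simp only [putN, Function.update_apply]
@[simp] theorem putN_xa : (s.putN t i a).xa = s.xa := rfl
@[simp] theorem putX_nr : (s.putX t i x).nr = s.nr := rfl
@[simp] theorem putX_xr : (s.putX t i x).xr = s.xr := rfl
@[simp] theorem putX_na : (s.putX t i x).na = s.na := rfl
@[simp] theorem putX_xa : (s.putX t i x).xa j =
    if j = t then Function.update (s.xa t) i x else s.xa j := by
  simp only [putX, Function.update_apply]

end State

attribute [simp] Instr.det Test.holds

/-! ### Frames -/

/-- The four kinds of memory. -/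
inductive Kind where
  | nr | xr | na | xa

/-- The register or the array that an instruction changes. -/
def Instr.dest : Instr → Kind × ℕ
  | .nconst r _ => (.nr, r)
  | .nadd r _ _ => (.nr, r)
  | .nsub r _ _ => (.nr, r)
  | .nload r _ _ => (.nr, r)
  | .nstore t _ _ => (.na, t)
  | .nrand r _ => (.nr, r)
  | .coin r _ => (.nr, r)
  | .xconst x _ => (.xr, x)
  | .xcast x _ => (.xr, x)
  | .xadd x _ _ => (.xr, x)
  | .xsub x _ _ => (.xr, x)
  | .xmul x _ _ => (.xr, x)
  | .xdiv x _ _ => (.xr, x)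
  | .xload x _ _ => (.xr, x)
  | .xstore t _ _ => (.xa, t)

/-- A Boolean function that reduces by evaluation, so that frame conditions of concrete programs
hold by `rfl`. -/
def Kind.same : Kind → Kind → Bool
  | .nr, .nr => true
  | .xr, .xr => true
  | .na, .na => true
  | .xa, .xa => true
  | _, _ => false

/-- The program never changes the register or array `r` of kind `κ`. -/
def Prog.keeps (κ : Kind) (r : ℕ) : Prog → Bool
  | .skip => true
  | .basic c => !(κ.same c.dest.1 && Nat.beq r c.dest.2)
  | .seq p q => p.keeps κ r && q.keeps κ r
  | .ite _ p q => p.keeps κ r && q.keeps κ r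
  | .loop _ p => p.keeps κ r

/-- The contents of a register or array, of whichever kind. -/
def State.get (s : State) : Kind → ℕ → ℕ × ℝ × (ℕ → ℕ) × (ℕ → ℝ)
  | .nr, r => (s.nr r, 0, 0, 0)
  | .xr, r => (0, s.xr r, 0, 0)
  | .na, r => (0, 0, s.na r, 0)
  | .xa, r => (0, 0, 0, s.xa r)

theorem Instr.get_eq {c : Instr} {s t : State} (h : t ∈ (c.exec s).support) {κ : Kind} {r : ℕ}
    (hk : (Prog.basic c).keeps κ r = true) : t.get κ r = s.get κ r := by
  have hne : ∀ a b : ℕ, (Nat.beq a b) = false → a ≠ b := by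
    intro a b hab e
    rw [e, Nat.beq_refl] at hab
    cases hab
  cases c <;> simp only [Instr.exec, PMF.mem_support_pure_iff, PMF.mem_support_map_iff] at h <;>
    first
    | (subst h; cases κ <;> simp only [Prog.keeps, Instr.dest, Kind.same, Bool.true_and,
        Bool.false_and, Bool.not_eq_true', State.get] at hk ⊢ <;> first | rfl | simp [hne _ _ hk])
    | (obtain ⟨_, -, rfl⟩ := h; cases κ <;> simp only [Prog.keeps, Instr.dest, Kind.same,
        Bool.true_and, Bool.false_and, Bool.not_eq_true', State.get] at hk ⊢ <;>
        first | rfl | simp [hne _ _ hk])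

/-- The programs pending after a step are parts of those pending before, so the syntactic condition
is inherited and can be iterated in `run_get`. -/
theorem step_get {κ : Kind} {r : ℕ} {k k' : List Prog} {s s' : State}
    (h : (k', s') ∈ (step (k, s)).support) (hk : ∀ p ∈ k, p.keeps κ r = true) :
    (∀ p ∈ k', p.keeps κ r = true) ∧ s'.get κ r = s.get κ r := by
  cases k with
  | nil =>
    simp only [step, PMF.mem_support_pure_iff, Prod.mk.injEq] at h
    obtain ⟨rfl, rfl⟩ := h
    exact ⟨hk, rfl⟩
  | cons p k =>
    have hp := hk p (by simp)
    have hk' : ∀ q ∈ k, q.keeps κ r = true := fun q hq => hk q (by simp [hq])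
    cases p <;> simp only [step, PMF.mem_support_pure_iff, PMF.mem_support_map_iff,
      Prod.mk.injEq] at h
    case skip => obtain ⟨rfl, rfl⟩ := h; exact ⟨hk', rfl⟩
    case basic c =>
      obtain ⟨t, ht, rfl, rfl⟩ := h
      exact ⟨hk', Instr.get_eq ht hp⟩
    case seq p q =>
      obtain ⟨rfl, rfl⟩ := h
      rw [Prog.keeps, Bool.and_eq_true] at hp
      refine ⟨?_, rfl⟩
      simp only [List.mem_cons, forall_eq_or_imp]
      exact ⟨hp.1, hp.2, hk'⟩
    case ite b p q =>
      obtain ⟨rfl, rfl⟩ := h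
      rw [Prog.keeps, Bool.and_eq_true] at hp
      refine ⟨?_, rfl⟩
      simp only [List.mem_cons, forall_eq_or_imp]
      refine ⟨?_, hk'⟩
      split_ifs
      exacts [hp.1, hp.2]
    case loop b p =>
      split_ifs at h <;> obtain ⟨rfl, rfl⟩ := h
      · refine ⟨?_, rfl⟩
        simp only [List.mem_cons, forall_eq_or_imp]
        exact ⟨hp, hp, hk'⟩
      · exact ⟨hk', rfl⟩

theorem run_get {κ : Kind} {r : ℕ} {k : List Prog} {s : State} {T : ℕ} {c : List Prog × State}
    (h : c ∈ (run T (k, s)).support) (hk : ∀ p ∈ k, p.keeps κ r = true) :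
    c.2.get κ r = s.get κ r := by
  induction T generalizing k s with
  | zero =>
    simp only [run, PMF.mem_support_pure_iff] at h
    rw [h]
  | succ T ih =>
    rw [run, PMF.mem_support_bind_iff] at h
    obtain ⟨⟨k', s'⟩, h1, h2⟩ := h
    obtain ⟨h3, h4⟩ := step_get h1 hk
    exact (ih h2 h3).trans h4

/-- The states `s` and `t` agree on everything that `p` never changes. -/
structure Frame (p : Prog) (s t : State) : Prop where
  get : ∀ κ r, p.keeps κ r = true → t.get κ r = s.get κ r

namespace Frame

variable {p : Prog} {s t : State} (h : Frame p s t) (r : ℕ)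
include h

theorem nr (hr : p.keeps .nr r = true) : t.nr r = s.nr r := by
  simpa [State.get] using h.get _ _ hr
theorem xr (hr : p.keeps .xr r = true) : t.xr r = s.xr r := by
  simpa [State.get] using h.get _ _ hr
theorem na (hr : p.keeps .na r = true) : t.na r = s.na r := by
  simpa [State.get] using h.get _ _ hr
theorem xa (hr : p.keeps .xa r = true) : t.xa r = s.xa r := by
  simpa [State.get] using h.get _ _ hr

end Frame

/-- The frame holds in every reachable state, hence can be joined to any postcondition.
Specifications therefore need to mention only what a program computes, not what it leaves alone. -/
theorem Good.frame {α : Type} {p : Prog} {s : State} {T : ℕ} {μ : PMF α} {Q : α → State → Prop}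
    (h : Good [p] s T μ Q) : Good [p] s T μ (fun a t => Q a t ∧ Frame p s t) :=
  h.and (P := Frame p s) fun _ hc => ⟨fun _ _ hk => run_get hc (by simpa using hk)⟩

theorem Frame.refl (p : Prog) (s : State) : Frame p s s := ⟨fun _ _ _ => rfl⟩

theorem Frame.trans {p : Prog} {s t u : State} (h : Frame p s t) (h' : Frame p t u) :
    Frame p s u := ⟨fun κ r hr => (h'.get κ r hr).trans (h.get κ r hr)⟩

/-! ### Sequences and loops -/

section rules

variable {α β : Type} {k : List Prog} {s : State} {T T' : ℕ} {μ : PMF α} {Q : α → State → Prop}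

theorem Good.comp {p : Prog} {ν : α → PMF β} {Q' : β → State → Prop} (h : Good [p] s T μ Q)
    (h' : ∀ a t, Frame p s t → Q a t → Good k t T' (ν a) Q') :
    Good (p :: k) s (T + T') (μ.bind ν) Q' :=
  h.frame.append fun a t ht => h' a t ht.2 ht.1

theorem Ends.comp {p : Prog} {P : State → Prop} (h : Ends [p] s T P)
    (h' : ∀ t, Frame p s t → P t → Good k t T' μ Q) : Good (p :: k) s (T + T') μ Q := by
  have := Good.comp h (ν := fun _ => μ) (fun _ t ht => h' t ht)
  rwa [PMF.pure_bind] at this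

theorem Good.comp_pure {p : Prog} {P : α → State → Prop} {f : α → β} {Q' : β → State → Prop}
    (h : Good [p] s T μ P)
    (h' : ∀ a t, Frame p s t → P a t → Good k t T' (PMF.pure (f a)) Q') :
    Good (p :: k) s (T + T') (μ.map f) Q' :=
  Good.comp h h'

/-- A loop that runs exactly `K` times. -/
theorem Good.loop {b : Test} {p : Prog} {a : α} (K : ℕ) {κ : ℕ → α → PMF α} {B : ℕ → ℕ}
    (I : ℕ → α → State → Prop) (h0 : I 0 a s)
    (hbody : ∀ i a t, i < K → Frame p s t → I i a t →
      b.holds t ∧ Good [p] t (B i) (κ i a) (I (i + 1)))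
    (hend : ∀ a t, Frame p s t → I K a t → ¬ b.holds t) :
    Good [.loop b p] s (∑ l ∈ Finset.range K, (B l + 1) + 1) (iter κ 0 K a) (I K) := by
  have := Good.loop_from (b := b) (p := p) (B := B) (κ := κ) (fun i a t => Frame p s t ∧ I i a t)
    (fun i a t hi ht => ⟨(hbody i a t hi ht.1 ht.2).1,
      (hbody i a t hi ht.1 ht.2).2.frame.mono fun a' t' h => ⟨ht.1.trans h.2, h.1⟩⟩)
    (fun a t ht => hend a t ht.1 ht.2) K 0 a s (by omega) ⟨Frame.refl p s, h0⟩
  simp only [Nat.zero_add] at this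
  exact this.mono fun _ _ h => h.2

theorem iter_unit (i j : ℕ) (u : Unit) :
    iter (fun _ _ => PMF.pure ()) i j u = PMF.pure () := by
  induction j generalizing i with
  | zero => rfl
  | succ j ih => rw [iter, PMF.pure_bind]; exact ih _

theorem Ends.loop {b : Test} {p : Prog} (K : ℕ) {B : ℕ → ℕ} (I : ℕ → State → Prop) (h0 : I 0 s)
    (hbody : ∀ i t, i < K → Frame p s t → I i t → b.holds t ∧ Ends [p] t (B i) (I (i + 1)))
    (hend : ∀ t, Frame p s t → I K t → ¬ b.holds t) :
    Ends [.loop b p] s (∑ l ∈ Finset.range K, (B l + 1) + 1) (I K) := by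
  have := Good.loop (a := ()) K (κ := fun _ _ => PMF.pure ()) (fun i _ t => I i t) h0
    (fun i _ t hi hf ht => hbody i t hi hf ht) (fun _ t hf ht => hend t hf ht)
  rwa [iter_unit] at this

theorem Ends.loop_const {b : Test} {p : Prog} (K B : ℕ) (I : ℕ → State → Prop) (h0 : I 0 s)
    (hbody : ∀ i t, i < K → Frame p s t → I i t → b.holds t ∧ Ends [p] t B (I (i + 1)))
    (hend : ∀ t, Frame p s t → I K t → ¬ b.holds t) :
    Ends [.loop b p] s (K * (B + 1) + 1) (I K) := by
  have := Ends.loop K I h0 hbody hend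
  simpa only [Finset.sum_const, Finset.card_range, smul_eq_mul] using this

/-- A loop with a decreasing variant. -/
theorem Ends.loop_variant {b : Test} {p : Prog} (B : ℕ) (I : ℕ → State → Prop)
    (m : ℕ) (h0 : I m s)
    (hbody : ∀ m t, Frame p s t → I m t → b.holds t → ∃ m', m = m' + 1 ∧ Ends [p] t B (I m')) :
    Ends [.loop b p] s (m * (B + 1) + 1) (fun t => (∃ m', I m' t) ∧ ¬ b.holds t) := by
  suffices H : ∀ m t, Frame p s t → I m t →
      Ends [.loop b p] t (m * (B + 1) + 1) (fun t => (∃ m', I m' t) ∧ ¬ b.holds t) from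
    H m s (Frame.refl p s) h0
  intro m
  induction m with
  | zero =>
    intro t hf hI
    have hb : ¬ b.holds t := fun hb => by
      obtain ⟨m', hm', -⟩ := hbody 0 t hf hI hb
      omega
    exact Good.mono_time (T := 0 + 1) (Good.loop_false hb (Good.nil ⟨⟨0, hI⟩, hb⟩ _)) (by omega)
  | succ m ih =>
    intro t hf hI
    by_cases hb : b.holds t
    · obtain ⟨m', hm', hg⟩ := hbody _ t hf hI hb
      obtain rfl : m = m' := by omega
      refine Good.mono_time (Good.loop_true hb (Ends.comp hg fun t' hf' ht' =>
        ih t' (hf.trans hf') ht')) ?_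
      ring_nf
      omega
    · exact Good.mono_time (T := 0 + 1) (Good.loop_false hb (Good.nil ⟨⟨_, hI⟩, hb⟩ _)) (by omega)

/-- A block of deterministic instructions that establishes `P`. -/
theorem Good.blk_then {l : List Instr} (P : State → Prop) (hl : l.all Instr.isDet = true)
    (hP : P (l.foldl Instr.det s))
    (h : ∀ t, Frame (ResistanceSketch.blk l) s t → P t → Good k t T μ Q) :
    Good (ResistanceSketch.blk l :: k) s (2 * l.length + 1 + T) μ Q :=
  Good.mono_time (Ends.comp (Good.blk hl (Good.nil hP 0)) h) (by omega)

end rules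

/-! ### Consequences for the distribution of the outcome -/

theorem Good.surely {α : Type} {p : Prog} {s : State} {N : ℕ} {T : ℝ} {μ : PMF α}
    {Q : α → State → Prop} (h : Good [p] s N μ Q) (hT : (N : ℝ) ≤ T) {P : State → Prop}
    (hP : ∀ a t, a ∈ μ.support → Q a t → P t) : Surely p s T P := by
  obtain ⟨J, h1, h2, h3⟩ := (h.mono_time (Nat.le_floor hT)).mem
  intro c hc
  rw [h1, PMF.mem_support_map_iff] at hc
  obtain ⟨x, hx, rfl⟩ := hc
  exact ⟨rfl, hP _ _ (h3 x hx).1 (h3 x hx).2⟩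

/-- Under the coupling, the event `A` for the abstract variable forces `P` for the final state. This
transfers every probabilistic estimate to the machine. -/
theorem Good.prob_ge {α : Type} {p : Prog} {s : State} {N : ℕ} {T : ℝ} {μ : PMF α}
    {Q : α → State → Prop} (h : Good [p] s N μ Q) (hT : (N : ℝ) ≤ T) {P : State → Prop}
    {A : Set α} (hP : ∀ a t, a ∈ A → a ∈ μ.support → Q a t → P t) :
    (μ.toOuterMeasure A).toReal ≤ prob p s T P := by
  obtain ⟨J, h1, h2, h3⟩ := (h.mono_time (Nat.le_floor hT)).mem
  unfold prob
  rw [h1, ← h2, PMF.toOuterMeasure_map_apply, PMF.toOuterMeasure_map_apply]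
  refine ENNReal.toReal_mono ?_ (PMF.toOuterMeasure_mono _ ?_)
  · refine ne_top_of_le_ne_top ENNReal.one_ne_top ?_
    rw [← (PMF.toOuterMeasure_apply_eq_one_iff J (s := Set.univ)).2 (Set.subset_univ _)]
    exact PMF.toOuterMeasure_mono _ (fun x _ => Set.mem_univ _)
  · rintro x ⟨hx, hJ⟩
    exact ⟨rfl, hP _ _ hx (h3 x hJ).1 (h3 x hJ).2⟩

/-! ### Looking up a coordinate of a sparse vector, and the query -/

/-- The entry with row `nr 2` and column `nr 3` of the matrix stored in array number `1` is put into
`xr 1`. The powers of two below the length of the row are tabulated in array number `2`, then the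
column is found by binary search. -/
def lookup : Prog :=
  .seq (blk [.nconst 4 1, .nconst 11 0, .nadd 9 2 4, .nload 5 1 9, .nadd 9 9 4, .nload 6 1 9,
    .nsub 10 6 5, .nconst 7 1, .nconst 8 0, .xconst 1 0]) <|
  .seq (.loop (.nle 7 10) (blk [.nstore 2 8 7, .nadd 8 8 4, .nadd 7 7 7])) <|
  .seq (.loop (.nlt 11 8)
    (.seq (blk [.nsub 8 8 4, .nload 7 2 8, .nadd 9 5 7])
      (.ite (.nle 9 6)
        (.seq (blk [.nsub 7 9 4, .nload 7 1 7]) (.ite (.nlt 7 3) (blk [.nadd 5 9 11]) .skip))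
        .skip)))
  (.ite (.nlt 5 6)
    (.seq (blk [.nload 7 1 5]) (.ite (.nle 7 3) (blk [.xload 1 1 5]) .skip)) .skip)

/-- Pigeonhole: the column indices in a row are distinct and below n. This bounds the number of
rounds of the binary search. -/
theorem StoresRows.row_length_le {n : ℕ} {a : ℕ → ℕ} {b : ℕ → ℝ} {M : Matrix (Fin n) (Fin n) ℝ}
    (h : StoresRows n a b M) (u : Fin n) : a (u + 2) - a (u + 1) ≤ n := by
  have h1 : ∀ p ∈ Finset.Ico (a (u + 1)) (a (u + 2)), a p ∈ Finset.range n := by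
    intro p hp
    obtain ⟨v, hv, -⟩ := h.entry u p (Finset.mem_Ico.1 hp)
    rw [hv, Finset.mem_range]
    exact v.2
  have h2 := Finset.card_le_card_of_injOn a h1 (by
    intro p hp q hq
    exact h.inj u p q (Finset.mem_Ico.1 hp) (Finset.mem_Ico.1 hq))
  simpa using h2

/-- The machine cannot halve an index, so the search advances a pointer by tabulated powers of two,
in decreasing order, as long as the entry just before the new position is smaller than v. The
pointer ends at the first column index that is at least v, if there is one. -/
theorem lookup_ends {n : ℕ} {d : Fin n → ℝ} {σ : Fin n → Fin n → ℝ} {u v : Fin n} {s : State}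
    (h : StoresSketch d σ s) (hu : s.nr 2 = u) (hv : s.nr 3 = v) :
    Ends [lookup] s (40 * Nat.size n + 60) (fun t => t.xr 1 = σ u v) := by
  set a := s.na 1 with ha
  set lo := a (u + 1) with hlo
  set hi := a (u + 2) with hhi
  have hlh : lo ≤ hi := h.rows.mono u
  have hlen : hi - lo ≤ n := h.rows.row_length_le u
  set K := Nat.size (hi - lo) with hK
  have hKn : K ≤ Nat.size n := Nat.size_le_size hlen
  have hpow : hi - lo < 2 ^ K := Nat.lt_size_self _
  -- A block of l instructions takes 2l + 1 steps, and each `seq` or `ite` one more. Both loops run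
  -- K times, where K is the bit length of the size of the row.
  refine Good.mono_time (T := 21 + (K * (7 + 1) + 1 + (K * (30 + 1) + 1 + 21 + 1) + 1) + 1) ?_
    (by omega)
  refine Good.seq (Good.blk_then (fun t => t.nr 4 = 1 ∧ t.nr 11 = 0 ∧ t.nr 5 = lo ∧ t.nr 6 = hi ∧
    t.nr 10 = hi - lo ∧ t.nr 7 = 1 ∧ t.nr 8 = 0 ∧ t.xr 1 = 0) rfl
    (by simp [hu, hlo, hhi, ha]) fun t hF ht => ?_)
  obtain ⟨e4, e11, e5, e6, e10, e7, e8, x1⟩ := ht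
  have e1 : t.na 1 = a := hF.na 1 rfl
  have y1 : t.xa 1 = s.xa 1 := hF.xa 1 rfl
  have e3 : t.nr 3 = v := (hF.nr 3 rfl).trans hv
  clear hF
  refine Good.seq (Ends.comp (Ends.loop_const K 7 (fun i t => t.nr 8 = i ∧ t.nr 7 = 2 ^ i ∧
    ∀ j < i, t.na 2 j = 2 ^ j) ⟨e8, e7, by simp⟩ ?_ ?_) fun t1 hF ht => ?_)
  · rintro i t1 hi hF ⟨h8, h7, h2⟩
    have h10 := hF.nr 10 rfl
    have h4 := hF.nr 4 rfl
    refine ⟨?_, Good.blk rfl (Good.nil ?_ 0)⟩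
    · rw [Test.holds, h7, h10, e10]
      exact Nat.lt_size.1 hi
    · simp only [List.foldl, Instr.det, State.setN_nr, State.putN_nr, State.setN_na, State.putN_na]
      refine ⟨by simp [h8, h4, e4], by simp [h7, pow_succ]; ring, fun j hj => ?_⟩
      simp only [if_true, Function.update_apply, h8]
      split_ifs with hji
      · rw [h7, hji]
      · exact h2 j (by omega)
  · rintro t1 hF ⟨h8, h7, h2⟩
    rw [Test.holds, h7, hF.nr 10 rfl, e10]
    omega
  obtain ⟨h8, -, h2⟩ := ht
  have f1 := (hF.na 1 rfl).trans e1
  have g1 := (hF.xa 1 rfl).trans y1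
  have f3 := (hF.nr 3 rfl).trans e3
  have f4 := (hF.nr 4 rfl).trans e4
  have f5 := (hF.nr 5 rfl).trans e5
  have f6 := (hF.nr 6 rfl).trans e6
  have f11 := (hF.nr 11 rfl).trans e11
  have w1 := (hF.xr 1 rfl).trans x1
  clear hF
  -- Invariant with w = 2^(K - i): entries before the pointer are below v, and entries from w - 1
  -- places after it are at least v. At the start the second half is vacuous because 2^K exceeds the
  -- length of the row; at the end w = 1.
  refine Good.seq (Ends.comp (T' := 21) (Ends.loop_const K 30 (fun i t => t.nr 8 = K - i ∧ lo ≤ t.nr 5 ∧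
    t.nr 5 ≤ hi ∧ (∀ p, lo ≤ p → p < t.nr 5 → a p < v) ∧
    ∀ p, p < hi → t.nr 5 + 2 ^ (K - i) ≤ p + 1 → v ≤ a p) ⟨h8, f5.ge, f5.trans_le hlh, ?_, ?_⟩ ?_ ?_)
    fun t2 hF ht => ?_)
  · intro p h1 h2
    omega
  · intro p h1 h2
    rw [Nat.sub_zero] at h2
    omega
  · rintro i t2 hi' hF ⟨q8, q5, q5', qlt, qge⟩
    have q2 := hF.na 2 rfl
    have q1 := (hF.na 1 rfl).trans f1
    have q3 := (hF.nr 3 rfl).trans f3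
    have q4 := (hF.nr 4 rfl).trans f4
    have q6 := (hF.nr 6 rfl).trans f6
    have q11 := (hF.nr 11 rfl).trans f11
    have hKi : K - i = K - (i + 1) + 1 := by omega
    refine ⟨by rw [Test.holds, q8, q11]; omega, ?_⟩
    set w := 2 ^ (K - (i + 1)) with hw
    have hw2 : 2 ^ (K - i) = w + w := by rw [hKi, pow_succ, hw]; ring
    have hw1 : 1 ≤ w := Nat.one_le_two_pow
    rw [hw2] at qge
    refine Good.seq (T := 29) (Good.blk_then (T := 22) (fun t => t.nr 8 = K - (i + 1) ∧
      t.nr 9 = t2.nr 5 + w) rfl ?_ fun t3 hF3 ht3 => ?_)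
    · simp [q8, q4, q2]
      refine ⟨by omega, ?_⟩
      rw [Nat.sub_sub, h2 _ (by omega)]
    obtain ⟨r8, r9⟩ := ht3
    have r1 := (hF3.na 1 rfl).trans q1
    have r3 := (hF3.nr 3 rfl).trans q3
    have r4 := (hF3.nr 4 rfl).trans q4
    have r5 := hF3.nr 5 rfl
    have r6 := (hF3.nr 6 rfl).trans q6
    have r11 := (hF3.nr 11 rfl).trans q11
    have hkeep : (∀ p, p < hi → t2.nr 5 + w ≤ p + 1 → v ≤ a p) → ∀ T,
        Good [.skip] t3 (T + 1) (PMF.pure ()) fun _ t => t.nr 8 = K - (i + 1) ∧ lo ≤ t.nr 5 ∧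
          t.nr 5 ≤ hi ∧ (∀ p, lo ≤ p → p < t.nr 5 → a p < v) ∧
          ∀ p, p < hi → t.nr 5 + w ≤ p + 1 → v ≤ a p := fun hge T =>
      Good.skip (Good.nil ⟨r8, by rwa [r5], by rwa [r5], by rwa [r5], by rwa [r5]⟩ T)
    refine Good.ite (T := 21) (fun hb => ?_) (fun hb => hkeep (fun p hp hpw => ?_) 20)
    swap
    · rw [Test.holds, r9, r6] at hb
      omega
    rw [Test.holds, r9, r6] at hb
    refine Good.seq (T := 20) (Good.blk_then (T := 15) (fun t => t.nr 7 = a (t2.nr 5 + w - 1)) rfl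
      (by simp [r9, r4, r1]) fun t4 hF4 r7 => ?_)
    have z3 := (hF4.nr 3 rfl).trans r3
    have z5 := (hF4.nr 5 rfl).trans r5
    have z8 := (hF4.nr 8 rfl).trans r8
    have z9 := (hF4.nr 9 rfl).trans r9
    have z11 := (hF4.nr 11 rfl).trans r11
    have hin : ∀ p, lo ≤ p → p < hi → InRow (s.na 1) u p := fun p h1 h2 => ⟨h1, h2⟩
    have hmono : ∀ p q, lo ≤ p → p ≤ q → q < hi → a p ≤ a q := by
      intro p q h1 h2 h3
      rcases h2.eq_or_lt with rfl | h2
      · exact le_rfl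
      · exact (h.sorted u p q (hin _ h1 (by omega)) (hin _ (by omega) h3) h2).le
    refine Good.ite (T := 14) (fun hb' => ?_) (fun hb' => ?_)
    · rw [Test.holds, r7, z3] at hb'
      refine Good.mono_time (Good.blk rfl (Good.nil ?_ 0)) (by simp)
      simp [z9, z11, z8]
      refine ⟨by omega, by omega, fun p h1 h2 => ?_, fun p h1 h2 => qge p h1 (by omega)⟩
      exact (hmono p (t2.nr 5 + w - 1) h1 (by omega) (by omega)).trans_lt hb'
    · rw [Test.holds, r7, z3, not_lt] at hb'
      refine Good.skip (Good.nil ⟨z8, by rwa [z5], by rwa [z5], by rwa [z5], ?_⟩ 13)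
      rw [z5]
      intro p h1 h2
      exact hb'.trans (hmono _ p (by omega) (by omega) h1)
  · rintro t2 hF ⟨q8, -⟩
    rw [Test.holds, q8, (hF.nr 11 rfl).trans f11]
    omega
  obtain ⟨-, q5, q5', qlt, qge⟩ := ht
  rw [Nat.sub_self, pow_zero] at qge
  have q1 := (hF.na 1 rfl).trans f1
  have p1 := (hF.xa 1 rfl).trans g1
  have q3 := (hF.nr 3 rfl).trans f3
  have q6 := (hF.nr 6 rfl).trans f6
  have x1' := (hF.xr 1 rfl).trans w1
  have hzero : (∀ p, lo ≤ p → p < hi → a p ≠ v) → σ u v = 0 := by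
    intro hne
    by_contra hσ
    obtain ⟨p, hp, hpv⟩ := h.rows.all u v hσ
    exact hne p hp.1 hp.2 hpv
  have hlt : ∀ p, lo ≤ p → p < hi → a p = v → t2.nr 5 ≤ p := fun p h1 h2 h3 =>
    not_lt.1 fun hp => (qlt p h1 hp).ne h3
  refine Good.ite (T := 20) (fun hb => ?_) (fun hb => Good.skip (Good.nil ?_ 19))
  swap
  · rw [Test.holds, q6] at hb
    rw [x1', hzero]
    intro p h1 h2 h3
    have := hlt p h1 h2 h3
    omega
  rw [Test.holds, q6] at hb
  refine Good.seq (T := 19) (Good.blk_then (T := 16) (fun t => t.nr 7 = a (t2.nr 5)) rfl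
      (by simp [q1]) fun t3 hF3 r7 => ?_)
  have r5 := hF3.nr 5 rfl
  have r3 := (hF3.nr 3 rfl).trans q3
  have s1 := (hF3.xa 1 rfl).trans p1
  have o1 := (hF3.xr 1 rfl).trans x1'
  refine Good.ite (T := 15) (fun hb' => ?_) (fun hb' => Good.skip (Good.nil ?_ 14))
  · rw [Test.holds, r7, r3] at hb'
    have hv' : a (t2.nr 5) = v := le_antisymm hb' (qge _ hb (by omega))
    refine Good.mono_time (Good.blk rfl (Good.nil ?_ 0)) (by simp)
    obtain ⟨v', h1, h2, -⟩ := h.rows.entry u (t2.nr 5) ⟨q5, hb⟩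
    simp only [List.foldl, Instr.det, State.setX_xr, if_true, s1, r5, h2, Matrix.of_apply]
    rw [show v' = v from Fin.ext (h1.symm.trans hv')]
  · rw [Test.holds, r7, r3, not_le] at hb'
    rw [o1, hzero]
    intro p h1 h2 h3
    have h4 := hlt p h1 h2 h3
    rcases h4.eq_or_lt with h5 | h5
    · rw [← h5] at h3; omega
    · have : a (t2.nr 5) < a p := h.sorted u (t2.nr 5) p ⟨q5, hb⟩ ⟨h1, h2⟩ h5
      omega

/-- The estimate for the pair of vertices in `nr 0` and `nr 1` is put into `xr 0`. -/
def query : Prog :=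
  .seq (blk [.nconst 12 0, .xconst 2 1, .xload 3 1 0, .xdiv 3 2 3, .xload 4 1 1, .xdiv 4 2 4,
    .nadd 2 0 12, .nadd 3 0 12]) <|
  .seq lookup <|
  .seq (blk [.xmul 0 3 1, .nadd 3 1 12]) <|
  .seq lookup <|
  .seq (blk [.xmul 5 4 1, .xsub 0 0 5, .nadd 2 1 12]) <|
  .seq lookup <|
  .seq (blk [.xmul 5 4 1, .xadd 0 0 5, .nadd 3 0 12]) <|
  .seq lookup (blk [.xmul 5 3 1, .xsub 0 0 5])

theorem StoresSketch.congr {n : ℕ} {d : Fin n → ℝ} {σ : Fin n → Fin n → ℝ} {s t : State}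
    (h : StoresSketch d σ s) (h1 : t.na 1 = s.na 1) (h2 : t.xa 1 = s.xa 1) :
    StoresSketch d σ t := by
  obtain ⟨a1, a2, a3⟩ := h
  constructor
  · rwa [h1, h2]
  · rwa [h1]
  · rwa [h2]

theorem query_ends {n : ℕ} {d : Fin n → ℝ} {σ : Fin n → Fin n → ℝ} {u v : Fin n} {s : State}
    (h : StoresSketch d σ s) (hu : s.nr 0 = u) (hv : s.nr 1 = v) :
    Ends [query] s (160 * Nat.size n + 300) (fun t => t.xr 0 = estimate d σ u v) := by
  refine Good.mono_time (T := 17 + (40 * Nat.size n + 60 + (5 + (40 * Nat.size n + 60 +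
    (7 + (40 * Nat.size n + 60 + (7 + (40 * Nat.size n + 60 + 5 + 1) + 1) + 1) + 1) + 1) + 1) + 1)
    + 1) ?_ (by omega)
  refine Good.seq (Good.blk_then (fun t => t.nr 12 = 0 ∧ t.xr 3 = 1 / d u ∧ t.xr 4 = 1 / d v ∧
    t.nr 2 = u ∧ t.nr 3 = u) rfl ?_ fun t1 hF ht => ?_)
  · simp [hu, hv, h.degs]
  obtain ⟨a12, b3, b4, a2, a3⟩ := ht
  have a0 := (hF.nr 0 rfl).trans hu
  have a1 := (hF.nr 1 rfl).trans hv
  have hs1 := h.congr (hF.na 1 rfl) (hF.xa 1 rfl)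
  refine Good.seq (Ends.comp (lookup_ends hs1 a2 a3) fun t2 hF ht => ?_)
  have hs2 := hs1.congr (hF.na 1 rfl) (hF.xa 1 rfl)
  replace a0 := (hF.nr 0 rfl).trans a0
  replace a1 := (hF.nr 1 rfl).trans a1
  replace a2 := (hF.nr 2 rfl).trans a2
  replace a12 := (hF.nr 12 rfl).trans a12
  replace b3 := (hF.xr 3 rfl).trans b3
  replace b4 := (hF.xr 4 rfl).trans b4
  refine Good.seq (Good.blk_then (fun t => t.xr 0 = 1 / d u * σ u u ∧ t.nr 3 = v) rfl ?_
    fun t3 hF ht => ?_)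
  · simp [ht, b3, a1, a12]
  obtain ⟨b0, a3⟩ := ht
  have hs3 := hs2.congr (hF.na 1 rfl) (hF.xa 1 rfl)
  replace a0 := (hF.nr 0 rfl).trans a0
  replace a1 := (hF.nr 1 rfl).trans a1
  replace a2 := (hF.nr 2 rfl).trans a2
  replace a12 := (hF.nr 12 rfl).trans a12
  replace b3 := (hF.xr 3 rfl).trans b3
  replace b4 := (hF.xr 4 rfl).trans b4
  refine Good.seq (Ends.comp (lookup_ends hs3 a2 a3) fun t4 hF ht => ?_)
  have hs4 := hs3.congr (hF.na 1 rfl) (hF.xa 1 rfl)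
  replace a0 := (hF.nr 0 rfl).trans a0
  replace a1 := (hF.nr 1 rfl).trans a1
  replace a3 := (hF.nr 3 rfl).trans a3
  replace a12 := (hF.nr 12 rfl).trans a12
  replace b0 := (hF.xr 0 rfl).trans b0
  replace b3 := (hF.xr 3 rfl).trans b3
  replace b4 := (hF.xr 4 rfl).trans b4
  refine Good.seq (Good.blk_then (fun t => t.xr 0 = 1 / d u * σ u u - 1 / d v * σ u v ∧
    t.nr 2 = v) rfl ?_ fun t5 hF ht => ?_)
  · simp [ht, b4, b0, a1, a12]
  clear b0
  obtain ⟨b0, a2⟩ := ht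
  have hs5 := hs4.congr (hF.na 1 rfl) (hF.xa 1 rfl)
  replace a0 := (hF.nr 0 rfl).trans a0
  replace a3 := (hF.nr 3 rfl).trans a3
  replace a12 := (hF.nr 12 rfl).trans a12
  replace b3 := (hF.xr 3 rfl).trans b3
  replace b4 := (hF.xr 4 rfl).trans b4
  refine Good.seq (Ends.comp (lookup_ends hs5 a2 a3) fun t6 hF ht => ?_)
  have hs6 := hs5.congr (hF.na 1 rfl) (hF.xa 1 rfl)
  replace a0 := (hF.nr 0 rfl).trans a0
  replace a2 := (hF.nr 2 rfl).trans a2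
  replace a12 := (hF.nr 12 rfl).trans a12
  replace b0 := (hF.xr 0 rfl).trans b0
  replace b3 := (hF.xr 3 rfl).trans b3
  replace b4 := (hF.xr 4 rfl).trans b4
  refine Good.seq (Good.blk_then (fun t => t.xr 0 = 1 / d u * σ u u - 1 / d v * σ u v +
    1 / d v * σ v v ∧ t.nr 3 = u) rfl ?_ fun t7 hF ht => ?_)
  · simp [ht, b4, b0, a0, a12]
  clear b0
  obtain ⟨b0, a3⟩ := ht
  have hs7 := hs6.congr (hF.na 1 rfl) (hF.xa 1 rfl)
  replace a2 := (hF.nr 2 rfl).trans a2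
  replace b3 := (hF.xr 3 rfl).trans b3
  refine Good.seq (Ends.comp (T' := 5) (lookup_ends hs7 a2 a3) fun t8 hF ht => ?_)
  replace b0 := (hF.xr 0 rfl).trans b0
  replace b3 := (hF.xr 3 rfl).trans b3
  refine Good.mono_time (Good.blk rfl (Good.nil ?_ 0)) (by simp)
  simp [ht, b3, b0, estimate]

/-! ### Spectral facts -/

/-! ### Eigenvector expansions of symmetric matrices. -/

section hermitian

variable {n : ℕ} {M : Matrix (Fin n) (Fin n) ℝ} (hM : M.IsHermitian)

/-- An orthonormal basis of eigenvectors of a symmetric matrix, as plain vectors. -/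
def eigvec (i : Fin n) : Fin n → ℝ := hM.eigenvectorBasis i

theorem mulVec_eigvec (i : Fin n) : M *ᵥ eigvec hM i = hM.eigenvalues i • eigvec hM i :=
  hM.mulVec_eigenvectorBasis i

/-- Parseval's identity, transferred from `EuclideanSpace` to plain vectors. -/
theorem dotProduct_eq_sum_eigvec (x y : Fin n → ℝ) :
    x ⬝ᵥ y = ∑ i, (eigvec hM i ⬝ᵥ x) * (eigvec hM i ⬝ᵥ y) := by
  have h := hM.eigenvectorBasis.sum_inner_mul_inner (WithLp.toLp 2 x) (WithLp.toLp 2 y)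
  simp only [EuclideanSpace.inner_eq_star_dotProduct, star_trivial] at h
  rw [dotProduct_comm x y, ← h]
  refine Finset.sum_congr rfl fun i _ => ?_
  rw [dotProduct_comm y]
  rfl

theorem eigvec_orthonormal (i j : Fin n) :
    eigvec hM i ⬝ᵥ eigvec hM j = if i = j then 1 else 0 := by
  have h := orthonormal_iff_ite.1 hM.eigenvectorBasis.orthonormal i j
  rw [EuclideanSpace.inner_eq_star_dotProduct, star_trivial, dotProduct_comm] at h
  exact h

theorem eigvec_dotProduct_mulVec (i : Fin n) (x : Fin n → ℝ) :
    eigvec hM i ⬝ᵥ (M *ᵥ x) = hM.eigenvalues i * (eigvec hM i ⬝ᵥ x) := by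
  have hT : Mᵀ = M := by
    have := hM.eq
    rwa [Matrix.conjTranspose_eq_transpose_of_trivial] at this
  rw [Matrix.dotProduct_mulVec, ← Matrix.mulVec_transpose, hT, mulVec_eigvec, smul_dotProduct,
    smul_eq_mul]

theorem sum_eigvec (x : Fin n → ℝ) : ∑ i, (eigvec hM i ⬝ᵥ x) • eigvec hM i = x := by
  have h : ∀ y : Fin n → ℝ, (∑ i, (eigvec hM i ⬝ᵥ x) • eigvec hM i) ⬝ᵥ y = x ⬝ᵥ y := by
    intro y
    rw [dotProduct_eq_sum_eigvec hM x y, sum_dotProduct]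
    simp only [smul_dotProduct, smul_eq_mul]
  exact dotProduct_eq _ _ h

theorem pinv_mulVec (x : Fin n → ℝ) : pinv hM *ᵥ x =
    ∑ i with hM.eigenvalues i ≠ 0, ((hM.eigenvalues i)⁻¹ * (eigvec hM i ⬝ᵥ x)) • eigvec hM i := by
  rw [pinv, Matrix.sum_mulVec]
  refine Finset.sum_congr rfl fun i _ => ?_
  rw [Matrix.smul_mulVec, Matrix.vecMulVec_mulVec, one_div, mul_smul]
  congr 1
  simp [eigvec]

/-- M M⁺ is the projection onto the span of the eigenvectors of nonzero eigenvalue, and the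
hypothesis places x in that span. -/
theorem mulVec_pinv_mulVec {x : Fin n → ℝ}
    (hx : ∀ i, hM.eigenvalues i = 0 → eigvec hM i ⬝ᵥ x = 0) : M *ᵥ (pinv hM *ᵥ x) = x := by
  conv_rhs => rw [← sum_eigvec hM x]
  rw [pinv_mulVec, Matrix.mulVec_sum, Finset.sum_filter]
  refine Finset.sum_congr rfl fun i _ => ?_
  split_ifs with h
  · rw [Matrix.mulVec_smul, mulVec_eigvec, smul_smul, mul_comm, ← mul_assoc, mul_inv_cancel₀ h,
      one_mul]
  · rw [not_not] at h
    rw [hx i h, zero_smul]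

end hermitian

/-! ### The Laplacian quadratic form and the effective resistance. -/

namespace WGraph

variable {n : ℕ} (G : WGraph n)

theorem lap_mulVec (f : Fin n → ℝ) (u : Fin n) :
    (G.lap *ᵥ f) u = ∑ v, G.A u v * (f u - f v) := by
  rw [lap, Matrix.sub_mulVec, Pi.sub_apply, Matrix.mulVec_diagonal, deg, Finset.sum_mul,
    Matrix.mulVec, dotProduct, ← Finset.sum_sub_distrib]
  exact Finset.sum_congr rfl fun v _ => by ring

/-- Averaging the double sum with the one in which u and v are exchanged completes the square. -/
theorem dotProduct_lap_mulVec (f : Fin n → ℝ) :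
    f ⬝ᵥ (G.lap *ᵥ f) = (∑ u, ∑ v, G.A u v * (f u - f v) ^ 2) / 2 := by
  have h1 : f ⬝ᵥ (G.lap *ᵥ f) = ∑ u, ∑ v, G.A u v * (f u - f v) * f u := by
    simp only [dotProduct, lap_mulVec, Finset.mul_sum]
    exact Finset.sum_congr rfl fun u _ => Finset.sum_congr rfl fun v _ => by ring
  have h2 : f ⬝ᵥ (G.lap *ᵥ f) = ∑ u, ∑ v, G.A u v * (f v - f u) * f v := by
    rw [h1, Finset.sum_comm]
    exact Finset.sum_congr rfl fun u _ => Finset.sum_congr rfl fun v _ => by rw [G.symm]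
  have h3 : f ⬝ᵥ (G.lap *ᵥ f) + f ⬝ᵥ (G.lap *ᵥ f) = ∑ u, ∑ v, G.A u v * (f u - f v) ^ 2 := by
    conv_lhs => rw [h1]
    rw [← h1]
    conv_lhs =>
      congr
      · rw [h1]
      · rw [h2]
    rw [← Finset.sum_add_distrib]
    refine Finset.sum_congr rfl fun u _ => ?_
    rw [← Finset.sum_add_distrib]
    exact Finset.sum_congr rfl fun v _ => by ring
  linarith

theorem dotProduct_lap_nonneg (f : Fin n → ℝ) : 0 ≤ f ⬝ᵥ (G.lap *ᵥ f) := by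
  rw [dotProduct_lap_mulVec]
  exact div_nonneg (Finset.sum_nonneg fun u _ => Finset.sum_nonneg fun v _ =>
    mul_nonneg (G.nonneg u v) (sq_nonneg _)) zero_le_two

/-- From (a - b)² ≤ 2a² + 2b², edge by edge. It is the source of the upper bound 2 for the
normalised spectrum. -/
theorem dotProduct_lap_le (f : Fin n → ℝ) :
    f ⬝ᵥ (G.lap *ᵥ f) ≤ 2 * ∑ u, G.deg u * f u ^ 2 := by
  have h1 : ∑ u, G.deg u * f u ^ 2 = ∑ u, ∑ v, G.A u v * f u ^ 2 :=
    Finset.sum_congr rfl fun u _ => by rw [deg, Finset.sum_mul]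
  have h2 : ∑ u, G.deg u * f u ^ 2 = ∑ u, ∑ v, G.A u v * f v ^ 2 := by
    rw [h1, Finset.sum_comm]
    exact Finset.sum_congr rfl fun u _ => Finset.sum_congr rfl fun v _ => by rw [G.symm]
  have h3 : (∑ u, ∑ v, G.A u v * (f u - f v) ^ 2) ≤
      2 * (∑ u, ∑ v, G.A u v * f u ^ 2) + 2 * ∑ u, ∑ v, G.A u v * f v ^ 2 := by
    rw [Finset.mul_sum, Finset.mul_sum, ← Finset.sum_add_distrib]
    refine Finset.sum_le_sum fun u _ => ?_
    rw [Finset.mul_sum, Finset.mul_sum, ← Finset.sum_add_distrib]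
    refine Finset.sum_le_sum fun v _ => ?_
    nlinarith [mul_nonneg (G.nonneg u v) (sq_nonneg (f u + f v))]
  rw [dotProduct_lap_mulVec]
  rw [← h1, ← h2] at h3
  linarith

variable {G} (hG : G.graph.Connected)

theorem lap_isSymm (G : WGraph n) : G.lapᵀ = G.lap := by
  have := G.lap_isHermitian.eq
  rwa [Matrix.conjTranspose_eq_transpose_of_trivial] at this

theorem lap_dotProduct_comm (G : WGraph n) (f g : Fin n → ℝ) :
    (G.lap *ᵥ f) ⬝ᵥ g = f ⬝ᵥ (G.lap *ᵥ g) := by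
  rw [Matrix.dotProduct_mulVec, ← Matrix.mulVec_transpose, lap_isSymm]

-- Zero energy means that f does not change along any edge; connectedness spreads this to all
-- vertices. So the kernel of L consists of constants.
include hG in
theorem eq_of_lap_eq_zero {f : Fin n → ℝ} (hf : f ⬝ᵥ (G.lap *ᵥ f) = 0) (u v : Fin n) :
    f u = f v := by
  rw [dotProduct_lap_mulVec, div_eq_zero_iff, or_iff_left two_ne_zero,
    Finset.sum_eq_zero_iff_of_nonneg (fun u _ => Finset.sum_nonneg fun v _ =>
      mul_nonneg (G.nonneg u v) (sq_nonneg _))] at hf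
  have hadj : ∀ u v, G.graph.Adj u v → f u = f v := by
    intro u v huv
    have h1 := hf u (Finset.mem_univ u)
    rw [Finset.sum_eq_zero_iff_of_nonneg (fun v _ =>
      mul_nonneg (G.nonneg u v) (sq_nonneg _))] at h1
    have h2 := h1 v (Finset.mem_univ v)
    rw [mul_eq_zero, or_iff_right huv, sq_eq_zero_iff, sub_eq_zero] at h2
    exact h2
  obtain ⟨p⟩ := hG.preconnected u v
  induction p with
  | nil => rfl
  | cons h _ ih => exact (hadj _ _ h).trans ih

include hG in
theorem deg_pos (hn : 2 ≤ n) (u : Fin n) : 0 < G.deg u := by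
  have : Nontrivial (Fin n) := Fin.nontrivial_iff_two_le.2 hn
  obtain ⟨v, hv⟩ := hG.preconnected.exists_adj_of_nontrivial u
  refine Finset.sum_pos' (fun v _ => G.nonneg u v) ⟨v, Finset.mem_univ v, ?_⟩
  exact lt_of_le_of_ne (G.nonneg u v) (Ne.symm hv)

/-- The vector `1_u - 1_v`. -/
def pairVec (u v : Fin n) : Fin n → ℝ := Pi.single u 1 - Pi.single v 1

theorem pairVec_dotProduct (u v : Fin n) (f : Fin n → ℝ) : pairVec u v ⬝ᵥ f = f u - f v := by
  simp [pairVec, sub_dotProduct]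

/-- The potential `L⁺ (1_u - 1_v)`. -/
def potential (G : WGraph n) (u v : Fin n) : Fin n → ℝ := pinv G.lap_isHermitian *ᵥ pairVec u v

-- Kernel vectors of L are constant, hence orthogonal to 1_u - 1_v, so no part of this vector is
-- lost by the pseudoinverse.
include hG in
theorem lap_potential (u v : Fin n) : G.lap *ᵥ G.potential u v = pairVec u v := by
  refine mulVec_pinv_mulVec _ fun i hi => ?_
  rw [dotProduct_comm, pairVec_dotProduct, sub_eq_zero]
  refine eq_of_lap_eq_zero hG ?_ u v
  rw [mulVec_eigvec, hi, zero_smul, dotProduct_zero]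

theorem effRes_eq (u v : Fin n) : G.effRes u v = pairVec u v ⬝ᵥ G.potential u v := rfl

include hG in
theorem effRes_eq_energy (u v : Fin n) :
    G.effRes u v = G.potential u v ⬝ᵥ (G.lap *ᵥ G.potential u v) := by
  rw [lap_potential hG, effRes_eq, dotProduct_comm]

include hG in
theorem effRes_nonneg (u v : Fin n) : 0 ≤ G.effRes u v := by
  rw [effRes_eq_energy hG]
  exact G.dotProduct_lap_nonneg _

include hG in
/-- A form of the Cauchy-Schwarz inequality for the Laplacian. -/
theorem sq_sub_le (u v : Fin n) (f : Fin n → ℝ) :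
    (f u - f v) ^ 2 ≤ G.effRes u v * (f ⬝ᵥ (G.lap *ᵥ f)) := by
  set z := G.potential u v
  -- The energy of t f - z is a quadratic polynomial in t without negative values, so its
  -- discriminant is not positive.
  have h1 : ∀ t : ℝ, 0 ≤ (f ⬝ᵥ (G.lap *ᵥ f)) * (t * t) + (-2 * (f u - f v)) * t +
      G.effRes u v := by
    intro t
    have h := G.dotProduct_lap_nonneg (t • f - z)
    have e1 : f ⬝ᵥ (G.lap *ᵥ z) = f u - f v := by
      rw [lap_potential hG, dotProduct_comm, pairVec_dotProduct]
    have e2 : z ⬝ᵥ (G.lap *ᵥ f) = f u - f v := by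
      rw [← e1, ← lap_dotProduct_comm, dotProduct_comm]
    have e3 : z ⬝ᵥ (G.lap *ᵥ z) = G.effRes u v := (effRes_eq_energy hG u v).symm
    simp only [Matrix.mulVec_sub, Matrix.mulVec_smul, sub_dotProduct, dotProduct_sub,
      smul_dotProduct, dotProduct_smul, smul_eq_mul, e1, e2, e3] at h
    linarith
  have h2 := discrim_le_zero h1
  rw [discrim] at h2
  nlinarith

theorem lap_single (u : Fin n) :
    (Pi.single u 1 : Fin n → ℝ) ⬝ᵥ (G.lap *ᵥ Pi.single u 1) = G.deg u := by
  simp [lap, G.loopless]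

-- The indicator of u has energy d_u and differs by 1 between u and v; insert it into `sq_sub_le`.
-- This bound turns additive errors in the vectors into relative errors of the estimate.
include hG in
theorem one_le_effRes_mul_deg {u v : Fin n} (huv : u ≠ v) : 1 ≤ G.effRes u v * G.deg u := by
  have h := sq_sub_le hG u v (Pi.single u 1)
  rw [lap_single, Pi.single_eq_same, Pi.single_eq_of_ne huv.symm] at h
  linarith

include hG in
theorem one_le_effRes_mul_deg' {u v : Fin n} (huv : u ≠ v) : 1 ≤ G.effRes u v * G.deg v := by
  have h := sq_sub_le hG u v (Pi.single v 1)
  rw [lap_single, Pi.single_eq_same, Pi.single_eq_of_ne huv] at h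
  linarith

theorem effRes_self (u : Fin n) : G.effRes u u = 0 := by
  simp [effRes]

/-! ### The spectrum of the normalised Laplacian -/

/-- `D^{1/2}`. -/
def sqrtDeg (G : WGraph n) : Matrix (Fin n) (Fin n) ℝ := Matrix.diagonal fun u => √(G.deg u)

/-- `D^{-1/2}`. -/
def sqrtDegInv (G : WGraph n) : Matrix (Fin n) (Fin n) ℝ := Matrix.diagonal fun u => (√(G.deg u))⁻¹

theorem normLap_eq (G : WGraph n) : G.normLap = G.sqrtDegInv * G.lap * G.sqrtDegInv := rfl

theorem dotProduct_diagonal_mulVec (w f g : Fin n → ℝ) :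
    f ⬝ᵥ (Matrix.diagonal w *ᵥ g) = (Matrix.diagonal w *ᵥ f) ⬝ᵥ g := by
  simp only [dotProduct, Matrix.mulVec_diagonal]
  exact Finset.sum_congr rfl fun u _ => by ring

theorem dotProduct_normLap (G : WGraph n) (f : Fin n → ℝ) : f ⬝ᵥ (G.normLap *ᵥ f) =
    (G.sqrtDegInv *ᵥ f) ⬝ᵥ (G.lap *ᵥ (G.sqrtDegInv *ᵥ f)) := by
  rw [normLap_eq, ← Matrix.mulVec_mulVec, ← Matrix.mulVec_mulVec, sqrtDegInv,
    dotProduct_diagonal_mulVec]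

theorem dotProduct_normLap_eigvec (G : WGraph n) (i : Fin n) :
    eigvec G.normLap_isHermitian i ⬝ᵥ (G.normLap *ᵥ eigvec G.normLap_isHermitian i) =
      G.normLap_isHermitian.eigenvalues i := by
  rw [mulVec_eigvec, dotProduct_smul, eigvec_orthonormal, if_pos rfl, smul_eq_mul, mul_one]

theorem eigenvalues_nonneg (G : WGraph n) (i : Fin n) :
    0 ≤ G.normLap_isHermitian.eigenvalues i := by
  rw [← dotProduct_normLap_eigvec, dotProduct_normLap]
  exact G.dotProduct_lap_nonneg _

/-- The Rayleigh quotient of an eigenvector, bounded by `dotProduct_lap_le`. It makes the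
eigenvalues 1 - λ/2 of the lazy walk nonnegative, so that the truncation error has a sign and
comparisons survive taking powers. -/
theorem eigenvalues_le_two (hd : ∀ u, 0 < G.deg u) (i : Fin n) :
    G.normLap_isHermitian.eigenvalues i ≤ 2 := by
  have h := eigvec_orthonormal G.normLap_isHermitian i i
  rw [← dotProduct_normLap_eigvec, dotProduct_normLap]
  refine (G.dotProduct_lap_le _).trans_eq ?_
  rw [if_pos rfl] at h
  conv_rhs => rw [← mul_one 2, ← h]
  rw [dotProduct]
  congr 1
  refine Finset.sum_congr rfl fun u _ => ?_
  rw [sqrtDegInv, Matrix.mulVec_diagonal, mul_pow, inv_pow, Real.sq_sqrt (hd u).le, ← mul_assoc,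
    mul_inv_cancel₀ (hd u).ne', one_mul, sq]

theorem sqrtDegInv_mul_sqrtDeg (hd : ∀ u, 0 < G.deg u) : G.sqrtDegInv * G.sqrtDeg = 1 := by
  rw [sqrtDegInv, sqrtDeg, Matrix.diagonal_mul_diagonal, ← Matrix.diagonal_one]
  congr 1
  ext u
  exact inv_mul_cancel₀ (Real.sqrt_pos.2 (hd u)).ne'

/-- D^{1/2} applied to the constant vector 1 lies in the kernel. If no eigenvalue vanished, all its
coefficients in the eigenbasis would, but its entries are positive. -/
theorem exists_eigenvalue_eq_zero (hd : ∀ u, 0 < G.deg u) (u₀ : Fin n) :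
    ∃ i, G.normLap_isHermitian.eigenvalues i = 0 := by
  by_contra! hne
  set φ := G.sqrtDeg *ᵥ (fun _ => 1) with hφ
  have h0 : G.normLap *ᵥ φ = 0 := by
    rw [normLap_eq, hφ, Matrix.mulVec_mulVec, Matrix.mul_assoc, sqrtDegInv_mul_sqrtDeg hd,
      Matrix.mul_one, ← Matrix.mulVec_mulVec]
    rw [show G.lap *ᵥ (fun _ => 1) = 0 by ext u; simp [lap_mulVec], Matrix.mulVec_zero]
  have h1 : ∀ i, eigvec G.normLap_isHermitian i ⬝ᵥ φ = 0 := by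
    intro i
    have := eigvec_dotProduct_mulVec G.normLap_isHermitian i φ
    rw [h0, dotProduct_zero] at this
    exact (mul_eq_zero.1 this.symm).resolve_left (hne i)
  have h2 := sum_eigvec G.normLap_isHermitian φ
  simp only [h1, zero_smul, Finset.sum_const_zero] at h2
  have h3 := congrFun h2 u₀
  rw [hφ, sqrtDeg, Matrix.mulVec_diagonal, mul_one, Pi.zero_apply] at h3
  exact (Real.sqrt_pos.2 (hd u₀)).ne h3

-- D^{-1/2} times a null eigenvector has zero energy and so is constant. All null eigenvectors are
-- thus multiples of φ = (√d_u), and two of them cannot be orthonormal.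
include hG in
theorem eigenvalue_eq_zero_unique (hn : 2 ≤ n) {i j : Fin n}
    (hi : G.normLap_isHermitian.eigenvalues i = 0) (hj : G.normLap_isHermitian.eigenvalues j = 0) :
    i = j := by
  have hd := deg_pos hG hn
  have key : ∀ i, G.normLap_isHermitian.eigenvalues i = 0 → ∃ c : ℝ,
      eigvec G.normLap_isHermitian i = fun u => c * √(G.deg u) := by
    intro i hi
    have h1 : (G.sqrtDegInv *ᵥ eigvec G.normLap_isHermitian i) ⬝ᵥ
        (G.lap *ᵥ (G.sqrtDegInv *ᵥ eigvec G.normLap_isHermitian i)) = 0 := by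
      rw [← dotProduct_normLap, dotProduct_normLap_eigvec, hi]
    refine ⟨(G.sqrtDegInv *ᵥ eigvec G.normLap_isHermitian i) i, funext fun u => ?_⟩
    rw [eq_of_lap_eq_zero hG h1 i u, sqrtDegInv, Matrix.mulVec_diagonal, mul_comm, ← mul_assoc,
      mul_inv_cancel₀ (Real.sqrt_pos.2 (hd u)).ne', one_mul]
  by_contra hij
  obtain ⟨c, hc⟩ := key i hi
  obtain ⟨c', hc'⟩ := key j hj
  set φ : Fin n → ℝ := fun u => √(G.deg u)
  have e1 : eigvec G.normLap_isHermitian i = c • φ := hc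
  have e2 : eigvec G.normLap_isHermitian j = c' • φ := hc'
  have o1 := eigvec_orthonormal G.normLap_isHermitian i i
  have o2 := eigvec_orthonormal G.normLap_isHermitian j j
  have o3 := eigvec_orthonormal G.normLap_isHermitian i j
  rw [if_pos rfl, e1, dotProduct_smul, smul_dotProduct, smul_eq_mul, smul_eq_mul] at o1
  rw [if_pos rfl, e2, dotProduct_smul, smul_dotProduct, smul_eq_mul, smul_eq_mul] at o2
  rw [if_neg hij, e1, e2, dotProduct_smul, smul_dotProduct, smul_eq_mul, smul_eq_mul] at o3
  -- The product of the squared norms c²|φ|² and c'²|φ|² equals (c c' |φ|²)², the square of the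
  -- inner product.
  have : (1 : ℝ) * 1 = 0 := by
    nth_rewrite 1 [← o1]
    rw [← o2]
    linear_combination (c * c' * (φ ⬝ᵥ φ)) * o3
  norm_num at this

theorem specGap_eq (hn : 2 ≤ n) : ∃ i, G.specGap hn = G.normLap_isHermitian.eigenvalues i := by
  refine ⟨Fintype.equivOfCardEq (Fintype.card_fin _) ⟨n - 2, by rw [Fintype.card_fin]; omega⟩, ?_⟩
  rw [Matrix.IsHermitian.eigenvalues, Equiv.symm_apply_apply]
  rfl

-- In the decreasing list a nonzero, hence positive, eigenvalue stands strictly before the zero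
-- eigenvalue, thus at index n - 2 at the latest.
include hG in
theorem specGap_le_eigenvalues (hn : 2 ≤ n) (i : Fin n)
    (hi : G.normLap_isHermitian.eigenvalues i ≠ 0) :
    G.specGap hn ≤ G.normLap_isHermitian.eigenvalues i := by
  set e := Fintype.equivOfCardEq (Fintype.card_fin (Fintype.card (Fin n))) with he
  have hev : ∀ i, G.normLap_isHermitian.eigenvalues i =
    G.normLap_isHermitian.eigenvalues₀ (e.symm i) := fun i => rfl
  obtain ⟨j, hj⟩ := exists_eigenvalue_eq_zero (deg_pos hG hn) i
  rw [hev, specGap]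
  refine G.normLap_isHermitian.eigenvalues₀_antitone ?_
  have hlt : ∀ i, ((e.symm i : Fin _) : ℕ) < n := fun i =>
    (e.symm i).2.trans_eq (Fintype.card_fin n)
  have hle : e.symm i ≤ e.symm j := by
    by_contra h
    have := G.normLap_isHermitian.eigenvalues₀_antitone (not_le.1 h).le
    rw [← hev, ← hev, hj] at this
    exact hi (le_antisymm this (eigenvalues_nonneg G i))
  have hne : e.symm i ≠ e.symm j := fun h => hi (by rw [hev, h, ← hev, hj])
  have h1 : (e.symm i : ℕ) < e.symm j := lt_of_le_of_ne hle fun h => hne (Fin.ext h)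
  have h2 := hlt j
  rw [Fin.le_def]
  change _ ≤ n - 2
  omega

-- If the entry at n - 2 were zero, so would be the one at n - 1, contradicting simplicity of the
-- eigenvalue 0.
include hG in
theorem specGap_pos (hn : 2 ≤ n) : 0 < G.specGap hn := by
  set e := Fintype.equivOfCardEq (Fintype.card_fin (Fintype.card (Fin n))) with he
  have hev : ∀ i, G.normLap_isHermitian.eigenvalues₀ i =
    G.normLap_isHermitian.eigenvalues (e i) := fun i => by
      rw [Matrix.IsHermitian.eigenvalues, Equiv.symm_apply_apply]
  have h0 : 0 ≤ G.specGap hn := by rw [specGap, hev]; exact eigenvalues_nonneg _ _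
  refine lt_of_le_of_ne h0 fun h => ?_
  rw [specGap, hev] at h
  have hcard : n - 1 < Fintype.card (Fin n) := by rw [Fintype.card_fin]; omega
  have h1 := G.normLap_isHermitian.eigenvalues₀_antitone
    (show (⟨n - 2, by rw [Fintype.card_fin]; omega⟩ : Fin (Fintype.card (Fin n))) ≤
      ⟨n - 1, hcard⟩ from Fin.mk_le_mk.2 (by omega))
  rw [hev, hev, ← h] at h1
  have h2 := eigenvalue_eq_zero_unique hG hn h.symm
    (le_antisymm h1 (eigenvalues_nonneg _ _))
  have h3 := congrArg Fin.val (e.injective h2)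
  simp only at h3
  omega

include hG in
theorem specGap_le_two (hn : 2 ≤ n) : G.specGap hn ≤ 2 := by
  obtain ⟨i, hi⟩ := specGap_eq (G := G) hn
  rw [hi]
  exact eigenvalues_le_two (deg_pos hG hn) i

/-! ### The lazy random walk -/

/-- The transition matrix `(I + D⁻¹ A) / 2` of the lazy random walk. -/
def lazyMat (G : WGraph n) : Matrix (Fin n) (Fin n) ℝ :=
  (1 / 2 : ℝ) • (1 + Matrix.diagonal (fun u => (G.deg u)⁻¹) * G.A)

/-- The expected number of visits in the first `ℓ` steps of the lazy random walk, divided by `2`. -/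
def visits (G : WGraph n) (ℓ : ℕ) (u v : Fin n) : ℝ :=
  (∑ k ∈ Finset.range ℓ, G.lazyMat ^ k) u v / 2

/-- The identity behind the method: applied to D⁻¹L, the partial sums of the powers of P telescope.
-/
theorem one_sub_lazyMat (hd : ∀ u, 0 < G.deg u) :
    1 - G.lazyMat = (1 / 2 : ℝ) • (Matrix.diagonal (fun u => (G.deg u)⁻¹) * G.lap) := by
  have h : Matrix.diagonal (fun u => (G.deg u)⁻¹) * Matrix.diagonal G.deg = 1 := by
    rw [Matrix.diagonal_mul_diagonal, ← Matrix.diagonal_one]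
    congr 1
    ext u
    exact inv_mul_cancel₀ (hd u).ne'
  rw [lazyMat, lap, Matrix.mul_sub, h, smul_add, smul_sub]
  have : (1 : Matrix (Fin n) (Fin n) ℝ) = (1 / 2 : ℝ) • 1 + (1 / 2 : ℝ) • 1 := by
    rw [← add_smul]; norm_num
  nth_rewrite 1 [this]
  abel

/-- P is not symmetric, but D^{1/2} conjugates it to I - N/2 with N the normalised Laplacian, which
has an orthonormal eigenbasis. -/
theorem sqrtDeg_mul_lazyMat (hd : ∀ u, 0 < G.deg u) :
    G.sqrtDeg * G.lazyMat = (1 - (1 / 2 : ℝ) • G.normLap) * G.sqrtDeg := by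
  have h1 : G.lazyMat = 1 - (1 / 2 : ℝ) • (Matrix.diagonal (fun u => (G.deg u)⁻¹) * G.lap) := by
    rw [← one_sub_lazyMat hd, sub_sub_cancel]
  have h2 : G.sqrtDeg * Matrix.diagonal (fun u => (G.deg u)⁻¹) = G.sqrtDegInv := by
    rw [sqrtDeg, Matrix.diagonal_mul_diagonal, sqrtDegInv]
    congr 1
    ext u
    refine eq_inv_of_mul_eq_one_left ?_
    rw [mul_right_comm, Real.mul_self_sqrt (hd u).le, mul_inv_cancel₀ (hd u).ne']
  rw [h1, Matrix.mul_sub, Matrix.mul_one, Matrix.mul_smul, ← Matrix.mul_assoc, h2, Matrix.sub_mul,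
    Matrix.one_mul, Matrix.smul_mul, normLap_eq, Matrix.mul_assoc, sqrtDegInv_mul_sqrtDeg hd,
    Matrix.mul_one]

theorem sqrtDeg_mul_lazyMat_pow (hd : ∀ u, 0 < G.deg u) (ℓ : ℕ) :
    G.sqrtDeg * G.lazyMat ^ ℓ = (1 - (1 / 2 : ℝ) • G.normLap) ^ ℓ * G.sqrtDeg := by
  induction ℓ with
  | zero => simp
  | succ ℓ ih =>
    rw [pow_succ, ← Matrix.mul_assoc, ih, Matrix.mul_assoc, sqrtDeg_mul_lazyMat hd,
      ← Matrix.mul_assoc, ← pow_succ]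

theorem eigvec_dotProduct_pow (G : WGraph n) (i : Fin n) (ℓ : ℕ) (w : Fin n → ℝ) :
    eigvec G.normLap_isHermitian i ⬝ᵥ ((1 - (1 / 2 : ℝ) • G.normLap) ^ ℓ *ᵥ w) =
      (1 - G.normLap_isHermitian.eigenvalues i / 2) ^ ℓ * (eigvec G.normLap_isHermitian i ⬝ᵥ w) := by
  induction ℓ with
  | zero => simp
  | succ ℓ ih =>
    rw [pow_succ', ← Matrix.mulVec_mulVec, Matrix.sub_mulVec, Matrix.one_mulVec, dotProduct_sub,
      Matrix.smul_mulVec, dotProduct_smul, eigvec_dotProduct_mulVec, ih, smul_eq_mul]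
    ring

/-- Dividing column v of the visit matrix by d_v for every v gives half the sum of P^k D⁻¹; the four
terms are the expansion of its quadratic form at 1_u - 1_v. -/
theorem estimate_visits_eq (G : WGraph n) (ℓ : ℕ) (u v : Fin n) :
    estimate G.deg (G.visits ℓ) u v = pairVec u v ⬝ᵥ ((1 / 2 : ℝ) •
      ((∑ k ∈ Finset.range ℓ, G.lazyMat ^ k) *ᵥ
        (Matrix.diagonal (fun u => (G.deg u)⁻¹) *ᵥ pairVec u v))) := by
  rw [pairVec_dotProduct]
  have h : Matrix.diagonal (fun u => (G.deg u)⁻¹) *ᵥ pairVec u v =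
      Pi.single u (G.deg u)⁻¹ - Pi.single v (G.deg v)⁻¹ := by
    rw [pairVec, Matrix.mulVec_sub, Matrix.diagonal_mulVec_single, Matrix.diagonal_mulVec_single]
    simp
  rw [h, Matrix.mulVec_sub]
  simp only [Pi.smul_apply, Pi.sub_apply, smul_eq_mul, Matrix.mulVec_single, estimate, visits,
    Matrix.col_apply, MulOpposite.smul_eq_mul_unop, MulOpposite.unop_op]
  ring

include hG in
/-- The estimate from the exact visit counts underestimates the effective resistance by a factor of
at least `1 - (1 - ν / 2)^ℓ`. -/
theorem estimate_visits (hn : 2 ≤ n) (ℓ : ℕ) (u v : Fin n) :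
    estimate G.deg (G.visits ℓ) u v ≤ G.effRes u v ∧
      (1 - (1 - G.specGap hn / 2) ^ ℓ) * G.effRes u v ≤ estimate G.deg (G.visits ℓ) u v := by
  have hd := deg_pos hG hn
  set z := G.potential u v with hz
  set w := G.sqrtDeg *ᵥ z with hw
  set N := G.normLap with hN
  set ψ := eigvec G.normLap_isHermitian with hψ
  set ev := G.normLap_isHermitian.eigenvalues with hev
  have hx : pairVec u v = G.sqrtDeg *ᵥ (N *ᵥ w) := by
    have h1 : G.sqrtDeg * G.sqrtDegInv = 1 := mul_eq_one_comm.1 (sqrtDegInv_mul_sqrtDeg hd)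
    have h2 : G.normLap * G.sqrtDeg = G.sqrtDegInv * G.lap := by
      rw [normLap_eq, Matrix.mul_assoc, sqrtDegInv_mul_sqrtDeg hd, Matrix.mul_one]
    rw [hN, hw, Matrix.mulVec_mulVec, Matrix.mulVec_mulVec, Matrix.mul_assoc, h2,
      ← Matrix.mul_assoc, h1, Matrix.one_mul, lap_potential hG]
  -- With 1_u - 1_v = L z, the sum of P^k (I - P) z over k < ℓ collapses to z - P^ℓ z, and the part
  -- z pairs to R(u,v).
  have hE : estimate G.deg (G.visits ℓ) u v =
      G.effRes u v - pairVec u v ⬝ᵥ (G.lazyMat ^ ℓ *ᵥ z) := by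
    rw [estimate_visits_eq, effRes_eq, ← dotProduct_sub]
    congr 1
    calc _ = ((∑ k ∈ Finset.range ℓ, G.lazyMat ^ k) *
          ((1 / 2 : ℝ) • (Matrix.diagonal (fun u => (G.deg u)⁻¹) * G.lap))) *ᵥ z := by
          rw [Matrix.mul_smul, Matrix.smul_mulVec, ← Matrix.mulVec_mulVec, ← Matrix.mulVec_mulVec,
            lap_potential hG]
      _ = _ := by
          rw [← one_sub_lazyMat hd, geom_sum_mul_neg, Matrix.sub_mulVec, Matrix.one_mulVec]
  -- The case ℓ = 0 is R(u,v) itself, so the remainder can be compared with R term by term.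
  have hτ : ∀ ℓ, pairVec u v ⬝ᵥ (G.lazyMat ^ ℓ *ᵥ z) =
      ∑ i, (1 - ev i / 2) ^ ℓ * (ev i * (ψ i ⬝ᵥ w) ^ 2) := by
    intro ℓ
    have h1 : G.sqrtDeg *ᵥ (G.lazyMat ^ ℓ *ᵥ z) = (1 - (1 / 2 : ℝ) • N) ^ ℓ *ᵥ w := by
      rw [Matrix.mulVec_mulVec, sqrtDeg_mul_lazyMat_pow hd, ← Matrix.mulVec_mulVec]
    rw [hx, sqrtDeg, ← dotProduct_diagonal_mulVec, ← sqrtDeg, h1,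
      dotProduct_eq_sum_eigvec G.normLap_isHermitian]
    refine Finset.sum_congr rfl fun i _ => ?_
    rw [eigvec_dotProduct_mulVec, eigvec_dotProduct_pow]
    ring
  have hR : G.effRes u v = ∑ i, ev i * (ψ i ⬝ᵥ w) ^ 2 := by
    have h := hτ 0
    simp only [pow_zero, one_mul, Matrix.one_mulVec] at h
    rw [effRes_eq, h]
  have hnn : ∀ i, 0 ≤ ev i * (ψ i ⬝ᵥ w) ^ 2 := fun i =>
    mul_nonneg (eigenvalues_nonneg G i) (sq_nonneg _)
  have hle2 : ∀ i, 0 ≤ 1 - ev i / 2 := fun i => by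
    have := eigenvalues_le_two hd i
    linarith
  have h1 : 0 ≤ pairVec u v ⬝ᵥ (G.lazyMat ^ ℓ *ᵥ z) := by
    rw [hτ]
    exact Finset.sum_nonneg fun i _ => mul_nonneg (pow_nonneg (hle2 i) ℓ) (hnn i)
  have h2 : pairVec u v ⬝ᵥ (G.lazyMat ^ ℓ *ᵥ z) ≤ (1 - G.specGap hn / 2) ^ ℓ * G.effRes u v := by
    rw [hτ, hR, Finset.mul_sum]
    refine Finset.sum_le_sum fun i _ => ?_
    -- The null eigenvector, whose factor does not decay, has weight zero; all other factors decay
    -- at least at the rate of the spectral gap.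
    by_cases hi : ev i = 0
    · rw [hi]; simp
    · refine mul_le_mul_of_nonneg_right (pow_le_pow_left₀ (hle2 i) ?_ ℓ) (hnn i)
      have := specGap_le_eigenvalues hG hn i hi
      linarith
  rw [hE]
  constructor <;> linarith

-- Truncation costs (ε/2) R. Each of the four terms has a coefficient 1/d_u or 1/d_v that is at most
-- R, so each contributes an error of at most (ε/8) R. For u = v both numbers are 0.
include hG in
theorem approx_of_close (hn : 2 ≤ n) {ε : ℝ} {ℓ : ℕ}
    (hℓ : (1 - G.specGap hn / 2) ^ ℓ ≤ ε / 2) {σ : Fin n → Fin n → ℝ}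
    (hσ : ∀ x y, |σ x y - G.visits ℓ x y| ≤ ε / 8) (u v : Fin n) :
    Approx ε (G.effRes u v) (estimate G.deg σ u v) := by
  by_cases huv : u = v
  · subst huv
    rw [effRes_self, show estimate G.deg σ u u = 0 by rw [estimate]; ring]
    constructor <;> simp
  have hd := deg_pos hG hn
  have hR := effRes_nonneg hG u v
  obtain ⟨h1, h2⟩ := estimate_visits hG hn ℓ u v
  have h3 : 1 / G.deg u ≤ G.effRes u v :=
    (div_le_iff₀ (hd u)).2 (one_le_effRes_mul_deg hG huv)
  have h4 : 1 / G.deg v ≤ G.effRes u v :=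
    (div_le_iff₀ (hd v)).2 (one_le_effRes_mul_deg' hG huv)
  have h5 : 0 ≤ 1 / G.deg u := (one_div_pos.2 (hd u)).le
  have h6 : 0 ≤ 1 / G.deg v := (one_div_pos.2 (hd v)).le
  have h7 : ∀ (d : ℝ) (x y : Fin n), 0 ≤ d → d ≤ G.effRes u v →
      |d * σ x y - d * G.visits ℓ x y| ≤ G.effRes u v * (ε / 8) := by
    intro d x y hd hd'
    rw [← mul_sub, abs_mul, abs_of_nonneg hd]
    exact mul_le_mul hd' (hσ x y) (abs_nonneg _) hR
  have e1 := abs_le.1 (h7 _ u u h5 h3)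
  have e2 := abs_le.1 (h7 _ u v h6 h4)
  have e3 := abs_le.1 (h7 _ v v h6 h4)
  have e4 := abs_le.1 (h7 _ v u h5 h3)
  have h8 : (1 - G.specGap hn / 2) ^ ℓ * G.effRes u v ≤ ε / 2 * G.effRes u v :=
    mul_le_mul_of_nonneg_right hℓ hR
  rw [estimate] at h1 h2
  rw [Approx, estimate]
  constructor <;> nlinarith

end WGraph

/-! ### Expectations -/

section expectation

variable {α β : Type}

/-- The expectation of a nonnegative random variable. -/
def ex (μ : PMF α) (f : α → ENNReal) : ENNReal := ∑' a, μ a * f a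

theorem ex_pure (a : α) (f : α → ENNReal) : ex (PMF.pure a) f = f a := by
  rw [ex, tsum_eq_single a]
  · simp
  · intro b hb
    rw [PMF.pure_apply, if_neg hb, zero_mul]

theorem ex_bind (μ : PMF α) (κ : α → PMF β) (f : β → ENNReal) :
    ex (μ.bind κ) f = ex μ fun a => ex (κ a) f := by
  simp only [ex, PMF.bind_apply, ← ENNReal.tsum_mul_right, ← ENNReal.tsum_mul_left, mul_assoc]
  exact ENNReal.tsum_comm

theorem ex_map (μ : PMF α) (g : α → β) (f : β → ENNReal) : ex (μ.map g) f = ex μ fun a => f (g a) := by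
  rw [PMF.map, ex_bind]
  simp only [Function.comp, ex_pure]

theorem ex_mono {μ : PMF α} {f g : α → ENNReal} (h : ∀ a ∈ μ.support, f a ≤ g a) :
    ex μ f ≤ ex μ g := by
  refine ENNReal.tsum_le_tsum fun a => ?_
  by_cases ha : a ∈ μ.support
  · exact mul_le_mul_right (h a ha) _
  · rw [(PMF.apply_eq_zero_iff μ a).2 ha, zero_mul, zero_mul]

theorem ex_congr {μ : PMF α} {f g : α → ENNReal} (h : ∀ a ∈ μ.support, f a = g a) :
    ex μ f = ex μ g :=
  le_antisymm (ex_mono fun a ha => (h a ha).le) (ex_mono fun a ha => (h a ha).ge)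

theorem ex_const (μ : PMF α) (x : ENNReal) : ex μ (fun _ => x) = x := by
  rw [ex, ENNReal.tsum_mul_right, PMF.tsum_coe, one_mul]

theorem ex_add (μ : PMF α) (f g : α → ENNReal) : ex μ (fun a => f a + g a) = ex μ f + ex μ g := by
  simp only [ex, mul_add, ENNReal.tsum_add]

theorem ex_const_mul (μ : PMF α) (x : ENNReal) (f : α → ENNReal) :
    ex μ (fun a => x * f a) = x * ex μ f := by
  simp only [ex, ← ENNReal.tsum_mul_left, mul_left_comm]

theorem ex_sum {ι : Type*} (S : Finset ι) (μ : PMF α) (f : ι → α → ENNReal) :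
    ex μ (fun a => ∑ i ∈ S, f i a) = ∑ i ∈ S, ex μ (f i) := by
  classical
  induction S using Finset.induction_on with
  | empty => simp [ex]
  | insert i S hi ih => simp only [Finset.sum_insert hi, ex_add, ih]

theorem ex_fintype [Fintype α] (μ : PMF α) (f : α → ENNReal) : ex μ f = ∑ a, μ a * f a :=
  tsum_fintype _

/-- Markov's inequality. -/
theorem toOuterMeasure_le_ex (μ : PMF α) (A : Set α) (f : α → ENNReal) (h : ∀ a ∈ A, 1 ≤ f a) :
    μ.toOuterMeasure A ≤ ex μ f := by
  rw [PMF.toOuterMeasure_apply]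
  refine ENNReal.tsum_le_tsum fun a => ?_
  by_cases ha : a ∈ A
  · rw [Set.indicator_of_mem ha]
    exact le_mul_of_one_le_right' (h a ha)
  · rw [Set.indicator_of_notMem ha]
    exact zero_le

theorem toOuterMeasure_compl (μ : PMF α) (A : Set α) :
    μ.toOuterMeasure A + μ.toOuterMeasure Aᶜ = 1 := by
  rw [PMF.toOuterMeasure_apply, PMF.toOuterMeasure_apply, ← ENNReal.tsum_add, ← μ.tsum_coe]
  refine tsum_congr fun a => ?_
  by_cases ha : a ∈ A <;> simp [ha]

theorem one_sub_le_toReal_toOuterMeasure (μ : PMF α) (A : Set α) {x : ℝ} (hx : 0 ≤ x)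
    (h : μ.toOuterMeasure Aᶜ ≤ ENNReal.ofReal x) : 1 - x ≤ (μ.toOuterMeasure A).toReal := by
  have h1 := toOuterMeasure_compl μ A
  have h2 : μ.toOuterMeasure A ≠ ⊤ := fun h => by simp [h] at h1
  have h3 : μ.toOuterMeasure Aᶜ ≠ ⊤ := fun h => by simp [h] at h1
  have h4 := congrArg ENNReal.toReal h1
  rw [ENNReal.toReal_add h2 h3, ENNReal.toReal_one] at h4
  have h5 := ENNReal.toReal_le_of_le_ofReal hx h
  linarith

/-- Convexity: on [0, 1] the function x ↦ e^{θx} lies below its chord. -/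
theorem exp_mul_le {θ x : ℝ} (h0 : 0 ≤ x) (h1 : x ≤ 1) :
    Real.exp (θ * x) ≤ x * Real.exp θ + (1 - x) := by
  have := convexOn_exp.2 (Set.mem_univ θ) (Set.mem_univ 0) h0 (sub_nonneg.2 h1) (by ring)
  simpa [mul_comm] using this

/-- The moment generating function of a `[0, 1]`-valued random variable. -/
theorem ex_exp_le {μ : PMF α} {X : α → ℝ} (hX : ∀ a ∈ μ.support, 0 ≤ X a ∧ X a ≤ 1) {p : ℝ}
    (hp : 0 ≤ p) (hE : ex μ (fun a => ENNReal.ofReal (X a)) = ENNReal.ofReal p) {θ : ℝ}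
    (hθ : |θ| ≤ 1) :
    ex μ (fun a => ENNReal.ofReal (Real.exp (θ * X a))) ≤
      ENNReal.ofReal (Real.exp (θ * p + θ ^ 2)) := by
  have h1 : ex μ (fun a => ENNReal.ofReal (X a)) + ex μ (fun a => ENNReal.ofReal (1 - X a)) = 1 := by
    rw [← ex_add, ← ex_const μ 1]
    refine ex_congr fun a ha => ?_
    rw [← ENNReal.ofReal_add (hX a ha).1 (sub_nonneg.2 (hX a ha).2)]
    simp
  have hp1 : p ≤ 1 := by
    rw [hE] at h1
    have : ENNReal.ofReal p ≤ 1 := by rw [← h1]; exact le_self_add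
    exact ENNReal.ofReal_le_one.1 this
  have h2 : ex μ (fun a => ENNReal.ofReal (1 - X a)) = ENNReal.ofReal (1 - p) := by
    rw [hE] at h1
    have h3 : ENNReal.ofReal p + ENNReal.ofReal (1 - p) = 1 := by
      rw [← ENNReal.ofReal_add hp (sub_nonneg.2 hp1)]
      simp
    exact (ENNReal.add_right_inj ENNReal.ofReal_ne_top).1 (h1.trans h3.symm)
  calc ex μ (fun a => ENNReal.ofReal (Real.exp (θ * X a)))
      ≤ ex μ (fun a => ENNReal.ofReal (Real.exp θ) * ENNReal.ofReal (X a) +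
          ENNReal.ofReal (1 - X a)) := ex_mono fun a ha => by
        rw [← ENNReal.ofReal_mul (Real.exp_pos _).le, ← ENNReal.ofReal_add
          (mul_nonneg (Real.exp_pos _).le (hX a ha).1) (sub_nonneg.2 (hX a ha).2)]
        refine ENNReal.ofReal_le_ofReal ?_
        rw [mul_comm (Real.exp θ)]
        exact exp_mul_le (hX a ha).1 (hX a ha).2
    _ = ENNReal.ofReal (Real.exp θ * p + (1 - p)) := by
        rw [ex_add, ex_const_mul, hE, h2, ← ENNReal.ofReal_mul (Real.exp_pos _).le,
          ← ENNReal.ofReal_add (mul_nonneg (Real.exp_pos _).le hp) (sub_nonneg.2 hp1)]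
    _ ≤ _ := by
        refine ENNReal.ofReal_le_ofReal ?_
        -- For |θ| ≤ 1 one has e^θ - 1 ≤ θ + θ². Together with 0 ≤ p ≤ 1 this bounds 1 + p(e^θ - 1)
        -- by 1 + θp + θ², and the exponential dominates.
        have h3 := (abs_le.1 (Real.abs_exp_sub_one_sub_id_le hθ)).2
        have h4 := Real.add_one_le_exp (θ * p + θ ^ 2)
        nlinarith [sq_nonneg θ]

end expectation

/-! ### The random walks of the sketch -/

namespace WGraph

variable {n : ℕ} (G : WGraph n) (hd : ∀ u, 0 < G.deg u)

/-- One step of the random walk on the graph. -/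
def nextPMF (u : Fin n) : PMF (Fin n) :=
  PMF.ofFintype (fun v => ENNReal.ofReal (G.A u v / G.deg u)) (by
    rw [← ENNReal.ofReal_sum_of_nonneg fun v _ => div_nonneg (G.nonneg u v) (hd u).le,
      ← Finset.sum_div, ← deg, div_self (hd u).ne', ENNReal.ofReal_one])

/-- One step of the lazy random walk on the graph. -/
def lazyPMF (u : Fin n) : PMF (Fin n) :=
  (coinPMF (1 / 2)).bind fun b => cond b (G.nextPMF hd u) (PMF.pure u)

theorem lazyMat_nonneg (u v : Fin n) : 0 ≤ G.lazyMat u v := by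
  rw [lazyMat, Matrix.smul_apply, Matrix.add_apply, Matrix.diagonal_mul, Matrix.one_apply]
  have h1 : 0 ≤ G.deg u := Finset.sum_nonneg fun v _ => G.nonneg u v
  have := mul_nonneg (inv_nonneg.2 h1) (G.nonneg u v)
  split_ifs <;> simp only [smul_eq_mul] <;> positivity

theorem lazyMat_pow_nonneg (k : ℕ) (u v : Fin n) : 0 ≤ (G.lazyMat ^ k) u v := by
  induction k generalizing u with
  | zero => simp only [pow_zero, Matrix.one_apply]; split_ifs <;> norm_num
  | succ k ih =>
    rw [pow_succ', Matrix.mul_apply]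
    exact Finset.sum_nonneg fun y _ => mul_nonneg (G.lazyMat_nonneg u y) (ih y)

theorem coinPMF_true (x : ℝ) : coinPMF x true = min (ENNReal.ofReal x) 1 := rfl

theorem coinPMF_false (x : ℝ) : coinPMF x false = 1 - min (ENNReal.ofReal x) 1 := rfl

theorem lazyPMF_apply (u v : Fin n) : G.lazyPMF hd u v = ENNReal.ofReal (G.lazyMat u v) := by
  have hh : (1 : ENNReal) - ENNReal.ofReal (1 / 2) = ENNReal.ofReal (1 / 2) := by
    rw [← ENNReal.ofReal_one, ← ENNReal.ofReal_sub _ (by norm_num)]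
    norm_num
  have hm : min (ENNReal.ofReal (1 / 2)) 1 = ENNReal.ofReal (1 / 2) :=
    min_eq_left (ENNReal.ofReal_le_one.2 (by norm_num))
  have hA := div_nonneg (G.nonneg u v) (hd u).le
  rw [lazyPMF, PMF.bind_apply, tsum_fintype, Fintype.sum_bool, coinPMF_true, coinPMF_false, hm, hh,
    cond_true, cond_false, nextPMF, PMF.ofFintype_apply, PMF.pure_apply, lazyMat,
    Matrix.smul_apply, Matrix.add_apply, Matrix.diagonal_mul, Matrix.one_apply, ← mul_add,
    smul_eq_mul, ENNReal.ofReal_mul (by norm_num : (0 : ℝ) ≤ 1 / 2)]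
  congr 1
  rw [ENNReal.ofReal_add (by split_ifs <;> norm_num)
    (mul_nonneg (inv_nonneg.2 (hd u).le) (G.nonneg u v)), add_comm, div_eq_inv_mul]
  congr 1
  split_ifs with h1 h2 h2
  · simp
  · exact absurd h1.symm h2
  · exact absurd h2.symm h1
  · simp

/-- One step of the walk, together with the numbers of visits so far. -/
def walkStep (_ : ℕ) (a : Fin n × (Fin n → ℕ)) : PMF (Fin n × (Fin n → ℕ)) :=
  (G.lazyPMF hd a.1).map fun y => (y, Function.update a.2 a.1 (a.2 a.1 + 1))

/-- A whole walk of `ℓ` steps from `u`, added to the numbers of visits. -/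
def walkFrom (ℓ : ℕ) (u : Fin n) (_ : ℕ) (c : Fin n → ℕ) : PMF (Fin n → ℕ) :=
  (iter (G.walkStep hd) 0 ℓ (u, c)).map Prod.snd

/-- The numbers of visits of `r` independent walks of `ℓ` steps from `u`. -/
def rowPMF (ℓ r : ℕ) (u : Fin n) : PMF (Fin n → ℕ) := iter (G.walkFrom hd ℓ u) 0 r 0

/-- The table of the numbers of visits is filled in, row `i`. -/
def tableStep (ℓ r i : ℕ) (cs : Fin n → Fin n → ℕ) : PMF (Fin n → Fin n → ℕ) :=
  if h : i < n then (G.rowPMF hd ℓ r ⟨i, h⟩).map (Function.update cs ⟨i, h⟩) else PMF.pure cs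

/-- The table of the numbers of visits. -/
def tablePMF (ℓ r : ℕ) : PMF (Fin n → Fin n → ℕ) := iter (G.tableStep hd ℓ r) 0 n 0

variable {G hd}

/-! ### Totals, means and tails of the visit counts. -/

theorem sum_update_add_one (c : Fin n → ℕ) (x : Fin n) :
    ∑ v, Function.update c x (c x + 1) v = ∑ v, c v + 1 := by
  have h := Finset.add_sum_erase Finset.univ c (Finset.mem_univ x)
  rw [← Finset.add_sum_erase _ _ (Finset.mem_univ x), Function.update_self, ← h]
  rw [Finset.sum_congr rfl fun v hv => Function.update_of_ne (Finset.ne_of_mem_erase hv) _ _]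
  ring

/-- Every step raises exactly one count by one. The total is what makes the rows sparse; the bound
per vertex puts visits divided by ℓ into [0, 1]. -/
theorem walk_support {i ℓ : ℕ} {a b : Fin n × (Fin n → ℕ)}
    (h : b ∈ (iter (G.walkStep hd) i ℓ a).support) :
    ∑ v, b.2 v = ∑ v, a.2 v + ℓ ∧ ∀ v, b.2 v ≤ a.2 v + ℓ := by
  induction ℓ generalizing i a with
  | zero =>
    rw [iter, PMF.mem_support_pure_iff] at h
    simp [h]
  | succ ℓ ih =>
    rw [iter, PMF.mem_support_bind_iff] at h
    obtain ⟨a', ha, hb⟩ := h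
    rw [walkStep, PMF.mem_support_map_iff] at ha
    obtain ⟨y, -, rfl⟩ := ha
    obtain ⟨h1, h2⟩ := ih hb
    simp only [sum_update_add_one] at h1
    refine ⟨by omega, fun v => (h2 v).trans ?_⟩
    by_cases hv : v = a.1
    · subst hv; simp; omega
    · simp only [Function.update_of_ne hv]; omega

/-- The total is the same for all outcomes, so the bound on the number of nonzero coordinates holds
surely. -/
theorem row_support {ℓ r i : ℕ} {u : Fin n} {c c' : Fin n → ℕ}
    (h : c' ∈ (iter (G.walkFrom hd ℓ u) i r c).support) : ∑ v, c' v = ∑ v, c v + r * ℓ := by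
  induction r generalizing i c with
  | zero =>
    rw [iter, PMF.mem_support_pure_iff] at h
    simp [h]
  | succ r ih =>
    rw [iter, PMF.mem_support_bind_iff] at h
    obtain ⟨c1, h1, h2⟩ := h
    rw [walkFrom, PMF.mem_support_map_iff] at h1
    obtain ⟨a, ha, rfl⟩ := h1
    rw [ih h2, (walk_support ha).1]
    ring

/-- The moves do not depend on the counts, so old counts are merely added. This is what makes
successive walks independent. -/
theorem walk_shift (i ℓ : ℕ) (x : Fin n) (c c' : Fin n → ℕ) :
    iter (G.walkStep hd) i ℓ (x, c + c') =
      (iter (G.walkStep hd) i ℓ (x, c')).map fun a => (a.1, c + a.2) := by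
  induction ℓ generalizing i x c' with
  | zero => simp [iter, PMF.pure_map]
  | succ ℓ ih =>
    rw [iter, iter, walkStep, walkStep, PMF.bind_map, PMF.bind_map, PMF.map_bind]
    congr 1
    ext1 y
    simp only [Function.comp]
    rw [← ih]
    congr 2
    ext v
    by_cases hv : v = x
    · subst hv; simp; ring
    · simp [Function.update_of_ne hv]

/-- First-step analysis. The count is raised before the move, so the times counted are 0, …, ℓ - 1,
and the sum of P^k over k ≤ ℓ is I + P times the sum over k < ℓ. -/
theorem walk_mean (i ℓ : ℕ) (x : Fin n) (c : Fin n → ℕ) (v : Fin n) :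
    ex (iter (G.walkStep hd) i ℓ (x, c)) (fun a => (a.2 v : ENNReal)) =
      c v + ENNReal.ofReal ((∑ k ∈ Finset.range ℓ, G.lazyMat ^ k) x v) := by
  have hpow : ∀ k x, 0 ≤ (G.lazyMat ^ k) x v := fun k x => G.lazyMat_pow_nonneg k x v
  have hsum : ∀ ℓ x, 0 ≤ (∑ k ∈ Finset.range ℓ, G.lazyMat ^ k) x v := by
    intro ℓ x
    rw [Matrix.sum_apply]
    exact Finset.sum_nonneg fun k _ => hpow k x
  induction ℓ generalizing i x c with
  | zero => simp [iter, ex_pure]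
  | succ ℓ ih =>
    rw [iter, ex_bind, walkStep, ex_map]
    simp only [ih]
    rw [ex_add, ex_const, ex_fintype]
    simp only [lazyPMF_apply]
    rw [Finset.sum_congr rfl fun y _ => (ENNReal.ofReal_mul (G.lazyMat_nonneg x y)).symm,
      ← ENNReal.ofReal_sum_of_nonneg fun y _ => mul_nonneg (G.lazyMat_nonneg x y) (hsum ℓ y),
      ← Matrix.mul_apply, Finset.mul_sum, Finset.sum_range_succ', Matrix.add_apply, pow_zero,
      Matrix.one_apply]
    simp only [← pow_succ']
    rw [ENNReal.ofReal_add (by rw [Matrix.sum_apply]; exact Finset.sum_nonneg fun k _ => hpow _ x)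
      (by split_ifs <;> norm_num), ← add_assoc, add_right_comm]
    congr 1
    split_ifs with h
    · subst h; simp
    · rw [Function.update_of_ne (Ne.symm h)]; simp

/-- `ex_exp_le` for the number of visits divided by ℓ. The factor 2 undoes the division by 2 in
`visits`. -/
theorem walk_mgf (ℓ : ℕ) (hℓ : 0 < ℓ) (x v : Fin n) {θ : ℝ} (hθ : |θ| ≤ 1) :
    ex (iter (G.walkStep hd) 0 ℓ (x, 0)) (fun a => ENNReal.ofReal (Real.exp (θ / ℓ * a.2 v))) ≤
      ENNReal.ofReal (Real.exp (θ * (2 * G.visits ℓ x v / ℓ) + θ ^ 2)) := by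
  have hl : (0 : ℝ) < ℓ := Nat.cast_pos.2 hℓ
  have hv : 2 * G.visits ℓ x v = (∑ k ∈ Finset.range ℓ, G.lazyMat ^ k) x v := by
    rw [visits]; ring
  have hm := walk_mean (hd := hd) 0 ℓ x 0 v
  simp only [Pi.zero_apply, Nat.cast_zero, zero_add, ← hv] at hm
  set p := 2 * G.visits ℓ x v with hp
  have hE : ex (iter (G.walkStep hd) 0 ℓ (x, 0)) (fun a => ENNReal.ofReal (a.2 v / ℓ)) =
      ENNReal.ofReal (max p 0 / ℓ) := by
    simp only [div_eq_inv_mul]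
    rw [ENNReal.ofReal_mul (inv_nonneg.2 hl.le)]
    simp only [ENNReal.ofReal_mul (inv_nonneg.2 hl.le), ENNReal.ofReal_natCast]
    rw [ex_const_mul, hm]
    congr 1
    rcases le_total p 0 with h | h
    · rw [max_eq_right h, ENNReal.ofReal_of_nonpos h, ENNReal.ofReal_zero]
    · rw [max_eq_left h]
  have hp0 : 0 ≤ p := by
    rw [hv, Matrix.sum_apply]
    exact Finset.sum_nonneg fun k _ => G.lazyMat_pow_nonneg k x v
  rw [max_eq_left hp0] at hE
  have h := ex_exp_le (X := fun a : Fin n × (Fin n → ℕ) => (a.2 v : ℝ) / ℓ) (fun a ha => ?_)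
    (div_nonneg hp0 hl.le) hE hθ
  · refine le_trans (le_of_eq ?_) h
    refine ex_congr fun a _ => ?_
    rw [div_mul_eq_mul_div, mul_div_assoc]
  · refine ⟨by positivity, (div_le_one hl).2 ?_⟩
    have := (walk_support ha).2 v
    simp only [Pi.zero_apply, zero_add] at this
    exact_mod_cast this

theorem ofReal_exp_add (x y : ℝ) : ENNReal.ofReal (Real.exp (x + y)) =
    ENNReal.ofReal (Real.exp x) * ENNReal.ofReal (Real.exp y) := by
  rw [Real.exp_add, ENNReal.ofReal_mul (Real.exp_pos _).le]

/-- By `walk_shift` each walk multiplies the moment generating function by the same factor. -/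
theorem row_mgf (ℓ r i : ℕ) (u v : Fin n) (c : Fin n → ℕ) (θ : ℝ) :
    ex (iter (G.walkFrom hd ℓ u) i r c) (fun c => ENNReal.ofReal (Real.exp (θ * c v))) =
      ENNReal.ofReal (Real.exp (θ * c v)) *
        (ex (iter (G.walkStep hd) 0 ℓ (u, 0))
          fun a => ENNReal.ofReal (Real.exp (θ * a.2 v))) ^ r := by
  induction r generalizing i c with
  | zero => simp [iter, ex_pure]
  | succ r ih =>
    rw [iter, ex_bind, walkFrom, ex_map]
    simp only [ih]
    have h := walk_shift (hd := hd) 0 ℓ u c 0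
    rw [add_zero] at h
    rw [h, ex_map, pow_succ', ← mul_assoc, ← ex_const_mul, mul_comm, ← ex_const_mul]
    refine ex_congr fun a _ => ?_
    rw [mul_comm _ (_ ^ r)]
    congr 1
    rw [← ofReal_exp_add]
    simp only [Pi.add_apply]
    push_cast
    ring_nf

/-- Chernoff's method with θ = ±δ/2 and δ = ε/(8ℓ): on the bad event one of the two exponentials is
at least 1. A deviation of ε/16 in the frequency is one of rδ in the count divided by ℓ, and the
exponent is r(δ²/4 - δ²/2) = -rε²/(256ℓ²). -/
theorem row_tail (ℓ r : ℕ) (hℓ : 0 < ℓ) (hr : 0 < r) (u v : Fin n) {ε : ℝ} (hε : 0 < ε)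
    (hε1 : ε ≤ 1) :
    (G.rowPMF hd ℓ r u).toOuterMeasure {c | ε / 16 < |(c v : ℝ) / (2 * r) - G.visits ℓ u v|} ≤
      ENNReal.ofReal (2 * Real.exp (-(r * (ε ^ 2 / (256 * ℓ ^ 2))))) := by
  have hl : (0 : ℝ) < ℓ := Nat.cast_pos.2 hℓ
  have hr' : (0 : ℝ) < r := Nat.cast_pos.2 hr
  have hl1 : (1 : ℝ) ≤ ℓ := Nat.one_le_cast.2 hℓ
  set δ := ε / (8 * ℓ) with hδ
  have hδ0 : 0 < δ := by positivity
  have hδ1 : δ ≤ 1 := (div_le_one (by positivity)).2 (by linarith)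
  set p := 2 * G.visits ℓ u v / ℓ with hp
  have key : ∀ θ : ℝ, |θ| = δ / 2 →
      ex (G.rowPMF hd ℓ r u) (fun c => ENNReal.ofReal (Real.exp (θ / ℓ * c v +
        (-(r * (θ * p + |θ| * δ)))))) ≤
        ENNReal.ofReal (Real.exp (-(r * (ε ^ 2 / (256 * ℓ ^ 2))))) := by
    intro θ hθ
    have hθ1 : |θ| ≤ 1 := by rw [hθ]; linarith
    have hθ2 : θ ^ 2 = (δ / 2) ^ 2 := by rw [← sq_abs, hθ]
    simp only [ofReal_exp_add _ (-(r * (θ * p + |θ| * δ))), mul_comm _ (ENNReal.ofReal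
      (Real.exp (-(r * (θ * p + |θ| * δ)))))]
    rw [ex_const_mul, rowPMF, row_mgf]
    have h1 := pow_le_pow_left' (walk_mgf (hd := hd) ℓ hℓ u v hθ1) r
    rw [← hp, ← ENNReal.ofReal_pow (Real.exp_pos _).le, ← Real.exp_nat_mul] at h1
    refine (mul_le_mul_right (mul_le_mul_right h1 _) _).trans_eq ?_
    rw [← ofReal_exp_add, ← ofReal_exp_add]
    congr 2
    rw [hθ, hθ2, Pi.zero_apply, hδ]
    field_simp
    ring
  have k1 := key (δ / 2) (abs_of_pos (by positivity))
  have k2 := key (-(δ / 2)) (by rw [abs_neg, abs_of_pos (by positivity)])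
  refine (toOuterMeasure_le_ex _ _ _ ?_).trans ((ex_add _ _ _).trans_le (add_le_add k1 k2) |>.trans_eq ?_)
  · intro c hc
    rw [Set.mem_ofPred_eq, lt_abs] at hc
    have hpl : G.visits ℓ u v = p * ℓ / 2 := by rw [hp]; field_simp
    rw [hpl] at hc
    have hεδ : ε = δ * (8 * ℓ) := by rw [hδ]; field_simp
    rw [abs_neg, abs_of_pos (by positivity : 0 < δ / 2)]
    rcases hc with hc | hc
    · refine le_trans ?_ le_self_add
      rw [ENNReal.one_le_ofReal, Real.one_le_exp_iff]
      have h1 : r * (p * ℓ + ε / 8) ≤ c v := by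
        rw [lt_sub_iff_add_lt, lt_div_iff₀ (by positivity)] at hc
        nlinarith
      have h2 := mul_le_mul_of_nonneg_left h1 (by positivity : 0 ≤ δ / 2 / ℓ)
      have h3 : δ / 2 / ℓ * (r * (p * ℓ + ε / 8)) = r * (δ / 2 * p + δ / 2 * δ) := by
        rw [hεδ]; field_simp
      linarith
    · refine le_trans ?_ le_add_self
      rw [ENNReal.one_le_ofReal, Real.one_le_exp_iff]
      have h1 : c v ≤ r * (p * ℓ - ε / 8) := by
        rw [neg_sub, lt_sub_comm, div_lt_iff₀ (by positivity)] at hc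
        nlinarith
      have h2 := mul_le_mul_of_nonneg_left h1 (by positivity : 0 ≤ δ / 2 / ℓ)
      have h3 : δ / 2 / ℓ * (r * (p * ℓ - ε / 8)) = r * (δ / 2 * p - δ / 2 * δ) := by
        rw [hεδ]; field_simp
      have h4 : -(δ / 2) / ℓ * (c v : ℝ) = -(δ / 2 / ℓ * c v) := by ring
      linarith
  · rw [← ENNReal.ofReal_add (Real.exp_pos _).le (Real.exp_pos _).le, two_mul]

/-- Step i writes row i and no other: the cost of the rows before i is already fixed, and each of
the j remaining rows adds at most x on average. Only linearity is needed, not independence of the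
rows. -/
theorem table_ex (ℓ r : ℕ) (f : Fin n → (Fin n → ℕ) → ENNReal) {x : ENNReal}
    (hf : ∀ u, ex (G.rowPMF hd ℓ r u) (f u) ≤ x) (j : ℕ) : ∀ i, i + j = n → ∀ cs,
    ex (iter (G.tableStep hd ℓ r) i j cs) (fun cs => ∑ u, f u (cs u)) ≤
      ∑ u with u.1 < i, f u (cs u) + j * x := by
  induction j with
  | zero =>
    intro i hi cs
    rw [iter, ex_pure, Finset.filter_true_of_mem fun u _ => by omega]
    exact le_self_add
  | succ j ih =>
    intro i hi cs
    have hin : i < n := by omega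
    rw [iter, ex_bind, tableStep, dif_pos hin, ex_map]
    have hset : (Finset.univ.filter fun u : Fin n => u.1 < i + 1) =
        insert ⟨i, hin⟩ (Finset.univ.filter fun u : Fin n => u.1 < i) := by
      ext u
      simp only [Finset.mem_filter, Finset.mem_univ, true_and, Finset.mem_insert, Fin.ext_iff]
      omega
    refine (ex_mono fun c _ => ih (i + 1) (by omega) _).trans ?_
    rw [ex_add, ex_const]
    have h1 : ∀ c : Fin n → ℕ, ∑ u with u.1 < i + 1, f u (Function.update cs ⟨i, hin⟩ c u) =
        f ⟨i, hin⟩ c + ∑ u with u.1 < i, f u (cs u) := by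
      intro c
      rw [hset, Finset.sum_insert (by simp), Function.update_self]
      congr 1
      refine Finset.sum_congr rfl fun u hu => ?_
      rw [Function.update_of_ne]
      rintro rfl
      simp at hu
    simp only [h1]
    rw [ex_add, ex_const]
    push_cast
    calc _ ≤ x + ∑ u with u.1 < i, f u (cs u) + j * x := by gcongr; exact hf _
      _ = _ := by ring

theorem table_support {ℓ r : ℕ} (j : ℕ) : ∀ i, i + j = n → ∀ cs cs' : Fin n → Fin n → ℕ,
    (∀ u : Fin n, u.1 < i → ∑ v, cs u v = r * ℓ) →
    cs' ∈ (iter (G.tableStep hd ℓ r) i j cs).support → ∀ u, ∑ v, cs' u v = r * ℓ := by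
  induction j with
  | zero =>
    intro i hi cs cs' h hcs u
    rw [iter, PMF.mem_support_pure_iff] at hcs
    rw [hcs, h u (by omega)]
  | succ j ih =>
    intro i hi cs cs' h hcs
    have hin : i < n := by omega
    rw [iter, PMF.mem_support_bind_iff] at hcs
    obtain ⟨cs1, h1, h2⟩ := hcs
    rw [tableStep, dif_pos hin, PMF.mem_support_map_iff] at h1
    obtain ⟨c, hc, rfl⟩ := h1
    refine ih (i + 1) (by omega) _ cs' (fun u hu => ?_) h2
    by_cases hui : u = ⟨i, hin⟩
    · subst hui
      rw [Function.update_self, row_support hc]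
      simp
    · rw [Function.update_of_ne hui]
      refine h u ?_
      rw [Fin.ext_iff] at hui
      simp only at hui
      omega

theorem tablePMF_support {ℓ r : ℕ} {cs : Fin n → Fin n → ℕ}
    (h : cs ∈ (G.tablePMF hd ℓ r).support) (u : Fin n) : ∑ v, cs u v = r * ℓ :=
  table_support n 0 (by omega) 0 cs (fun u hu => absurd hu (by omega)) h u

/-- With high probability all the empirical visit frequencies are accurate. -/
theorem table_accurate (hn : 2 ≤ n) (c ℓ r : ℕ) (hℓ : 0 < ℓ) {ε : ℝ} (hε : 0 < ε) (hε1 : ε ≤ 1)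
    (hr : 256 * (c + 3) * Real.log n * ℓ ^ 2 / ε ^ 2 ≤ r) :
    1 - 1 / (n : ℝ) ^ c ≤ ((G.tablePMF hd ℓ r).toOuterMeasure
      {cs | ∀ u v, |(cs u v : ℝ) / (2 * r) - G.visits ℓ u v| ≤ ε / 16}).toReal := by
  have hn' : (2 : ℝ) ≤ n := by exact_mod_cast hn
  have hlog : 0 < Real.log n := Real.log_pos (by linarith)
  have hl : (0 : ℝ) < ℓ := Nat.cast_pos.2 hℓ
  have hr0 : 0 < r := by
    have : (0 : ℝ) < r := lt_of_lt_of_le (by positivity) hr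
    exact_mod_cast this
  refine one_sub_le_toReal_toOuterMeasure _ _ (by positivity) ?_
  set B : Fin n → Fin n → Set (Fin n → ℕ) := fun u v =>
    {c | ε / 16 < |(c v : ℝ) / (2 * r) - G.visits ℓ u v|} with hB
  set x := ENNReal.ofReal (2 * Real.exp (-(r * (ε ^ 2 / (256 * ℓ ^ 2))))) with hx
  -- The cost of a table is its number of inaccurate entries; Markov's inequality for it is the
  -- union bound.
  have h1 := table_ex (hd := hd) ℓ r (fun u c => ∑ v, (B u v).indicator 1 c) (x := n * x)
    (fun u => by
      rw [ex_sum]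
      refine (Finset.sum_le_sum (g := fun _ => x) fun v _ => ?_).trans_eq (by simp)
      refine le_trans (le_of_eq ?_) (row_tail (hd := hd) ℓ r hℓ hr0 u v hε hε1)
      rw [ex, PMF.toOuterMeasure_apply]
      refine tsum_congr fun c => ?_
      simp only [Set.indicator_apply]
      split_ifs <;> simp) n 0 (by omega) 0
  refine (toOuterMeasure_le_ex _ _ _ ?_).trans (h1.trans ?_)
  · intro cs hcs
    simp only [Set.mem_compl_iff, Set.mem_ofPred_eq, not_forall, not_le] at hcs
    obtain ⟨u, v, huv⟩ := hcs
    refine le_trans ?_ (Finset.single_le_sum (fun _ _ => zero_le) (Finset.mem_univ u))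
    refine le_trans ?_ (Finset.single_le_sum (fun _ _ => zero_le) (Finset.mem_univ v))
    rw [Set.indicator_of_mem (show cs u ∈ B u v from huv)]
    rfl
  · rw [Finset.filter_false_of_mem fun u _ => by omega, Finset.sum_empty, zero_add, hx,
      ← ENNReal.ofReal_natCast, ← ENNReal.ofReal_mul (by positivity),
      ← ENNReal.ofReal_mul (by positivity)]
    refine ENNReal.ofReal_le_ofReal ?_
    have h2 : (c + 3) * Real.log n ≤ r * (ε ^ 2 / (256 * ℓ ^ 2)) := by
      rw [div_le_iff₀ (by positivity)] at hr
      rw [mul_div_assoc', le_div_iff₀ (by positivity)]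
      linarith
    have h3 : Real.exp (-(r * (ε ^ 2 / (256 * ℓ ^ 2)))) ≤ 1 / (n : ℝ) ^ (c + 3) := by
      rw [Real.exp_neg, ← one_div]
      refine one_div_le_one_div_of_le (by positivity) ?_
      rw [← Real.exp_log (by positivity : (0 : ℝ) < n ^ (c + 3)), Real.log_pow]
      push_cast
      exact Real.exp_le_exp.2 h2
    -- Of the exponent c + 3, two powers of n pay for the pairs and one for the factor 2 ≤ n.
    calc (n : ℝ) * (n * (2 * Real.exp (-(r * (ε ^ 2 / (256 * ℓ ^ 2))))))
        ≤ n * (n * (n * (1 / (n : ℝ) ^ (c + 3)))) := by gcongr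
      _ = 1 / (n : ℝ) ^ c := by
        rw [pow_add]; field_simp

end WGraph

/-! ### Alias tables -/

/-- The positions `0, …, m - 1` of an array hold the stack `l`, its top at `m - 1`. -/
def IsStack (A : ℕ → ℕ) : ℕ → List ℕ → Prop
  | m, [] => m = 0
  | m, x :: l => ∃ m', m = m' + 1 ∧ A m' = x ∧ IsStack A m' l

theorem IsStack.congr {A B : ℕ → ℕ} {m : ℕ} {l : List ℕ} (h : IsStack A m l)
    (hAB : ∀ i < m, B i = A i) : IsStack B m l := by
  induction l generalizing m with
  | nil => exact h
  | cons x l ih =>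
    obtain ⟨m', rfl, h1, h2⟩ := h
    exact ⟨m', rfl, (hAB m' (by omega)).trans h1, ih h2 fun i hi => hAB i (by omega)⟩

theorem IsStack.push {A : ℕ → ℕ} {m : ℕ} {l : List ℕ} (h : IsStack A m l) (x : ℕ) :
    IsStack (Function.update A m x) (m + 1) (x :: l) :=
  ⟨m, rfl, Function.update_self _ _ _, h.congr fun _ hi => Function.update_of_ne hi.ne _ _⟩

theorem list_sum_lt_length {q : ℕ → ℝ} {l : List ℕ} (hl : l ≠ []) (h : ∀ p ∈ l, q p < 1) :
    (l.map q).sum < l.length := by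
  induction l with
  | nil => exact absurd rfl hl
  | cons x l ih =>
    have hx := h x (by simp)
    rcases eq_or_ne l [] with rfl | hl'
    · simpa using hx
    · have := ih hl' fun p hp => h p (by simp [hp])
      simp only [List.map_cons, List.sum_cons, List.length_cons]
      push_cast
      linarith

theorem length_le_list_sum {q : ℕ → ℝ} {l : List ℕ} (h : ∀ p ∈ l, 1 ≤ q p) :
    (l.length : ℝ) ≤ (l.map q).sum := by
  induction l with
  | nil => simp
  | cons x l ih =>
    have hx := h x (by simp)
    have := ih fun p hp => h p (by simp [hp])
    simp only [List.map_cons, List.sum_cons, List.length_cons]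
    push_cast
    linarith

theorem eq_one_of_list_sum_eq_length {q : ℕ → ℝ} {l : List ℕ} (h : ∀ p ∈ l, 1 ≤ q p)
    (hs : (l.map q).sum = l.length) : ∀ p ∈ l, q p = 1 := by
  induction l with
  | nil => simp
  | cons x l ih =>
    have hx := h x (by simp)
    have hl : ∀ p ∈ l, 1 ≤ q p := fun p hp => h p (by simp [hp])
    have := length_le_list_sum hl
    simp only [List.map_cons, List.sum_cons, List.length_cons] at hs
    push_cast at hs
    intro p hp
    rcases List.mem_cons.1 hp with rfl | hp
    · linarith
    · exact ih hl (by linarith) p hp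

/-- The state of the construction of the alias table of the scaled weights `q₀` on the positions
from `lo` to `hi`: the unfinished positions are the light ones in `ls` and the heavy ones in `hs`,
and `q` holds their remaining weights and the probabilities of the finished positions. -/
structure AliasInv (lo hi : ℕ) (q₀ q : ℕ → ℝ) (al : ℕ → ℕ) (ls hs : List ℕ) : Prop where
  nodup : (ls ++ hs).Nodup
  mem : ∀ p ∈ ls ++ hs, lo ≤ p ∧ p < hi
  light : ∀ p ∈ ls, q p < 1
  heavy : ∀ p ∈ hs, 1 ≤ q p
  nonneg : ∀ p, lo ≤ p → p < hi → 0 ≤ q p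
  done : ∀ p, lo ≤ p → p < hi → p ∉ ls → p ∉ hs → q p ≤ 1 ∧ lo ≤ al p ∧ al p < hi
  sum : (ls.map q).sum + (hs.map q).sum = ls.length + hs.length
  cons : ∀ j, lo ≤ j → j < hi →
    q j + ∑ p ∈ Finset.Ico lo hi, (if (p ∉ ls ∧ p ∉ hs) ∧ al p = j then 1 - q p else 0) = q₀ j

/-- An alias table of the scaled weights `q₀` on the positions from `lo` to `hi`. -/
structure AliasTable (lo hi : ℕ) (q₀ q : ℕ → ℝ) (al : ℕ → ℕ) : Prop where
  nonneg : ∀ p, lo ≤ p → p < hi → 0 ≤ q p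
  le_one : ∀ p, lo ≤ p → p < hi → q p ≤ 1
  alias_mem : ∀ p, lo ≤ p → p < hi → q p ≠ 1 → lo ≤ al p ∧ al p < hi
  cons : ∀ j, lo ≤ j → j < hi →
    q j + ∑ p ∈ Finset.Ico lo hi, (if al p = j then 1 - q p else 0) = q₀ j

theorem AliasTable.congr {lo hi : ℕ} {q₀ q q' : ℕ → ℝ} {al al' : ℕ → ℕ}
    (h : AliasTable lo hi q₀ q al) (hq : ∀ p, lo ≤ p → p < hi → q' p = q p)
    (ha : ∀ p, lo ≤ p → p < hi → al' p = al p) : AliasTable lo hi q₀ q' al' := by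
  refine ⟨fun p h1 h2 => ?_, fun p h1 h2 => ?_, fun p h1 h2 h3 => ?_, fun j h1 h2 => ?_⟩
  · rw [hq p h1 h2]; exact h.nonneg p h1 h2
  · rw [hq p h1 h2]; exact h.le_one p h1 h2
  · rw [ha p h1 h2]; exact h.alias_mem p h1 h2 (by rwa [← hq p h1 h2])
  · rw [hq j h1 h2, ← h.cons j h1 h2]
    congr 1
    refine Finset.sum_congr rfl fun p hp => ?_
    rw [Finset.mem_Ico] at hp
    rw [hq p hp.1 hp.2, ha p hp.1 hp.2]

/-- The unfinished weights have average 1, whereas light ones alone would have average below 1. -/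
theorem AliasInv.exists_heavy {lo hi : ℕ} {q₀ q : ℕ → ℝ} {al : ℕ → ℕ} {s : ℕ} {ls hs : List ℕ}
    (h : AliasInv lo hi q₀ q al (s :: ls) hs) : ∃ x hs', hs = x :: hs' := by
  cases hs with
  | cons x hs' => exact ⟨x, hs', rfl⟩
  | nil =>
    have h1 := list_sum_lt_length (by simp) h.light
    have h2 := h.sum
    simp only [List.map_nil, List.sum_nil, List.length_nil] at h2
    push_cast at h1 h2
    linarith

/-- Once no light position is left, the remaining weights are at least 1 with average 1, hence all
equal to 1. Their aliases are never set; they carry no mass, which is why an alias is constrained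
only where the weight is not 1. -/
theorem AliasInv.table {lo hi : ℕ} {q₀ q : ℕ → ℝ} {al : ℕ → ℕ} {hs : List ℕ}
    (h : AliasInv lo hi q₀ q al [] hs) : AliasTable lo hi q₀ q al := by
  have h1 : ∀ p ∈ hs, q p = 1 := eq_one_of_list_sum_eq_length h.heavy (by simpa using h.sum)
  refine ⟨h.nonneg, fun p h2 h3 => ?_, fun p h2 h3 h4 => ?_, fun j h2 h3 => ?_⟩
  · by_cases hp : p ∈ hs
    · exact (h1 p hp).le
    · exact (h.done p h2 h3 (by simp) hp).1
  · exact (h.done p h2 h3 (by simp) fun hp => h4 (h1 p hp)).2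
  · rw [← h.cons j h2 h3]
    congr 1
    refine Finset.sum_congr rfl fun p _ => ?_
    by_cases hp : p ∈ hs
    · simp [h1 p hp]
    · simp [hp]

/-- The heavy position x gives the missing weight 1 - q s to the light position s, which becomes
final with alias x. The total drops by 1 together with the number of unfinished positions. Stating
the new lists up to permutation covers both cases, x remaining heavy or becoming light. -/
theorem AliasInv.step {lo hi : ℕ} {q₀ q : ℕ → ℝ} {al : ℕ → ℕ} {s x : ℕ} {ls hs : List ℕ}
    (h : AliasInv lo hi q₀ q al (s :: ls) (x :: hs)) {ls' hs' : List ℕ}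
    (hp : (ls' ++ hs').Perm (ls ++ x :: hs))
    (hl : ∀ p ∈ ls', Function.update q x (q x + q s - 1) p < 1)
    (hh : ∀ p ∈ hs', 1 ≤ Function.update q x (q x + q s - 1) p) :
    AliasInv lo hi q₀ (Function.update q x (q x + q s - 1)) (Function.update al s x) ls' hs' := by
  set q' := Function.update q x (q x + q s - 1) with hq'
  have hmem : ∀ p, (p ∈ ls' ∨ p ∈ hs') ↔ (p ∈ ls ∨ p = x ∨ p ∈ hs) := fun p => by
    simpa using hp.mem_iff (a := p)
  have hnd := h.nodup
  rw [List.cons_append, List.nodup_cons] at hnd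
  obtain ⟨hs1, hnd⟩ := hnd
  have hsx : s ≠ x := fun e => hs1 (by simp [e])
  have hs2 : ¬ (s ∈ ls' ∨ s ∈ hs') := by
    rw [hmem]
    simpa using hs1
  have hrange : ∀ p, (p ∈ ls' ∨ p ∈ hs') → lo ≤ p ∧ p < hi := fun p hp' => by
    refine h.mem p ?_
    rw [hmem] at hp'
    simp only [List.cons_append, List.mem_cons, List.mem_append]
    tauto
  have hxr := h.mem x (by simp)
  have hsr := h.mem s (by simp)
  have hqx := h.heavy x (by simp)
  have hqs := h.nonneg s hsr.1 hsr.2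
  have hqs1 := h.light s (by simp)
  refine ⟨hp.nodup_iff.2 hnd, fun p hp' => hrange p (List.mem_append.1 hp'), hl, hh,
    fun p h1 h2 => ?_, fun p h1 h2 h3 h4 => ?_, ?_, fun j h1 h2 => ?_⟩
  · by_cases hpx : p = x
    · rw [hpx, hq', Function.update_self]; linarith
    · rw [hq', Function.update_of_ne hpx]; exact h.nonneg p h1 h2
  · have h5 : ¬ (p ∈ ls ∨ p = x ∨ p ∈ hs) := by rw [← hmem]; tauto
    have hpx : p ≠ x := fun e => h5 (Or.inr (Or.inl e))
    rw [hq', Function.update_of_ne hpx]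
    by_cases hps : p = s
    · rw [hps, Function.update_self]
      exact ⟨hqs1.le, hxr⟩
    · rw [Function.update_of_ne hps]
      refine h.done p h1 h2 ?_ ?_ <;> simp only [List.mem_cons] <;> tauto
  · have e1 : (ls'.map q').sum + (hs'.map q').sum = ((ls ++ x :: hs).map q').sum := by
      rw [← List.sum_append, ← List.map_append]
      exact (hp.map q').sum_eq
    have e2 : ∀ l : List ℕ, x ∉ l → l.map q' = l.map q := fun l hxl =>
      List.map_congr_left fun p hp' => show q' p = q p from Function.update_of_ne (fun e : p = x => hxl (e ▸ hp')) _ _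
    have e3 : x ∉ ls ∧ x ∉ hs := by
      rw [List.nodup_append] at hnd
      refine ⟨fun hx => hnd.2.2 x hx x (by simp) rfl, ?_⟩
      exact (List.nodup_cons.1 hnd.2.1).1
    have e4 := hp.length_eq
    have e5 := h.sum
    rw [List.length_append, List.length_append, List.length_cons] at e4
    have e6 : ((ls'.length + hs'.length : ℕ) : ℝ) = ((ls.length + (hs.length + 1) : ℕ) : ℝ) := by
      rw [e4]
    rw [e1, List.map_append, List.sum_append, List.map_cons, List.sum_cons, e2 _ e3.1, e2 _ e3.2,
      hq', Function.update_self]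
    simp only [List.map_cons, List.sum_cons, List.length_cons] at e5
    push_cast at e5 e6
    linarith
  -- The only new summand is that of s: it sends 1 - q s to x, which is exactly what x has lost.
  · have hsum : ∑ p ∈ Finset.Ico lo hi,
        (if (p ∉ ls' ∧ p ∉ hs') ∧ Function.update al s x p = j then 1 - q' p else 0) =
        ∑ p ∈ Finset.Ico lo hi, ((if (p ∉ s :: ls ∧ p ∉ x :: hs) ∧ al p = j then 1 - q p else 0) +
          if p = s then (if x = j then 1 - q s else 0) else 0) := by
      refine Finset.sum_congr rfl fun p _ => ?_
      have hm := hmem p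
      by_cases hps : p = s
      · subst hps
        simp only [Function.update_self, if_true, List.mem_cons, true_or, not_true, false_and,
          if_false, zero_add]
        rw [hq', Function.update_of_ne hsx]
        have : p ∉ ls' ∧ p ∉ hs' := by tauto
        simp only [this, not_false_eq_true, and_self, true_and]
      · rw [Function.update_of_ne hps, if_neg hps, add_zero]
        have : (p ∉ ls' ∧ p ∉ hs') ↔ (p ∉ s :: ls ∧ p ∉ x :: hs) := by
          simp only [List.mem_cons]
          tauto
        simp only [this]
        by_cases hpx : p = x
        · rw [if_neg, if_neg] <;> simp [hpx]
        · rw [hq', Function.update_of_ne hpx]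
    rw [hsum, Finset.sum_add_distrib, Finset.sum_ite_eq' , if_pos (Finset.mem_Ico.2 hsr),
      ← h.cons j h1 h2]
    by_cases hxj : x = j
    · subst hxj
      rw [hq', Function.update_self, if_pos rfl]
      ring
    · rw [hq', Function.update_of_ne (Ne.symm hxj), if_neg hxj, add_zero]

/-! ### Building alias tables on the machine in time linear in the degree. -/

/-- The positions from `24` to `25` of the row of the vertex in `nr 23` are weighed, and their total
weight is stored as the degree. -/
def weighRow : Prog :=
  .seq (blk [.nadd 28 23 21, .nload 24 0 28, .nadd 28 28 21, .nload 25 0 28, .nsub 29 25 24,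
    .xcast 26 29, .xconst 25 0]) <|
  .seq (.loop (.nlt 24 25) (blk [.xload 27 0 24, .xadd 25 25 27, .nadd 24 24 21]))
  (blk [.xstore 1 23 25, .xdiv 26 26 25, .nadd 28 23 21, .nload 24 0 28, .nconst 26 0,
    .nconst 27 0])

/-- The scaled weights of the row are computed, and the positions are distributed to two stacks. -/
def splitRow : Prog :=
  .loop (.nlt 24 25) <|
    .seq (blk [.xload 27 0 24, .xmul 27 27 26, .xstore 5 24 27]) <|
    .seq (.ite (.xlt 27 22) (blk [.nstore 3 26 24, .nadd 26 26 21])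
      (blk [.nstore 4 27 24, .nadd 27 27 21]))
    (blk [.nadd 24 24 21])

/-- The alias table is built from the two stacks. -/
def pairRow : Prog :=
  .loop (.nlt 22 26) <|
    .seq (blk [.nsub 26 26 21, .nload 28 3 26, .nsub 29 27 21, .nload 29 4 29, .nstore 5 28 29,
      .xload 27 5 28, .xload 28 5 29, .xadd 28 28 27, .xsub 28 28 22, .xstore 5 29 28])
    (.ite (.xlt 28 22) (blk [.nsub 27 27 21, .nstore 3 26 29, .nadd 26 26 21]) .skip)

/-- Degree and alias table of the vertex in `nr 23`. -/
def aliasRow : Prog := .seq weighRow <| .seq splitRow pairRow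

/-- Each round finishes one position, so the number of unfinished positions is a variant; it starts
at the length of the row. -/
theorem pairRow_ends {s : State} {lo hi : ℕ} {q₀ : ℕ → ℝ} {ls hs : List ℕ}
    (h21 : s.nr 21 = 1) (h22 : s.nr 22 = 0) (x22 : s.xr 22 = 1)
    (hls : IsStack (s.na 3) (s.nr 26) ls) (hhs : IsStack (s.na 4) (s.nr 27) hs)
    (hI : AliasInv lo hi q₀ (s.xa 5) (s.na 5) ls hs) (hlen : ls.length + hs.length = hi - lo) :
    Ends [pairRow] s ((hi - lo) * (40 + 1) + 1) (fun t =>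
      AliasTable lo hi q₀ (t.xa 5) (t.na 5) ∧
      ∀ p, ¬ (lo ≤ p ∧ p < hi) → t.xa 5 p = s.xa 5 p ∧ t.na 5 p = s.na 5 p) := by
  refine Good.mono (Ends.loop_variant (s := s) 40 (fun m t => ∃ ls hs,
    IsStack (t.na 3) (t.nr 26) ls ∧ IsStack (t.na 4) (t.nr 27) hs ∧
    AliasInv lo hi q₀ (t.xa 5) (t.na 5) ls hs ∧ ls.length + hs.length = m ∧
    ∀ p, ¬ (lo ≤ p ∧ p < hi) → t.xa 5 p = s.xa 5 p ∧ t.na 5 p = s.na 5 p) (hi - lo)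
    ⟨ls, hs, hls, hhs, hI, hlen, fun p _ => ⟨rfl, rfl⟩⟩ ?_).frame ?_
  · rintro m t hF ⟨ls, hs, hls, hhs, hI, hlen, hout⟩ hb
    have t21 := (hF.nr 21 rfl).trans h21
    have t22 := (hF.nr 22 rfl).trans h22
    have y22 := (hF.xr 22 rfl).trans x22
    rw [Test.holds, t22] at hb
    cases ls with
    | nil => exact absurd hls (by simp only [IsStack]; omega)
    | cons a ls =>
    obtain ⟨x, hs, rfl⟩ := hI.exists_heavy
    obtain ⟨k, hk, ha, hls⟩ := hls
    obtain ⟨k', hk', hx, hhs⟩ := hhs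
    have hxr := hI.mem x (by simp)
    have har := hI.mem a (by simp)
    refine ⟨m - 1, by rw [List.length_cons] at hlen; omega, ?_⟩
    set q' := Function.update (t.xa 5) x (t.xa 5 x + t.xa 5 a - 1) with hq'
    set al' := Function.update (t.na 5) a x with hal'
    have hout' : ∀ p, ¬ (lo ≤ p ∧ p < hi) → q' p = s.xa 5 p ∧ al' p = s.na 5 p := by
      intro p hp
      rw [hq', hal', Function.update_of_ne (by rintro rfl; exact hp hxr),
        Function.update_of_ne (by rintro rfl; exact hp har)]
      exact hout p hp
    have hlq : ∀ p ∈ ls, q' p < 1 := by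
      intro p hp
      have hpx : p ≠ x := by
        rintro rfl
        have := hI.nodup
        rw [List.nodup_append] at this
        exact this.2.2 p (by simp [hp]) p (by simp) rfl
      rw [hq', Function.update_of_ne hpx]
      exact hI.light p (by simp [hp])
    have hhq : ∀ p ∈ hs, 1 ≤ q' p := by
      intro p hp
      have hpx : p ≠ x := by
        rintro rfl
        have := hI.nodup
        rw [List.nodup_append] at this
        exact (List.nodup_cons.1 this.2.1).1 hp
      rw [hq', Function.update_of_ne hpx]
      exact hI.heavy p (by simp [hp])
    refine Good.seq (T := 39) (Good.blk_then (T := 18) (fun t' => t'.nr 26 = k ∧ t'.nr 29 = x ∧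
      t'.xr 28 = q' x ∧ t'.xa 5 = q' ∧ t'.na 5 = al') rfl ?_ fun t1 hF1 ht1 => ?_)
    · simp only [List.foldl, Instr.det, State.setN_nr, State.setN_na, State.putN_nr, State.putN_na,
        State.putN_xa, State.setN_xa, State.setX_xa, State.setX_nr, State.setX_na, State.setX_xr,
        State.putX_nr, State.putX_na, State.putX_xr, State.putX_xa, hk, hk', t21, State.putN_xr,
        State.setN_xr]
      simp [ha, hx, hq', hal', y22, add_comm]
    obtain ⟨u26, u29, w28, w5, v5⟩ := ht1
    have u3 := hF1.na 3 rfl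
    have u4 := hF1.na 4 rfl
    have u27 := hF1.nr 27 rfl
    have u21 := (hF1.nr 21 rfl).trans t21
    have w22 := (hF1.xr 22 rfl).trans y22
    simp only [List.length_cons] at hlen
    refine Good.ite (T := 17) (fun hb' => ?_) (fun hb' => Good.skip (Good.nil ?_ 16))
    · rw [Test.holds, w28, w22] at hb'
      refine Good.mono_time (Good.blk rfl (Good.nil ⟨x :: ls, hs, ?_, ?_, ?_, ?_, ?_⟩ 0)) (by simp)
      · simp only [List.foldl, Instr.det, State.setN_nr, State.setN_na, State.putN_nr,
          State.putN_na]
        simp only [u26, u29, u21, u3]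
        simpa using hls.push x
      · simp only [List.foldl, Instr.det, State.setN_nr, State.setN_na, State.putN_nr,
          State.putN_na]
        simpa [u27, u21, hk', u4] using hhs
      · simp only [List.foldl, Instr.det, State.setN_na, State.putN_na, State.setN_xa,
          State.putN_xa]
        simp only [w5, v5]
        refine hI.step ?_ ?_ hhq
        · simpa using (List.perm_middle (a := x) (l₁ := ls) (l₂ := hs)).symm
        · intro p hp
          rcases List.mem_cons.1 hp with rfl | hp
          · exact hb'
          · exact hlq p hp
      · simp only [List.length_cons]; omega
      · simpa [w5, v5] using hout'
    · rw [Test.holds, w28, w22, not_lt] at hb'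
      refine ⟨ls, x :: hs, ?_, ?_, ?_, ?_, ?_⟩
      · rw [u3, u26]; exact hls
      · rw [u4, u27]; exact ⟨k', hk', hx, hhs⟩
      · rw [w5, v5]
        refine hI.step (List.Perm.refl _) hlq ?_
        intro p hp
        rcases List.mem_cons.1 hp with rfl | hp
        · exact hb'
        · exact hhq p hp
      · simp only [List.length_cons]; omega
      · rw [w5, v5]; exact hout'
  · rintro _ t ⟨⟨⟨m, ls, hs, hls, -, hI, -, hout⟩, hb⟩, hF⟩
    refine ⟨?_, hout⟩
    rw [Test.holds, hF.nr 22 rfl, h22, not_lt] at hb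
    cases ls with
    | nil => exact hI.table
    | cons a ls =>
      obtain ⟨k, hk, -⟩ := hls
      omega

theorem splitRow_ends {s : State} {lo hi : ℕ} (hlh : lo ≤ hi) {x : ℝ} (h21 : s.nr 21 = 1)
    (x22 : s.xr 22 = 1) (h24 : s.nr 24 = lo) (h25 : s.nr 25 = hi) (h26 : s.nr 26 = 0)
    (h27 : s.nr 27 = 0) (x26 : s.xr 26 = x) (hpos : ∀ p, lo ≤ p → p < hi → 0 ≤ s.xa 0 p * x)
    (hsum : ∑ p ∈ Finset.Ico lo hi, s.xa 0 p * x = (hi - lo : ℕ)) :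
    Ends [splitRow] s ((hi - lo) * (30 + 1) + 1) (fun t => ∃ ls hs,
      IsStack (t.na 3) (t.nr 26) ls ∧ IsStack (t.na 4) (t.nr 27) hs ∧
      AliasInv lo hi (fun p => s.xa 0 p * x) (t.xa 5) (t.na 5) ls hs ∧
      ls.length + hs.length = hi - lo ∧ ∀ p, ¬ (lo ≤ p ∧ p < hi) → t.xa 5 p = s.xa 5 p) := by
  set q₀ : ℕ → ℝ := fun p => s.xa 0 p * x with hq₀
  refine Good.mono (Ends.loop_const (s := s) (hi - lo) 30 (fun i t => t.nr 24 = lo + i ∧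
    ∃ ls hs, IsStack (t.na 3) (t.nr 26) ls ∧ IsStack (t.na 4) (t.nr 27) hs ∧
    (ls ++ hs).Nodup ∧ (∀ p, (p ∈ ls ∨ p ∈ hs) ↔ (lo ≤ p ∧ p < lo + i)) ∧
    (∀ p ∈ ls, q₀ p < 1) ∧ (∀ p ∈ hs, 1 ≤ q₀ p) ∧ (∀ p, lo ≤ p → p < lo + i → t.xa 5 p = q₀ p) ∧
    (∀ p, ¬ (lo ≤ p ∧ p < hi) → t.xa 5 p = s.xa 5 p) ∧ ls.length + hs.length = i ∧
    (ls.map q₀).sum + (hs.map q₀).sum = ∑ p ∈ Finset.Ico lo (lo + i), q₀ p) ?_ ?_ ?_) ?_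
  · refine ⟨h24, [], [], h26, h27, by simp, fun p => ?_, by simp, by simp, fun p _ _ => by omega,
      fun p _ => rfl, rfl, by simp⟩
    simp
  · rintro i t hi' hF ⟨t24, ls, hs, hls, hhs, hnd, hmem, hl, hh, hq, hout, hlen, hs'⟩
    have t21 := (hF.nr 21 rfl).trans h21
    have t25 := (hF.nr 25 rfl).trans h25
    have y22 := (hF.xr 22 rfl).trans x22
    have y26 := (hF.xr 26 rfl).trans x26
    have y0 := hF.xa 0 rfl
    refine ⟨by rw [Test.holds, t24, t25]; omega, ?_⟩
    have hnl : lo + i ∉ ls := fun h => by have := (hmem _).1 (Or.inl h); omega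
    have hnh : lo + i ∉ hs := fun h => by have := (hmem _).1 (Or.inr h); omega
    have hsum' : ∑ p ∈ Finset.Ico lo (lo + (i + 1)), q₀ p =
        ∑ p ∈ Finset.Ico lo (lo + i), q₀ p + q₀ (lo + i) := by
      rw [← add_assoc, Finset.sum_Ico_succ_top (by omega)]
    refine Good.seq (T := 29) (Good.blk_then (T := 22) (fun t' => t'.xr 27 = q₀ (lo + i) ∧
      t'.xa 5 = Function.update (t.xa 5) (lo + i) (q₀ (lo + i))) rfl ?_ fun t1 hF1 ht1 => ?_)
    · simp [t24, y0, y26, hq₀]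
    obtain ⟨w27, w5⟩ := ht1
    have u21 := (hF1.nr 21 rfl).trans t21
    have u24 := (hF1.nr 24 rfl).trans t24
    have u26 := hF1.nr 26 rfl
    have u27 := hF1.nr 27 rfl
    have u3 := hF1.na 3 rfl
    have u4 := hF1.na 4 rfl
    have w22 := (hF1.xr 22 rfl).trans y22
    have hq' : ∀ p, lo ≤ p → p < lo + (i + 1) → t1.xa 5 p = q₀ p := by
      intro p h1 h2
      rw [w5]
      by_cases hp : p = lo + i
      · rw [hp, Function.update_self]
      · rw [Function.update_of_ne hp, hq p h1 (by omega)]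
    have hout' : ∀ p, ¬ (lo ≤ p ∧ p < hi) → t1.xa 5 p = s.xa 5 p := by
      intro p hp
      rw [w5, Function.update_of_ne (by rintro rfl; omega), hout p hp]
    refine Good.seq (T := 21) (Good.ite (T := 20) (fun hb => ?_) fun hb => ?_)
    · rw [Test.holds, w27, w22] at hb
      refine Good.mono_time (Good.blk (T := 3) rfl (Good.blk (T := 0) rfl (Good.nil
        ⟨?_, (lo + i) :: ls, hs, ?_⟩ 0))) (by simp)
      · simp [u24, u21]; ring
      · simp only [List.foldl, Instr.det, State.setN_nr, State.setN_na, State.putN_nr,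
          State.putN_na, State.setN_xa, State.putN_xa, u24, u26, u21, u3, u4, u27]
        refine ⟨by simpa using hls.push (lo + i), by simpa using hhs, ?_, fun p => ?_, ?_, hh, hq',
          hout', by rw [List.length_cons]; omega, ?_⟩
        · rw [List.cons_append, List.nodup_cons]
          exact ⟨by simp [hnl, hnh], hnd⟩
        · have := hmem p
          rw [List.mem_cons, or_assoc, this]
          omega
        · intro p hp
          rcases List.mem_cons.1 hp with rfl | hp
          exacts [hb, hl p hp]
        · rw [hsum', List.map_cons, List.sum_cons, ← hs']
          ring
    · rw [Test.holds, w27, w22, not_lt] at hb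
      refine Good.mono_time (Good.blk (T := 3) rfl (Good.blk (T := 0) rfl (Good.nil
        ⟨?_, ls, (lo + i) :: hs, ?_⟩ 0))) (by simp)
      · simp [u24, u21]; ring
      · simp only [List.foldl, Instr.det, State.setN_nr, State.setN_na, State.putN_nr,
          State.putN_na, State.setN_xa, State.putN_xa, u24, u26, u21, u3, u4, u27]
        refine ⟨by simpa using hls, by simpa using hhs.push (lo + i), ?_, fun p => ?_, hl, ?_, hq',
          hout', by rw [List.length_cons]; omega, ?_⟩
        · rw [List.perm_middle.nodup_iff, List.nodup_cons]
          exact ⟨by simp [hnl, hnh], hnd⟩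
        · have := hmem p
          rw [List.mem_cons, or_left_comm, this]
          omega
        · intro p hp
          rcases List.mem_cons.1 hp with rfl | hp
          exacts [hb, hh p hp]
        · rw [hsum', List.map_cons, List.sum_cons, ← add_assoc, add_right_comm, ← hs']
  · rintro t hF ⟨t24, -⟩
    rw [Test.holds, t24, (hF.nr 25 rfl).trans h25]
    omega
  · rintro _ t ⟨-, ls, hs, hls, hhs, hnd, hmem, hl, hh, hq, hout, hlen, hs'⟩
    rw [Nat.add_sub_cancel' hlh] at hmem hq hs'
    have hql : ∀ l : List ℕ, (∀ p ∈ l, lo ≤ p ∧ p < hi) → l.map (t.xa 5) = l.map q₀ := fun l h =>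
      List.map_congr_left fun p hp => hq p (h p hp).1 (h p hp).2
    have hlr : ∀ p ∈ ls, lo ≤ p ∧ p < hi := fun p hp => (hmem p).1 (Or.inl hp)
    have hhr : ∀ p ∈ hs, lo ≤ p ∧ p < hi := fun p hp => (hmem p).1 (Or.inr hp)
    refine ⟨ls, hs, hls, hhs, ⟨hnd, fun p hp => (hmem p).1 (List.mem_append.1 hp), fun p hp => ?_,
      fun p hp => ?_, fun p h1 h2 => ?_, fun p h1 h2 h3 h4 => ?_, ?_, fun j h1 h2 => ?_⟩, hlen, hout⟩
    · rw [hq p (hlr p hp).1 (hlr p hp).2]; exact hl p hp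
    · rw [hq p (hhr p hp).1 (hhr p hp).2]; exact hh p hp
    · rw [hq p h1 h2]; exact hpos p h1 h2
    · have := (hmem p).2 ⟨h1, h2⟩; tauto
    · rw [hql ls hlr, hql hs hhr, hs', hsum, ← hlen]
      push_cast
      rfl
    · rw [hq j h1 h2, Finset.sum_eq_zero, add_zero]
      intro p hp
      have := (hmem p).2 (Finset.mem_Ico.1 hp)
      rw [if_neg]
      tauto

theorem weighRow_ends {s : State} {lo hi : ℕ} (hlh : lo ≤ hi) (h21 : s.nr 21 = 1)
    (hlo : s.na 0 (s.nr 23 + 1) = lo) (hhi : s.na 0 (s.nr 23 + 2) = hi) :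
    Ends [weighRow] s (32 + (hi - lo) * (7 + 1)) (fun t => t.nr 24 = lo ∧ t.nr 25 = hi ∧
      t.nr 26 = 0 ∧ t.nr 27 = 0 ∧
      t.xr 26 = ((hi - lo : ℕ) : ℝ) / ∑ p ∈ Finset.Ico lo hi, s.xa 0 p ∧
      t.xa 1 = Function.update (s.xa 1) (s.nr 23) (∑ p ∈ Finset.Ico lo hi, s.xa 0 p)) := by
  refine Good.mono_time (T := 15 + (((hi - lo) * (7 + 1) + 1 + 13) + 1) + 1) ?_ (by omega)
  refine Good.seq (Good.blk_then (fun t => t.nr 24 = lo ∧ t.nr 25 = hi ∧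
    t.xr 26 = ((hi - lo : ℕ) : ℝ) ∧ t.xr 25 = 0) rfl ?_ fun t hF ht => ?_)
  · simp [h21, hlo, hhi]
  obtain ⟨t24, t25, y26, y25⟩ := ht
  have t21 := (hF.nr 21 rfl).trans h21
  have t23 := hF.nr 23 rfl
  have t0 := hF.na 0 rfl
  have y0 := hF.xa 0 rfl
  have y1 := hF.xa 1 rfl
  refine Good.seq (Ends.comp (T' := 13) (Ends.loop_const (hi - lo) 7 (fun i t =>
    t.nr 24 = lo + i ∧ t.xr 25 = ∑ p ∈ Finset.Ico lo (lo + i), s.xa 0 p) ⟨t24, by simp [y25]⟩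
    ?_ ?_) fun t1 hF1 ht1 => ?_)
  · rintro i t1 hi' hF1 ⟨u24, w25⟩
    refine ⟨by rw [Test.holds, u24, hF1.nr 25 rfl, t25]; omega, Good.blk rfl (Good.nil ⟨?_, ?_⟩ 0)⟩
    · simp [u24, hF1.nr 21 rfl, t21]; ring
    · rw [← add_assoc, Finset.sum_Ico_succ_top (by omega)]
      simp [u24, w25, hF1.xa 0 rfl, y0]
  · rintro t1 hF1 ⟨u24, -⟩
    rw [Test.holds, u24, hF1.nr 25 rfl, t25]; omega
  · obtain ⟨-, w25⟩ := ht1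
    rw [Nat.add_sub_cancel' hlh] at w25
    refine Good.mono_time (Good.blk rfl (Good.nil ?_ 0)) (by simp)
    simp [hF1.nr 23 rfl, t23, hF1.nr 21 rfl, t21, hF1.na 0 rfl, t0, hlo, hF1.nr 25 rfl, t25, w25,
      hF1.xr 26 rfl, y26, hF1.xa 1 rfl, y1]

/-- Weights are scaled by length over total to have average 1, as the invariant demands. Nothing
outside the row changes, so the tables of other rows survive. -/
theorem aliasRow_ends {s : State} {lo hi : ℕ} (hlh : lo < hi) (h21 : s.nr 21 = 1)
    (h22 : s.nr 22 = 0) (x22 : s.xr 22 = 1) (hlo : s.na 0 (s.nr 23 + 1) = lo)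
    (hhi : s.na 0 (s.nr 23 + 2) = hi) (hpos : ∀ p, lo ≤ p → p < hi → 0 < s.xa 0 p) :
    Ends [aliasRow] s (40 + 100 * (hi - lo)) (fun t =>
      t.xa 1 = Function.update (s.xa 1) (s.nr 23) (∑ p ∈ Finset.Ico lo hi, s.xa 0 p) ∧
      AliasTable lo hi (fun p => s.xa 0 p * (((hi - lo : ℕ) : ℝ) / ∑ p ∈ Finset.Ico lo hi, s.xa 0 p))
        (t.xa 5) (t.na 5) ∧
      ∀ p, ¬ (lo ≤ p ∧ p < hi) → t.xa 5 p = s.xa 5 p ∧ t.na 5 p = s.na 5 p) := by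
  have hS : 0 < ∑ p ∈ Finset.Ico lo hi, s.xa 0 p :=
    Finset.sum_pos (fun p hp => hpos p (Finset.mem_Ico.1 hp).1 (Finset.mem_Ico.1 hp).2)
      (by simpa using hlh)
  refine Good.mono_time (T := (32 + (hi - lo) * (7 + 1)) + (((hi - lo) * (30 + 1) + 1) +
    ((hi - lo) * (40 + 1) + 1) + 1) + 1) ?_ (by omega)
  refine Good.seq (Ends.comp (weighRow_ends hlh.le h21 hlo hhi) fun t hF ht => ?_)
  obtain ⟨t24, t25, t26, t27, y26, y1⟩ := ht
  have y0 := hF.xa 0 rfl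
  have t21 := (hF.nr 21 rfl).trans h21
  have t22 := (hF.nr 22 rfl).trans h22
  have y22 := (hF.xr 22 rfl).trans x22
  refine Good.seq (Ends.comp (splitRow_ends hlh.le t21 y22 t24 t25 t26 t27 y26 ?_ ?_)
    fun t1 hF1 ht1 => ?_)
  · intro p h1 h2
    rw [y0]
    exact mul_nonneg (hpos p h1 h2).le (by positivity)
  · rw [y0, ← Finset.sum_mul, mul_div_cancel₀ _ hS.ne']
  obtain ⟨ls, hs, hls, hhs, hI, hlen, hout⟩ := ht1
  rw [y0] at hI
  refine Good.mono (pairRow_ends ((hF1.nr 21 rfl).trans t21) ((hF1.nr 22 rfl).trans t22)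
    ((hF1.xr 22 rfl).trans y22) hls hhs hI hlen).frame ?_
  rintro _ t2 ⟨⟨h1, h2⟩, hF2⟩
  refine ⟨by rw [hF2.xa 1 rfl, hF1.xa 1 rfl, y1], h1, fun p hp => ?_⟩
  rw [(h2 p hp).1, (h2 p hp).2, hout p hp, hF1.na 5 rfl, hF.na 5 rfl, hF.xa 5 rfl]
  exact ⟨rfl, rfl⟩

/-! ### Random walks on the machine -/

section rows

variable {n : ℕ} {a : ℕ → ℕ} {b : ℕ → ℝ} {M : Matrix (Fin n) (Fin n) ℝ}

/-- The column index at the position `p`. -/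
def colAt (a : ℕ → ℕ) (u : Fin n) (p : ℕ) : Fin n := if h : a p < n then ⟨a p, h⟩ else u

theorem StoresRows.colAt_eq (h : StoresRows n a b M) {u : Fin n} {p : ℕ} (hp : InRow a u p) :
    a p = colAt a u p ∧ b p = M u (colAt a u p) ∧ M u (colAt a u p) ≠ 0 := by
  obtain ⟨v, h1, h2, h3⟩ := h.entry u p hp
  have : colAt a u p = v := by
    rw [colAt, dif_pos (by rw [h1]; exact v.2)]
    exact Fin.ext h1
  rw [this]
  exact ⟨h1, h2, h3⟩

theorem StoresRows.sum_row (h : StoresRows n a b M) (u : Fin n) (f : ℝ → ℝ) :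
    ∑ p ∈ Finset.Ico (a (u + 1)) (a (u + 2)), f (b p) = ∑ v with M u v ≠ 0, f (M u v) := by
  refine Finset.sum_bij (fun p _ => colAt a u p) (fun p hp => ?_) (fun p hp q hq hpq => ?_)
    (fun v hv => ?_) (fun p hp => ?_)
  · simpa using (h.colAt_eq (Finset.mem_Ico.1 hp)).2.2
  · refine h.inj u p q (Finset.mem_Ico.1 hp) (Finset.mem_Ico.1 hq) ?_
    rw [(h.colAt_eq (Finset.mem_Ico.1 hp)).1, (h.colAt_eq (Finset.mem_Ico.1 hq)).1, hpq]
  · obtain ⟨p, hp, hpv⟩ := h.all u v (Finset.mem_filter.1 hv).2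
    exact ⟨p, Finset.mem_Ico.2 hp, Fin.ext ((h.colAt_eq hp).1.symm.trans hpv)⟩
  · rw [(h.colAt_eq (Finset.mem_Ico.1 hp)).2.1]

theorem StoresRows.sum_eq (h : StoresRows n a b M) (u : Fin n) :
    ∑ p ∈ Finset.Ico (a (u + 1)) (a (u + 2)), b p = ∑ v, M u v := by
  rw [h.sum_row u fun x => x, Finset.sum_filter_ne_zero]

theorem StoresRows.length_eq (h : StoresRows n a b M) (u : Fin n) :
    a (u + 2) - a (u + 1) = (Finset.univ.filter fun v => M u v ≠ 0).card := by
  have := h.sum_row u fun _ => 1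
  simp only [Finset.sum_const, Nat.card_Ico, nsmul_eq_mul, mul_one] at this
  exact_mod_cast this

end rows

namespace WGraph

variable {n : ℕ} {G : WGraph n} {hd : ∀ u, 0 < G.deg u}

theorem row_lt {a : ℕ → ℕ} {b : ℕ → ℝ} (h : StoresRows n a b G.A) (hd : ∀ u, 0 < G.deg u)
    (u : Fin n) : a (u + 1) < a (u + 2) := by
  by_contra hlt
  have h1 := h.sum_eq u
  rw [Finset.Ico_eq_empty hlt, Finset.sum_empty] at h1
  exact (hd u).ne h1

/-- Row lengths are vertex degrees of the underlying simple graph, so this is the handshake lemma.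
It bounds the preprocessing by the number of edges. -/
theorem sum_range_row_le {a : ℕ → ℕ} {b : ℕ → ℝ} (h : StoresRows n a b G.A) :
    ∑ i ∈ Finset.range n, (a (i + 2) - a (i + 1)) = 2 * G.numEdges := by
  classical
  rw [← Fin.sum_univ_eq_sum_range (fun i => a (i + 2) - a (i + 1)) n]
  have h1 : ∀ u : Fin n, a (u + 2) - a (u + 1) = G.graph.degree u := by
    intro u
    rw [h.length_eq u, ← SimpleGraph.card_neighborFinset_eq_degree]
    congr 1
    ext v
    rw [SimpleGraph.mem_neighborFinset]
    simp [graph]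
  rw [Finset.sum_congr rfl fun u _ => h1 u, SimpleGraph.sum_degrees_eq_twice_card_edges, numEdges,
    Set.ncard_eq_toFinset_card', SimpleGraph.edgeFinset]

/-- The memory holds the graph and alias tables for all its vertices. -/
structure Tables (G : WGraph n) (s : State) : Prop where
  rows : StoresRows n (s.na 0) (s.xa 0) G.A
  table : ∀ u : Fin n, AliasTable (s.na 0 (u + 1)) (s.na 0 (u + 2))
    (fun p => s.xa 0 p * (((s.na 0 (u + 2) - s.na 0 (u + 1) : ℕ) : ℝ) / G.deg u))
    (s.xa 5) (s.na 5)

theorem Tables.congr {s t : State} (h : Tables G s) (h1 : t.na 0 = s.na 0) (h2 : t.xa 0 = s.xa 0)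
    (h3 : t.xa 5 = s.xa 5) (h4 : t.na 5 = s.na 5) : Tables G t := by
  obtain ⟨h5, h6⟩ := h
  constructor
  · rwa [h1, h2]
  · rwa [h1, h2, h3, h4]

theorem randPMF_apply {d : ℕ} (hd : 0 < d) (j : ℕ) :
    randPMF d j = if j < d then ENNReal.ofReal (1 / d) else 0 := by
  rw [randPMF, dif_pos hd, PMF.uniformOfFinset_apply, Finset.card_range, one_div,
    ENNReal.ofReal_inv_of_pos (Nat.cast_pos.2 hd), ENNReal.ofReal_natCast]
  simp only [Finset.mem_range]

theorem coinPMF_apply {x : ℝ} (h0 : 0 ≤ x) (h1 : x ≤ 1) (b : Bool) :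
    coinPMF x b = ENNReal.ofReal (cond b x (1 - x)) := by
  have hm : min (ENNReal.ofReal x) 1 = ENNReal.ofReal x :=
    min_eq_left (ENNReal.ofReal_le_one.2 h1)
  cases b
  · rw [coinPMF_false, hm, cond_false]
    rw [ENNReal.ofReal_sub _ h0, ENNReal.ofReal_one]
  · rw [coinPMF_true, hm, cond_true]

/-- An alias table samples the next vertex of the random walk. -/
theorem Tables.nextPMF_eq {s : State} (h : Tables G s) (u : Fin n) :
    G.nextPMF hd u = (randPMF (s.na 0 (u + 2) - s.na 0 (u + 1))).bind fun j =>
      (coinPMF (s.xa 5 (s.na 0 (u + 1) + j))).bind fun b =>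
        PMF.pure (colAt (s.na 0) u
          (cond b (s.na 0 (u + 1) + j) (s.na 5 (s.na 0 (u + 1) + j)))) := by
  obtain ⟨hrows, htab⟩ := h
  replace htab := htab u
  have hlt := row_lt hrows hd u
  set a := s.na 0
  set q := s.xa 5
  set al := s.na 5
  set lo := a (u + 1) with hlo
  set hi := a (u + 2) with hhi
  have hd0 : 0 < hi - lo := by omega
  have hdr : (0 : ℝ) < ((hi - lo : ℕ) : ℝ) := Nat.cast_pos.2 hd0
  ext v
  -- `g p` is the probability that position p yields v, directly or through its alias. If v is not a
  -- neighbour, no position of the row carries v and every alias of positive mass lies in the row;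
  -- otherwise exactly one position carries v, and `cons` at that position is the claim.
  set g : ℕ → ℝ := fun p => (if v = colAt a u p then q p else 0) +
    (if v = colAt a u (al p) then 1 - q p else 0) with hg
  have hsum : ∑ p ∈ Finset.Ico lo hi, g p = ((hi - lo : ℕ) : ℝ) * (G.A u v / G.deg u) := by
    rw [hg, Finset.sum_add_distrib]
    by_cases hv : G.A u v = 0
    · have hne : ∀ p, lo ≤ p → p < hi → v ≠ colAt a u p := by
        rintro p h1 h2 rfl
        exact (hrows.colAt_eq ⟨h1, h2⟩).2.2 hv
      rw [Finset.sum_eq_zero, Finset.sum_eq_zero, hv]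
      · simp
      · intro p hp
        rw [Finset.mem_Ico] at hp
        split_ifs with h1
        · by_contra h2
          have h3 := htab.alias_mem p hp.1 hp.2 (fun h => h2 (by rw [h, sub_self]))
          exact hne _ h3.1 h3.2 h1
        · rfl
      · intro p hp
        rw [Finset.mem_Ico] at hp
        rw [if_neg (hne p hp.1 hp.2)]
    · obtain ⟨pv, hpv, hpv'⟩ := hrows.all u v hv
      have hcol : ∀ p, lo ≤ p → p < hi → (v = colAt a u p ↔ p = pv) := by
        intro p h1 h2
        refine ⟨fun h => hrows.inj u p pv ⟨h1, h2⟩ hpv ?_, fun h => ?_⟩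
        · rw [(hrows.colAt_eq ⟨h1, h2⟩).1, hpv', h]
        · rw [Fin.ext_iff, ← (hrows.colAt_eq ⟨h1, h2⟩).1, h, hpv']
      have hb : s.xa 0 pv = G.A u v := by
        rw [(hrows.colAt_eq hpv).2.1, ← (hcol pv hpv.1 hpv.2).2 rfl]
      have hc := htab.cons pv hpv.1 hpv.2
      rw [hb] at hc
      rw [mul_div_left_comm, ← hc]
      congr 1
      · rw [Finset.sum_congr rfl fun p hp => if_congr (hcol p (Finset.mem_Ico.1 hp).1
          (Finset.mem_Ico.1 hp).2) rfl rfl, Finset.sum_ite_eq', if_pos (Finset.mem_Ico.2 hpv)]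
      · refine Finset.sum_congr rfl fun p hp => ?_
        rw [Finset.mem_Ico] at hp
        by_cases h1 : q p = 1
        · simp [h1]
        · have h2 := htab.alias_mem p hp.1 hp.2 h1
          rw [if_congr (hcol _ h2.1 h2.2) rfl rfl]
  have hterm : ∀ j, ((coinPMF (q (lo + j))).bind fun b =>
      PMF.pure (colAt a u (cond b (lo + j) (al (lo + j))))) v =
        coinPMF (q (lo + j)) true * (if v = colAt a u (lo + j) then 1 else 0) +
        coinPMF (q (lo + j)) false * (if v = colAt a u (al (lo + j)) then 1 else 0) := by
    intro j
    rw [PMF.bind_apply, tsum_fintype, Fintype.sum_bool, PMF.pure_apply, PMF.pure_apply]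
    simp only [cond_true, cond_false]
    congr
  have hnn : ∀ p ∈ Finset.Ico lo hi, 0 ≤ g p := by
    intro p hp
    rw [Finset.mem_Ico] at hp
    have h1 := htab.nonneg p hp.1 hp.2
    have h2 := htab.le_one p hp.1 hp.2
    rw [hg]
    refine add_nonneg ?_ ?_ <;> split_ifs <;> linarith
  rw [PMF.bind_apply, tsum_eq_sum (s := Finset.range (hi - lo)) fun j hj => by
    rw [randPMF_apply hd0, if_neg (by simpa using hj), zero_mul]]
  have hj : ∀ j ∈ Finset.range (hi - lo), randPMF (hi - lo) j * ((coinPMF (q (lo + j))).bind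
      fun b => PMF.pure (colAt a u (cond b (lo + j) (al (lo + j))))) v =
      ENNReal.ofReal (1 / (hi - lo : ℕ) * g (lo + j)) := by
    intro j hj
    rw [Finset.mem_range] at hj
    have h1 := htab.nonneg (lo + j) (by omega) (by omega)
    have h2 := htab.le_one (lo + j) (by omega) (by omega)
    rw [randPMF_apply hd0, if_pos hj, hterm, ENNReal.ofReal_mul (by positivity), hg,
      coinPMF_apply h1 h2, coinPMF_apply h1 h2]
    congr 1
    rw [ENNReal.ofReal_add (by split_ifs <;> linarith) (by split_ifs <;> linarith)]
    congr 1 <;> split_ifs <;> simp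
  rw [Finset.sum_congr rfl hj, ← ENNReal.ofReal_sum_of_nonneg fun j hj => mul_nonneg (by positivity)
    (hnn _ (by rw [Finset.mem_range] at hj; rw [Finset.mem_Ico]; omega)), ← Finset.mul_sum]
  rw [Finset.sum_Ico_eq_sum_range] at hsum
  rw [hsum, nextPMF, PMF.ofFintype_apply]
  congr 1
  field_simp

end WGraph

open WGraph

/-- The vertex in `nr 30` is replaced by the next vertex of a random walk. -/
def aliasStep : Prog :=
  .seq (blk [.nadd 31 30 21, .nload 32 0 31, .nadd 31 31 21, .nload 31 0 31, .nsub 31 31 32]) <|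
  .seq (.basic (.nrand 31 31)) <|
  .seq (blk [.nadd 31 31 32, .xload 30 5 31]) <|
  .seq (.basic (.coin 32 30)) <|
  .seq (.ite (.nlt 22 32) .skip (blk [.nload 31 5 31]))
  (blk [.nload 30 0 31])

theorem aliasStep_good {n : ℕ} {G : WGraph n} {hd : ∀ u, 0 < G.deg u} {s : State} (h : Tables G s)
    (h21 : s.nr 21 = 1) (h22 : s.nr 22 = 0) {u : Fin n} (hu : s.nr 30 = u) :
    Good [aliasStep] s 40 (G.nextPMF hd u) (fun y t => t.nr 30 = y) := by
  rw [h.nextPMF_eq u]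
  obtain ⟨hrows, htab⟩ := h
  replace htab := htab u
  have hlt := row_lt hrows hd u
  refine Good.seq (T := 39) (Good.blk_then (T := 28) (fun t => t.nr 32 = s.na 0 (u + 1) ∧
    t.nr 31 = s.na 0 (u + 2) - s.na 0 (u + 1)) rfl ?_ fun t hF ht => ?_)
  · simp [h21, hu]
  obtain ⟨t32, t31⟩ := ht
  have t22 := (hF.nr 22 rfl).trans h22
  have t0 := hF.na 0 rfl
  have t5 := hF.na 5 rfl
  have y5 := hF.xa 5 rfl
  rw [← t31]
  refine Good.seq (T := 27) (Good.nrand (T := 26) fun j hj => ?_)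
  rw [t31] at hj
  replace hj := mem_support_randPMF (by omega) hj
  refine Good.seq (T := 25) (Good.blk_then (T := 20) (fun t => t.nr 31 = s.na 0 (u + 1) + j ∧
    t.xr 30 = s.xa 5 (s.na 0 (u + 1) + j)) rfl ?_ fun t1 hF1 ht1 => ?_)
  · simp [t32, y5, add_comm]
  obtain ⟨u31, w30⟩ := ht1
  have u22 : t1.nr 22 = 0 := (hF1.nr 22 rfl).trans (by simp [t22])
  have u0 : t1.na 0 = s.na 0 := (hF1.na 0 rfl).trans (by simp [t0])
  have u5 : t1.na 5 = s.na 5 := (hF1.na 5 rfl).trans (by simp [t5])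
  rw [← w30]
  refine Good.seq (T := 19) (Good.coin (T := 18) fun b hb => ?_)
  set p := s.na 0 (u + 1) + j with hp
  -- Tails has probability zero when the weight is 1; so after tails the alias is a valid position.
  have hmem : InRow (s.na 0) u (cond b p (s.na 5 p)) := by
    cases b
    · refine htab.alias_mem p (by omega) (by omega) fun hq => ?_
      rw [w30, hq, PMF.mem_support_iff, coinPMF_false] at hb
      simp at hb
    · exact ⟨by simp only [cond_true]; omega, by simp only [cond_true]; omega⟩
  have hcol := (hrows.colAt_eq hmem).1
  refine Good.seq (T := 17) (Good.ite (T := 16) (fun hb' => ?_) (fun hb' => ?_))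
  · cases b
    · simp [u22] at hb'
    · refine Good.skip (T := 15) (Good.mono_time (Good.blk rfl (Good.nil ?_ 0)) (by simp))
      simpa [u31, u0] using hcol
  · cases b
    · refine Good.mono_time (Good.blk (T := 3) rfl (Good.blk (T := 0) rfl (Good.nil ?_ 0))) (by simp)
      simpa [u31, u0, u5] using hcol
    · simp [u22] at hb'

/-! ### Counting visits on the machine. -/

/-- The list `A 0, …, A (k - 1)` consists of the vertices that have been visited at least `x`
times. -/
structure Kept {n : ℕ} (c : Fin n → ℕ) (x : ℝ) (A : ℕ → ℕ) (k : ℕ) : Prop where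
  entry : ∀ i < k, ∃ v : Fin n, A i = v ∧ x ≤ c v
  inj : ∀ i < k, ∀ j < k, A i = A j → i = j
  all : ∀ v : Fin n, x ≤ c v → ∃ i < k, A i = v

theorem Kept.visit {n : ℕ} {c : Fin n → ℕ} {x : ℝ} {A : ℕ → ℕ} {k : ℕ} (h : Kept c x A k)
    (v : Fin n) (hv : x ≤ c v ∨ (c v + 1 : ℕ) < x) :
    Kept (Function.update c v (c v + 1)) x A k := by
  have hiff : ∀ w, x ≤ (Function.update c v (c v + 1) w : ℕ) ↔ x ≤ c w := by
    intro w
    by_cases hw : w = v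
    · subst hw
      rw [Function.update_self]
      push_cast at hv ⊢
      constructor <;> intro h <;> rcases hv with hv | hv <;> linarith
    · rw [Function.update_of_ne hw]
  refine ⟨fun i hi => ?_, h.inj, fun w hw => h.all w ((hiff w).1 hw)⟩
  obtain ⟨w, h1, h2⟩ := h.entry i hi
  exact ⟨w, h1, (hiff w).2 h2⟩

/-- This is the visit at which the count crosses x. Before it v was below the threshold, so v is not
yet listed and no duplicate arises; all other visits fall under `Kept.visit`. -/
theorem Kept.push {n : ℕ} {c : Fin n → ℕ} {x : ℝ} {A : ℕ → ℕ} {k : ℕ} (h : Kept c x A k)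
    (v : Fin n) (hv : c v < x) (hv' : x ≤ (c v + 1 : ℕ)) :
    Kept (Function.update c v (c v + 1)) x (Function.update A k v) (k + 1) := by
  have hne : ∀ i < k, A i ≠ v := by
    intro i hi he
    obtain ⟨w, h1, h2⟩ := h.entry i hi
    have : w = v := Fin.ext (h1.symm.trans he)
    rw [this] at h2
    linarith
  refine ⟨fun i hi => ?_, fun i hi j hj hij => ?_, fun w hw => ?_⟩
  · rcases (Nat.lt_succ_iff_lt_or_eq.1 hi) with hi | rfl
    · obtain ⟨w, h1, h2⟩ := h.entry i hi
      have hw : w ≠ v := fun e => hne i hi (by rw [h1, e])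
      exact ⟨w, by rw [Function.update_of_ne hi.ne, h1], by rwa [Function.update_of_ne hw]⟩
    · exact ⟨v, Function.update_self _ _ _, by rwa [Function.update_self]⟩
  · rcases (Nat.lt_succ_iff_lt_or_eq.1 hi) with hi | rfl <;>
      rcases (Nat.lt_succ_iff_lt_or_eq.1 hj) with hj | rfl
    · rw [Function.update_of_ne hi.ne, Function.update_of_ne hj.ne] at hij
      exact h.inj i hi j hj hij
    · rw [Function.update_of_ne hi.ne, Function.update_self] at hij
      exact absurd hij (hne i hi)
    · rw [Function.update_of_ne hj.ne, Function.update_self] at hij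
      exact absurd hij.symm (hne j hj)
    · rfl
  · by_cases hwv : w = v
    · exact ⟨k, by omega, by rw [Function.update_self, hwv]⟩
    · rw [Function.update_of_ne hwv] at hw
      obtain ⟨i, h1, h2⟩ := h.all w hw
      exact ⟨i, by omega, by rw [Function.update_of_ne h1.ne, h2]⟩

/-- A visit of the vertex in `nr 30` is counted, and the walk makes a lazy step. -/
def walkBody : Prog :=
  .seq (blk [.nadd 31 34 30, .xload 30 3 31, .xadd 31 30 22, .xstore 3 31 31]) <|
  .seq (.ite (.xlt 30 33) (.ite (.xle 33 31) (blk [.nstore 6 35 30, .nadd 35 35 21]) .skip) .skip) <|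
  .seq (.basic (.coin 31 23)) <|
  .seq (.ite (.nlt 22 31) aliasStep .skip)
  (blk [.nadd 33 33 21])

/-- The memory during the walks: constants, and tables of the graph. -/
structure WalkEnv {n : ℕ} (G : WGraph n) (base ℓ r : ℕ) (x : ℝ) (s : State) : Prop where
  tables : Tables G s
  one : s.nr 21 = 1
  zero : s.nr 22 = 0
  base_eq : s.nr 34 = base
  len_eq : s.nr 36 = ℓ
  reps_eq : s.nr 37 = r
  xone : s.xr 22 = 1
  half : s.xr 23 = 1 / 2
  thr : s.xr 33 = x

/-- The counts of visits in memory. -/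
structure Counts {n : ℕ} (base : ℕ) (x : ℝ) (c : Fin n → ℕ) (s : State) : Prop where
  count : ∀ v : Fin n, s.xa 3 (base + v) = c v
  fresh : ∀ i, base + n ≤ i → s.xa 3 i = 0
  kept : Kept c x (s.na 6) (s.nr 35)

theorem Counts.congr {n base : ℕ} {x : ℝ} {c : Fin n → ℕ} {s t : State} (h : Counts base x c s)
    (h1 : t.xa 3 = s.xa 3) (h2 : t.na 6 = s.na 6) (h3 : t.nr 35 = s.nr 35) : Counts base x c t := by
  obtain ⟨h4, h5, h6⟩ := h
  constructor
  · rwa [h1]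
  · rwa [h1]
  · rwa [h2, h3]

theorem WalkEnv.congr {n base ℓ r : ℕ} {G : WGraph n} {x : ℝ} {p : Prog} {s t : State}
    (h : WalkEnv G base ℓ r x s) (hF : Frame p s t)
    (hp : (p.keeps .na 0 && p.keeps .xa 0 && p.keeps .xa 5 && p.keeps .na 5 && p.keeps .nr 21 &&
      p.keeps .nr 22 && p.keeps .nr 34 && p.keeps .nr 36 && p.keeps .nr 37 && p.keeps .xr 22 &&
      p.keeps .xr 23 && p.keeps .xr 33) = true) : WalkEnv G base ℓ r x t := by
  simp only [Bool.and_eq_true] at hp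
  obtain ⟨⟨⟨⟨⟨⟨⟨⟨⟨⟨⟨p1, p2⟩, p3⟩, p4⟩, p5⟩, p6⟩, p7⟩, p8⟩, p9⟩, p10⟩, p11⟩, p12⟩ := hp
  obtain ⟨h1, h2, h3, h4, h5, h6, h7, h8, h9⟩ := h
  exact ⟨h1.congr (hF.na _ p1) (hF.xa _ p2) (hF.xa _ p3) (hF.na _ p4), (hF.nr _ p5).trans h2,
    (hF.nr _ p6).trans h3, (hF.nr _ p7).trans h4, (hF.nr _ p8).trans h5, (hF.nr _ p9).trans h6,
    (hF.xr _ p10).trans h7, (hF.xr _ p11).trans h8, (hF.xr _ p12).trans h9⟩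

theorem walkBody_good {n : ℕ} {G : WGraph n} {hd : ∀ u, 0 < G.deg u} {base ℓ r : ℕ} {x : ℝ}
    {s : State} (hE : WalkEnv G base ℓ r x s) {i : ℕ} {y : Fin n × (Fin n → ℕ)}
    (h33 : s.nr 33 = i) (h30 : s.nr 30 = y.1) (hC : Counts base x y.2 s) (m : ℕ) :
    Good [walkBody] s 80 (G.walkStep hd m y)
      (fun y t => t.nr 33 = i + 1 ∧ t.nr 30 = y.1 ∧ Counts base x y.2 t) := by
  obtain ⟨u, c⟩ := y
  simp only at h30 hC
  set c' := Function.update c u (c u + 1) with hc'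
  refine Good.map (μ := G.lazyPMF hd u)
    (Q := fun v t => t.nr 33 = i + 1 ∧ t.nr 30 = v ∧ Counts base x c' t) ?_
    (fun v => (v, c')) (fun v t h => h)
  refine Good.seq (T := 79) (Good.blk_then (T := 70) (fun t => t.xr 30 = c u ∧ t.xr 31 = (c u + 1 : ℕ) ∧
    t.xa 3 = Function.update (s.xa 3) (base + u) (c u + 1 : ℕ)) rfl ?_ fun t hF ht => ?_)
  · simp [hE.base_eq, h30, hC.count, hE.xone]
  obtain ⟨y30, y31, y3⟩ := ht
  have hE1 : WalkEnv G base ℓ r x t := hE.congr hF rfl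
  have t30 := (hF.nr 30 rfl).trans h30
  have t33 := (hF.nr 33 rfl).trans h33
  have t35 := hF.nr 35 rfl
  have t6 := hF.na 6 rfl
  have hcount : ∀ v : Fin n, t.xa 3 (base + v) = c' v := by
    intro v
    rw [y3, hc']
    by_cases hv : v = u
    · subst hv; simp
    · rw [Function.update_of_ne hv, Function.update_of_ne, hC.count]
      intro h
      exact hv (Fin.ext (by omega))
  have hfresh : ∀ i, base + n ≤ i → t.xa 3 i = 0 := by
    intro j hj
    rw [y3, Function.update_of_ne, hC.fresh j hj]
    have := u.2
    omega
  have hkeep : (x ≤ c u ∨ (c u + 1 : ℕ) < x) → Counts base x c' t := fun h =>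
    ⟨hcount, hfresh, by rw [t6, t35]; exact hC.kept.visit u h⟩
  have hmid : Ends [.ite (.xlt 30 33) (.ite (.xle 33 31)
      (blk [.nstore 6 35 30, .nadd 35 35 21]) .skip) .skip] t 10 (Counts base x c') := by
    refine Good.ite (T := 9) (fun hb => Good.ite (T := 8) (fun hb' => ?_) fun hb' => ?_) fun hb => ?_
    · rw [Test.holds, y30, hE1.thr] at hb
      rw [Test.holds, y31, hE1.thr] at hb'
      refine Good.mono_time (Good.blk rfl (Good.nil ⟨?_, ?_, ?_⟩ 0)) (by simp)
      · simpa using hcount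
      · simpa using hfresh
      · have := hC.kept.push u hb hb'
        simpa [t6, t35, t30, hE1.one] using this
    · rw [Test.holds, y31, hE1.thr, not_le] at hb'
      exact Good.skip (T := 7) (Good.nil (a := ()) (Q := fun _ => Counts base x c') (hkeep (Or.inr hb')) _)
    · rw [Test.holds, y30, hE1.thr, not_lt] at hb
      exact Good.skip (T := 8) (Good.nil (a := ()) (Q := fun _ => Counts base x c') (hkeep (Or.inl hb)) _)
  refine Good.seq (T := 69) (Ends.comp (T := 10) (T' := 59) hmid fun t1 hF1 hC1 => ?_)
  have hE2 : WalkEnv G base ℓ r x t1 := hE1.congr hF1 rfl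
  have u30 := (hF1.nr 30 rfl).trans t30
  have u33 := (hF1.nr 33 rfl).trans t33
  rw [lazyPMF, ← hE2.half]
  refine Good.seq (T := 58) (Good.coin (T := 57) fun b hb => ?_)
  have hfin : ∀ (t' : State) (v : Fin n), t'.nr 33 = i → t'.nr 21 = 1 → t'.nr 30 = v →
      Counts base x c' t' → ∀ T, Good [blk [.nadd 33 33 21]] t' (T + 3) (PMF.pure v) (fun v t =>
        t.nr 33 = i + 1 ∧ t.nr 30 = v ∧ Counts base x c' t) := by
    intro t' v e33 e21 e30 hC' T
    refine Good.blk rfl (Good.nil ⟨by simp [e33, e21], by simpa using e30, ?_⟩ T)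
    exact hC'.congr (by simp) (by simp) (by simp)
  refine Good.seq (T := 56) (Good.ite (T := 55) (fun hb' => ?_) fun hb' => ?_)
  · cases b
    · simp [hE2.zero] at hb'
    · simp only [cond_true] at hb' ⊢
      set t2 := t1.setN 31 1 with ht2
      have h1 := Good.comp_pure (k := [blk [.nadd 33 33 21]]) (T' := 15) (f := id)
        (aliasStep_good (hd := hd) (s := t2) (u := u) (hE2.tables.congr rfl rfl rfl rfl)
          (by simp [ht2, hE2.one]) (by simp [ht2, hE2.zero]) (by simp [ht2, u30]))
        (fun v t' hF' h30' => hfin t' v ((hF'.nr 33 rfl).trans (by simp [ht2, u33]))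
          ((hF'.nr 21 rfl).trans (by simp [ht2, hE2.one])) h30'
          (hC1.congr ((hF'.xa 3 rfl).trans (by simp [ht2])) ((hF'.na 6 rfl).trans (by simp [ht2]))
            ((hF'.nr 35 rfl).trans (by simp [ht2]))) 12)
      rwa [PMF.map_id] at h1
  · cases b
    · exact Good.skip (T := 54) (hfin _ u (by simp [u33]) (by simp [hE2.one]) (by simp [u30])
        (hC1.congr (by simp) (by simp) (by simp)) 51)
    · simp [hE2.zero] at hb'

/-- A whole walk of the length in `nr 36` from the vertex in `nr 23`. -/
def walkProg : Prog :=
  .seq (blk [.nadd 30 23 22, .nconst 33 0]) <|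
  .seq (.loop (.nlt 33 36) walkBody) (blk [.nadd 38 38 21])

theorem walkProg_good {n : ℕ} {G : WGraph n} {hd : ∀ u, 0 < G.deg u} {base ℓ r : ℕ} {x : ℝ}
    {s : State} (hE : WalkEnv G base ℓ r x s) {u : Fin n} {c : Fin n → ℕ} {j : ℕ}
    (h23 : s.nr 23 = u) (h38 : s.nr 38 = j) (hC : Counts base x c s) (m : ℕ) :
    Good [walkProg] s (81 * ℓ + 12) (G.walkFrom hd ℓ u m c)
      (fun c t => t.nr 38 = j + 1 ∧ Counts base x c t) := by
  refine Good.mono_time (T := 5 + ((∑ l ∈ Finset.range ℓ, (80 + 1) + 1) + 3 + 1) + 1) ?_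
    (by simp; omega)
  refine Good.seq (Good.blk_then (fun t => t.nr 30 = u ∧ t.nr 33 = 0) rfl (by simp [h23, hE.zero])
    fun t hF ht => ?_)
  have hE1 : WalkEnv G base ℓ r x t := hE.congr hF rfl
  have hC1 := hC.congr (hF.xa 3 rfl) (hF.na 6 rfl) (hF.nr 35 rfl)
  have t38 := (hF.nr 38 rfl).trans h38
  refine Good.seq (Good.comp_pure (T' := 3) (Good.loop (a := (u, c)) ℓ (κ := G.walkStep hd) (B := fun _ => 80)
    (fun i y t => t.nr 33 = i ∧ t.nr 30 = y.1 ∧ Counts base x y.2 t) ⟨ht.2, ht.1, hC1⟩ ?_ ?_) ?_)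
  · rintro i y t1 hi hF1 ⟨a1, a2, a3⟩
    have hE2 : WalkEnv G base ℓ r x t1 := hE1.congr hF1 rfl
    exact ⟨by rw [Test.holds, a1, hE2.len_eq]; exact hi, walkBody_good hE2 a1 a2 a3 i⟩
  · rintro y t1 hF1 ⟨a1, -⟩
    rw [Test.holds, a1, (hE1.congr hF1 rfl : WalkEnv G base ℓ r x t1).len_eq]
    omega
  · rintro y t1 hF1 ⟨-, -, a3⟩
    refine Good.blk (T := 0) rfl (Good.nil ⟨?_, a3.congr (by simp) (by simp) (by simp)⟩ 0)
    simp [hF1.nr 38 rfl, t38, hF1.nr 21 rfl, hE1.one]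

/-- All the walks from the vertex in `nr 23`. -/
def sampleRow : Prog := .seq (blk [.nconst 38 0, .nconst 35 0]) (.loop (.nlt 38 37) walkProg)

/-- Memory is zero at the start and every vertex uses its own block of counters from `base` on, so
counters never have to be cleared. The empty list is correct at first because x is positive. -/
theorem sampleRow_good {n : ℕ} {G : WGraph n} {hd : ∀ u, 0 < G.deg u} {base ℓ r : ℕ} {x : ℝ}
    {s : State} (hE : WalkEnv G base ℓ r x s) (hx : 0 < x) {u : Fin n} (h23 : s.nr 23 = u)
    (h3 : ∀ i, base ≤ i → s.xa 3 i = 0) :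
    Good [sampleRow] s (r * (81 * ℓ + 13) + 7) (G.rowPMF hd ℓ r u)
      (fun c t => Counts base x c t) := by
  refine Good.mono_time (T := 5 + (∑ l ∈ Finset.range r, ((81 * ℓ + 12) + 1) + 1) + 1) ?_
    (by simp only [Finset.sum_const, Finset.card_range, smul_eq_mul, Nat.add_assoc, Nat.reduceAdd]; omega)
  refine Good.seq (Good.blk_then (fun t => t.nr 38 = 0 ∧ t.nr 35 = 0) rfl (by simp)
    fun t hF ht => ?_)
  have hE1 : WalkEnv G base ℓ r x t := hE.congr hF rfl
  have t23 := (hF.nr 23 rfl).trans h23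
  refine (Good.loop (a := (0 : Fin n → ℕ)) r (κ := G.walkFrom hd ℓ u) (B := fun _ => 81 * ℓ + 12)
    (fun j c t => t.nr 38 = j ∧ Counts base x c t) ⟨ht.1, ?_⟩ ?_ ?_).mono fun c t h => h.2
  · have e3 := hF.xa 3 rfl
    refine ⟨fun v => by rw [e3, h3 _ (by omega)]; simp, fun i hi => by rw [e3, h3 _ (by omega)], ?_⟩
    rw [ht.2]
    refine ⟨fun i hi => by omega, fun i hi => by omega, fun v hv => ?_⟩
    simp at hv
    linarith
  · rintro j c t1 hj hF1 ⟨a1, a2⟩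
    have hE2 : WalkEnv G base ℓ r x t1 := hE1.congr hF1 rfl
    exact ⟨by rw [Test.holds, a1, hE2.reps_eq]; exact hj,
      walkProg_good hE2 ((hF1.nr 23 rfl).trans t23) a1 a2 j⟩
  · rintro c t1 hF1 ⟨a1, -⟩
    rw [Test.holds, a1, (hE1.congr hF1 rfl : WalkEnv G base ℓ r x t1).reps_eq]
    omega

/-! ### Writing a sorted sparse row -/

/-- The number of entries of the list `A 0, …, A (k - 1)` below `A i`. -/
def rank (A : ℕ → ℕ) (k i : ℕ) : ℕ := ((Finset.range k).filter fun j => A j < A i).card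

theorem rank_lt {A : ℕ → ℕ} {k i : ℕ} (hi : i < k) : rank A k i < k := by
  have : (Finset.range k).filter (fun j => A j < A i) ⊂ Finset.range k :=
    Finset.filter_ssubset.2 ⟨i, Finset.mem_range.2 hi, lt_irrefl _⟩
  have h := Finset.card_lt_card this
  rwa [Finset.card_range] at h

theorem rank_lt_rank {A : ℕ → ℕ} {k i j : ℕ} (hi : i < k) (hij : A i < A j) :
    rank A k i < rank A k j := by
  refine Finset.card_lt_card ⟨fun l hl => ?_, fun h => ?_⟩
  · rw [Finset.mem_filter] at hl ⊢
    exact ⟨hl.1, hl.2.trans hij⟩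
  · have := h (Finset.mem_filter.2 ⟨Finset.mem_range.2 hi, hij⟩)
    exact lt_irrefl _ (Finset.mem_filter.1 this).2

theorem rank_inj {A : ℕ → ℕ} {k : ℕ} (hA : ∀ i < k, ∀ j < k, A i = A j → i = j) {i j : ℕ}
    (hi : i < k) (hj : j < k) (h : rank A k i = rank A k j) : i = j := by
  refine hA i hi j hj ?_
  rcases lt_trichotomy (A i) (A j) with h1 | h1 | h1
  · exact absurd h (rank_lt_rank hi h1).ne
  · exact h1
  · exact absurd h (rank_lt_rank hj h1).ne'

/-- An injective map of a finite set to itself is surjective. So writing each entry at its rank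
leaves no gap. -/
theorem exists_rank_eq {A : ℕ → ℕ} {k : ℕ} (hA : ∀ i < k, ∀ j < k, A i = A j → i = j) {p : ℕ}
    (hp : p < k) : ∃ i < k, rank A k i = p := by
  have h1 : (Finset.range k).image (rank A k) = Finset.range k := by
    refine Finset.eq_of_subset_of_card_le (fun x hx => ?_) ?_
    · obtain ⟨i, hi, rfl⟩ := Finset.mem_image.1 hx
      exact Finset.mem_range.2 (rank_lt (Finset.mem_range.1 hi))
    · rw [Finset.card_image_of_injOn]
      intro i hi j hj hij
      simp only [Finset.coe_range, Set.mem_Iio] at hi hj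
      exact rank_inj hA hi hj hij
  have h2 : p ∈ (Finset.range k).image (rank A k) := by rw [h1]; exact Finset.mem_range.2 hp
  obtain ⟨i, hi, h⟩ := Finset.mem_image.1 h2
  exact ⟨i, Finset.mem_range.1 hi, h⟩

/-- The positions from `lo` to `hi` of the arrays `a`, `b` hold the sparse vector `f`. -/
structure RowStored {n : ℕ} (a : ℕ → ℕ) (b : ℕ → ℝ) (lo hi : ℕ) (f : Fin n → ℝ) : Prop where
  entry : ∀ p, lo ≤ p → p < hi → ∃ v : Fin n, a p = v ∧ b p = f v ∧ f v ≠ 0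
  sorted : ∀ p q, lo ≤ p → p < q → q < hi → a p < a q
  all : ∀ v : Fin n, f v ≠ 0 → ∃ p, (lo ≤ p ∧ p < hi) ∧ a p = v

theorem RowStored.congr {n : ℕ} {a a' : ℕ → ℕ} {b b' : ℕ → ℝ} {lo hi : ℕ} {f : Fin n → ℝ}
    (h : RowStored a b lo hi f) (ha : ∀ p, lo ≤ p → p < hi → a' p = a p)
    (hb : ∀ p, lo ≤ p → p < hi → b' p = b p) : RowStored a' b' lo hi f := by
  refine ⟨fun p h1 h2 => ?_, fun p q h1 h2 h3 => ?_, fun v hv => ?_⟩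
  · rw [ha p h1 h2, hb p h1 h2]; exact h.entry p h1 h2
  · rw [ha p h1 (by omega), ha q (by omega) h3]; exact h.sorted p q h1 h2 h3
  · obtain ⟨p, h1, h2⟩ := h.all v hv
    exact ⟨p, h1, by rw [ha p h1.1 h1.2, h2]⟩

/-- The sparse estimate obtained from a vector of counts: small counts are dropped. -/
def sparse {n : ℕ} (x d : ℝ) (c : Fin n → ℕ) (v : Fin n) : ℝ := if x ≤ c v then c v / d else 0

theorem sparse_ne_zero {n : ℕ} {x d : ℝ} (hx : 0 < x) (hd : 0 < d) {c : Fin n → ℕ} {v : Fin n} :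
    sparse x d c v ≠ 0 ↔ x ≤ c v := by
  rw [sparse]
  split_ifs with h
  · exact ⟨fun _ => h, fun _ => (div_pos (hx.trans_le h) hd).ne'⟩
  · exact ⟨fun h' => absurd rfl h', fun h' => absurd h' h⟩

/-- The kept vertices of the row are written in increasing order. -/
def emitRow : Prog :=
  .seq (blk [.nconst 40 0]) <|
  .seq (.loop (.nlt 40 35) <|
    .seq (blk [.nload 43 6 40, .nadd 42 39 22, .nconst 41 0]) <|
    .seq (.loop (.nlt 41 35) <|
      .seq (blk [.nload 44 6 41]) <|
      .seq (.ite (.nlt 44 43) (blk [.nadd 42 42 21]) .skip) (blk [.nadd 41 41 21]))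
    (blk [.nstore 1 42 43, .nadd 45 34 43, .xload 35 3 45, .xdiv 35 35 34, .xstore 1 42 35,
      .nadd 40 40 21]))
  (blk [.nadd 39 39 35, .nadd 45 23 21, .nadd 45 45 21, .nstore 1 45 39])

/-- Sorting by rank: for each kept vertex the smaller kept ones are counted, which costs k²
comparisons and needs no auxiliary structure. The condition u + 2 < P keeps the table of row
boundaries apart from the block being written. -/
theorem emitRow_ends {n : ℕ} {s : State} {base k P u : ℕ} {x d : ℝ} {c : Fin n → ℕ}
    (h21 : s.nr 21 = 1) (h22 : s.nr 22 = 0) (h23 : s.nr 23 = u) (h34 : s.nr 34 = base)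
    (h39 : s.nr 39 = P) (hd : s.xr 34 = d) (hx0 : 0 < x) (hd0 : 0 < d) (huP : u + 2 < P)
    (hC : Counts base x c s) (hk : s.nr 35 = k) :
    Ends [emitRow] s (k * (13 * k + 36) + 15) (fun t => t.nr 39 = P + k ∧ t.na 1 (u + 2) = P + k ∧
      (∀ p, p ≠ u + 2 → p < P → t.na 1 p = s.na 1 p) ∧ (∀ p < P, t.xa 1 p = s.xa 1 p) ∧
      RowStored (t.na 1) (t.xa 1) P (P + k) (sparse x d c)) := by
  have hK := hC.kept
  rw [hk] at hK
  set A := s.na 6 with hA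
  refine Good.mono_time (T := 3 + (k * (13 * k + 35 + 1) + 1 + 9 + 1) + 1) ?_
    (by simp only [Nat.add_assoc, Nat.reduceAdd]; omega)
  refine Good.seq (Good.blk_then (fun t => t.nr 40 = 0) rfl (by simp) fun t hF t40 => ?_)
  have t35 := (hF.nr 35 rfl).trans hk
  have t39 := (hF.nr 39 rfl).trans h39
  have t34 := (hF.nr 34 rfl).trans h34
  have t21 := (hF.nr 21 rfl).trans h21
  have t22 := (hF.nr 22 rfl).trans h22
  have t23 := (hF.nr 23 rfl).trans h23
  have y34 := (hF.xr 34 rfl).trans hd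
  have t6 := hF.na 6 rfl
  have t1 := hF.na 1 rfl
  have y1 := hF.xa 1 rfl
  have y3 := hF.xa 3 rfl
  rw [← hA] at t6
  clear hF
  refine Good.seq (Ends.comp (T' := 9) (Ends.loop_const k (13 * k + 35) (fun i t' => t'.nr 40 = i ∧
    (∀ p < P, t'.na 1 p = s.na 1 p) ∧ (∀ p < P, t'.xa 1 p = s.xa 1 p) ∧
    ∀ i' < i, t'.na 1 (P + rank A k i') = A i' ∧
      ∀ v : Fin n, A i' = v → t'.xa 1 (P + rank A k i') = c v / d) ⟨t40, fun p _ => by rw [t1],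
      fun p _ => by rw [y1], fun i hi => by omega⟩ ?_ ?_) fun t2 hF ht2 => ?_)
  · rintro i t2 hi hF ⟨u40, ulow, wlow, hdone⟩
    have u35 := (hF.nr 35 rfl).trans t35
    have u39 := (hF.nr 39 rfl).trans t39
    have u34 := (hF.nr 34 rfl).trans t34
    have u21 := (hF.nr 21 rfl).trans t21
    have u22 := (hF.nr 22 rfl).trans t22
    have w34 := (hF.xr 34 rfl).trans y34
    have u6 := (hF.na 6 rfl).trans t6
    have w3 := (hF.xa 3 rfl).trans y3
    refine ⟨by rw [Test.holds, u40, u35]; exact hi, ?_⟩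
    refine Good.mono_time (T := 7 + (k * (12 + 1) + 1 + 13 + 1) + 1) ?_ (by omega)
    refine Good.seq (Good.blk_then (fun t => t.nr 43 = A i ∧ t.nr 42 = P ∧ t.nr 41 = 0) rfl
      (by simp [u6, u40, u39, u22]) fun t3 hF3 ht3 => ?_)
    obtain ⟨a43, a42, a41⟩ := ht3
    have a35 := (hF3.nr 35 rfl).trans u35
    have a21 := (hF3.nr 21 rfl).trans u21
    have a6 := (hF3.na 6 rfl).trans u6
    refine Good.seq (Ends.comp (T' := 13) (Ends.loop_const k 12 (fun j t' => t'.nr 41 = j ∧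
      t'.nr 42 = P + ((Finset.range j).filter fun l => A l < A i).card) ⟨a41, by simp [a42]⟩ ?_ ?_)
      fun t4 hF4 ht4 => ?_)
    · rintro j t4 hj hF4 ⟨b41, b42⟩
      have b35 := (hF4.nr 35 rfl).trans a35
      have b21 := (hF4.nr 21 rfl).trans a21
      have b43 := (hF4.nr 43 rfl).trans a43
      have b6 := (hF4.na 6 rfl).trans a6
      refine ⟨by rw [Test.holds, b41, b35]; exact hj, ?_⟩
      rw [Finset.range_add_one, Finset.filter_insert]
      refine Good.seq (T := 11) (Good.blk_then (T := 8) (fun t => t.nr 44 = A j) rfl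
        (by simp [b6, b41]) fun t5 hF5 c44 => ?_)
      have c41 := (hF5.nr 41 rfl).trans b41
      have c42 := (hF5.nr 42 rfl).trans b42
      have c43 := (hF5.nr 43 rfl).trans b43
      have c21 := (hF5.nr 21 rfl).trans b21
      refine Good.seq (T := 7) (Good.ite (T := 6) (fun hb => ?_) fun hb => ?_)
      · rw [Test.holds, c44, c43] at hb
        refine Good.blk (T := 3) rfl (Good.blk (T := 0) rfl (Good.nil ?_ 0))
        rw [if_pos hb, Finset.card_insert_of_notMem (by simp)]
        simp [c41, c42, c21]
        ring
      · rw [Test.holds, c44, c43] at hb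
        refine Good.skip (T := 5) (Good.mono_time (Good.blk (T := 0) rfl (Good.nil ?_ 0)) (by simp))
        rw [if_neg hb]
        simp [c41, c42, c21]
    · rintro t4 hF4 ⟨b41, -⟩
      rw [Test.holds, b41, (hF4.nr 35 rfl).trans a35]
      omega
    · obtain ⟨-, b42⟩ := ht4
      change t4.nr 42 = P + rank A k i at b42
      have b43 := (hF4.nr 43 rfl).trans a43
      have b34 := (hF4.nr 34 rfl).trans ((hF3.nr 34 rfl).trans u34)
      have b40 := (hF4.nr 40 rfl).trans ((hF3.nr 40 rfl).trans u40)
      have b21 := (hF4.nr 21 rfl).trans a21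
      have b1 := (hF4.na 1 rfl).trans (hF3.na 1 rfl)
      have d1 := (hF4.xa 1 rfl).trans (hF3.xa 1 rfl)
      have d3 := (hF4.xa 3 rfl).trans ((hF3.xa 3 rfl).trans w3)
      have d34 := (hF4.xr 34 rfl).trans ((hF3.xr 34 rfl).trans w34)
      refine Good.mono_time (Good.blk (T := 0) rfl (Good.nil ?_ 0)) (by simp)
      simp only [List.foldl, Instr.det, State.setN_nr, State.setN_na, State.putN_nr,
        State.putN_na, State.setN_xa, State.putN_xa, State.setX_xa, State.setX_nr, State.setX_na,
        State.setX_xr, State.putX_nr, State.putX_na, State.putX_xa, State.putN_xr, State.setN_xr]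
      simp only [b42, b43, b34, b40, b21, b1, d1, d3, d34]
      refine ⟨by simp, fun p hp => ?_, fun p hp => ?_, fun i' hi' => ?_⟩
      · simp only [if_true]
        rw [Function.update_of_ne (by omega)]
        exact ulow p hp
      · simp only [if_true]
        simp only [Nat.reduceEqDiff, if_false]
        rw [Function.update_of_ne (by omega)]
        exact wlow p hp
      · simp only [Nat.reduceEqDiff, if_false, if_true]
        rcases Nat.lt_succ_iff_lt_or_eq.1 hi' with hlt | rfl
        · have hne : P + rank A k i' ≠ P + rank A k i := fun h =>
            hlt.ne (rank_inj hK.inj (by omega) hi (by omega))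
          rw [Function.update_of_ne hne, Function.update_of_ne hne]
          exact hdone i' hlt
        · rw [Function.update_self, Function.update_self]
          refine ⟨rfl, fun v hv => ?_⟩
          rw [hv, hC.count]
  · rintro t2 hF ⟨u40, -⟩
    rw [Test.holds, u40, (hF.nr 35 rfl).trans t35]
    omega
  · obtain ⟨-, ulow, wlow, hdone⟩ := ht2
    have u35 := (hF.nr 35 rfl).trans t35
    have u39 := (hF.nr 39 rfl).trans t39
    have u23 := (hF.nr 23 rfl).trans t23
    have u21 := (hF.nr 21 rfl).trans t21
    refine Good.mono_time (Good.blk (T := 0) rfl (Good.nil ?_ 0)) (by simp)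
    simp only [List.foldl, Instr.det, State.setN_nr, State.setN_na, State.putN_nr,
      State.putN_na, State.setN_xa, State.putN_xa]
    simp only [u35, u39, u23, u21, Nat.reduceEqDiff, if_false, if_true]
    have hrow : ∀ i < k, Function.update (t2.na 1) (u + 1 + 1) (P + k) (P + rank A k i) = A i := by
      intro i hi
      rw [Function.update_of_ne (by omega)]
      exact (hdone i hi).1
    refine ⟨trivial, by simp, fun p h1 h2 => ?_, wlow, fun p h1 h2 => ?_, fun p q h1 h2 h3 => ?_,
      fun v hv => ?_⟩
    · rw [Function.update_of_ne h1, ulow p h2]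
    · obtain ⟨i, hi, hp⟩ := exists_rank_eq hK.inj (p := p - P) (by omega)
      obtain rfl : p = P + rank A k i := by omega
      obtain ⟨v, hv1, hv2⟩ := hK.entry i hi
      refine ⟨v, by rw [hrow i hi, hv1], ?_, (sparse_ne_zero hx0 hd0).2 hv2⟩
      rw [(hdone i hi).2 v hv1, sparse, if_pos hv2]
    · obtain ⟨i, hi, hp⟩ := exists_rank_eq hK.inj (p := p - P) (by omega)
      obtain ⟨j, hj, hq⟩ := exists_rank_eq hK.inj (p := q - P) (by omega)
      obtain rfl : p = P + rank A k i := by omega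
      obtain rfl : q = P + rank A k j := by omega
      rw [hrow i hi, hrow j hj]
      rcases lt_trichotomy (A i) (A j) with h4 | h4 | h4
      · exact h4
      · rw [hK.inj i hi j hj h4] at h2
        exact absurd h2 (lt_irrefl _)
      · have := rank_lt_rank hj h4
        omega
    · obtain ⟨i, hi, hiv⟩ := hK.all v ((sparse_ne_zero hx0 hd0).1 hv)
      have := rank_lt (A := A) hi
      exact ⟨P + rank A k i, ⟨by omega, by omega⟩, by rw [hrow i hi, hiv]⟩

theorem card_filter_mul_le {n : ℕ} {x : ℝ} {c : Fin n → ℕ} :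
    ((Finset.univ.filter fun v => x ≤ c v).card : ℝ) * x ≤ (∑ v, c v : ℕ) := by
  calc ((Finset.univ.filter fun v => x ≤ c v).card : ℝ) * x
      = ∑ v with x ≤ c v, x := by rw [Finset.sum_const, nsmul_eq_mul]
    _ ≤ ∑ v with x ≤ c v, (c v : ℝ) :=
        Finset.sum_le_sum fun v hv => (Finset.mem_filter.1 hv).2
    _ ≤ ∑ v, (c v : ℝ) :=
        Finset.sum_le_sum_of_subset_of_nonneg (Finset.filter_subset _ _) fun v _ _ =>
          Nat.cast_nonneg _
    _ = _ := by push_cast; rfl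

/-- The list maps injectively to the vertices of count at least x, each of which contributes at
least x to the total. -/
theorem Kept.mul_le {n : ℕ} {c : Fin n → ℕ} {x : ℝ} {A : ℕ → ℕ} {k : ℕ} (h : Kept c x A k)
    (hx : 0 < x) : k * x ≤ (∑ v, c v : ℕ) := by
  refine le_trans ?_ (card_filter_mul_le (x := x))
  refine mul_le_mul_of_nonneg_right (Nat.cast_le.2 ?_) hx.le
  choose f hf1 hf2 using h.entry
  have := Finset.card_le_card_of_injOn (s := (Finset.range k).attach)
    (t := Finset.univ.filter fun v => x ≤ c v)
    (fun i => f i.1 (Finset.mem_range.1 i.2)) (fun i _ => by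
      simpa using hf2 i.1 (Finset.mem_range.1 i.2)) (fun i _ j _ hij => by
      refine Subtype.ext (h.inj _ (Finset.mem_range.1 i.2) _ (Finset.mem_range.1 j.2) ?_)
      rw [hf1 _ (Finset.mem_range.1 i.2), hf1 _ (Finset.mem_range.1 j.2)]
      exact congrArg Fin.val hij)
  simpa using this

/-! ### All rows of the sketch -/

/-- The row of the vertex in `nr 23` is sampled and written. -/
def rowProg : Prog :=
  .seq sampleRow <| .seq emitRow (blk [.nadd 23 23 21, .nadd 34 34 20])

/-- The rows up to `i` have been written. -/
structure RowsInv {n : ℕ} (G : WGraph n) (ℓ r : ℕ) (x : ℝ) (i : ℕ) (cs : Fin n → Fin n → ℕ)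
    (t : State) : Prop where
  env : WalkEnv G (i * n) ℓ r x t
  size : t.nr 20 = n
  row : t.nr 23 = i
  divisor : t.xr 34 = 2 * r
  out_ge : n + 2 ≤ t.nr 39
  a_zero : t.na 1 0 = n
  a_one : t.na 1 1 = n + 2
  a_out : t.na 1 (i + 1) = t.nr 39
  stored : ∀ u : Fin n, u.1 < i → n + 2 ≤ t.na 1 (u + 1) ∧ t.na 1 (u + 1) ≤ t.na 1 (u + 2) ∧
    t.na 1 (u + 2) ≤ t.nr 39 ∧
    RowStored (t.na 1) (t.xa 1) (t.na 1 (u + 1)) (t.na 1 (u + 2)) (sparse x (2 * r) (cs u))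
  degs : ∀ u : Fin n, t.xa 1 u = G.deg u
  fresh : ∀ j, i * n ≤ j → t.xa 3 j = 0

theorem rowProg_good {n : ℕ} {G : WGraph n} {hd : ∀ u, 0 < G.deg u} {ℓ r i : ℕ} {x : ℝ}
    {cs : Fin n → Fin n → ℕ} {s : State} (hI : RowsInv G ℓ r x i cs s) (hi : i < n) (hr : 0 < r)
    (hx : 0 < x) (hk : ∀ k : ℕ, k * x ≤ (r * ℓ : ℕ) → k * k ≤ r) :
    Good [rowProg] s (r * (81 * ℓ + 13) + 49 * r + 40) (G.tableStep hd ℓ r i cs)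
      (fun cs t => RowsInv G ℓ r x (i + 1) cs t) := by
  rw [tableStep, dif_pos hi]
  set u : Fin n := ⟨i, hi⟩ with hu
  have hr' : (0 : ℝ) < 2 * r := by have : (0 : ℝ) < r := Nat.cast_pos.2 hr; linarith
  refine Good.mono_time (T := (r * (81 * ℓ + 13) + 7) + (49 * r + 30) + 1) ?_ (by omega)
  refine Good.seq (Good.comp_pure (sampleRow_good hI.env hx (u := u) hI.row hI.fresh).mem
    fun c t hF ht => ?_)
  obtain ⟨hc, hC⟩ := ht
  have hE : WalkEnv G (i * n) ℓ r x t := hI.env.congr hF rfl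
  have hkk : t.nr 35 * t.nr 35 ≤ r := by
    refine hk _ ((hC.kept.mul_le hx).trans_eq ?_)
    rw [row_support hc]
    simp
  have t23 := (hF.nr 23 rfl).trans hI.row
  have t39 := hF.nr 39 rfl
  have t20 := (hF.nr 20 rfl).trans hI.size
  have t1 := hF.na 1 rfl
  have y1 := hF.xa 1 rfl
  have y34 := (hF.xr 34 rfl).trans hI.divisor
  set k := t.nr 35 with hkdef
  set P := s.nr 39 with hP
  have hout := hI.out_ge
  rw [← hP] at hout
  -- With k ≤ k² ≤ r the quadratic sorting cost 13k² + 36k is at most 49r.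
  have hk1 : k ≤ k * k := Nat.le_mul_self k
  refine Good.seq (T := 49 * r + 29) (Good.mono_time (T := k * (13 * k + 36) + 15 + 5)
    (Ends.comp (T' := 5) (emitRow_ends hE.one hE.zero t23 hE.base_eq t39 y34 hx hr'
    (by omega) hC rfl) fun t2 hF2 ht2 => ?_) (by nlinarith))
  obtain ⟨u39, ui, ulow, wlow, hrow⟩ := ht2
  have hE2 : WalkEnv G (i * n) ℓ r x t2 := hE.congr hF2 rfl
  have u23 := (hF2.nr 23 rfl).trans t23
  have u20 := (hF2.nr 20 rfl).trans t20
  have w34 := (hF2.xr 34 rfl).trans y34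
  have w3 := hF2.xa 3 rfl
  refine Good.blk (T := 0) rfl (Good.nil ?_ 0)
  simp only [List.foldl, Instr.det]
  have hstored : ∀ v : Fin n, v.1 < i → n + 2 ≤ t2.na 1 (v + 1) ∧
      t2.na 1 (v + 1) ≤ t2.na 1 (v + 2) ∧ t2.na 1 (v + 2) ≤ P + k ∧
      RowStored (t2.na 1) (t2.xa 1) (t2.na 1 (v + 1)) (t2.na 1 (v + 2))
        (sparse x (2 * r) (cs v)) := by
    intro v hv
    obtain ⟨h1, h2, h3, h4⟩ := hI.stored v hv
    rw [← t1] at h1 h2 h3 h4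
    rw [← y1] at h4
    rw [ulow (v + 1) (by omega) (by omega), ulow (v + 2) (by omega) (by omega)]
    refine ⟨h1, h2, by omega, h4.congr (fun p h5 h6 => ulow p (by omega) (by omega))
      fun p h5 h6 => wlow p (by omega)⟩
  have hPi : t2.na 1 (i + 1) = P := by
    rw [ulow _ (by omega) (by omega), t1, hI.a_out]
  constructor
  · refine ⟨hE2.tables.congr (by simp) (by simp) (by simp) (by simp), ?_, ?_, ?_, ?_, ?_, ?_, ?_, ?_⟩
    · simpa using hE2.one
    · simpa using hE2.zero
    · simp [hE2.base_eq, u20]; ring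
    · simpa using hE2.len_eq
    · simpa using hE2.reps_eq
    · simpa using hE2.xone
    · simpa using hE2.half
    · simpa using hE2.thr
  · simpa using u20
  · simp [u23, hE2.one]
  · simpa using w34
  · simp only [State.setN_nr, Nat.reduceEqDiff, if_false, u39]; omega
  · simp only [State.setN_na]; rw [ulow 0 (by omega) (by omega), t1, hI.a_zero]
  · simp only [State.setN_na]; rw [ulow 1 (by omega) (by omega), t1, hI.a_one]
  · simpa [u39] using ui
  · intro v hv
    simp only [State.setN_na, State.setN_xa, State.setN_nr, Nat.reduceEqDiff, if_false, u39]
    by_cases hvi : v = u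
    · subst hvi
      rw [Function.update_self]
      simp only [hu]
      rw [hPi, ui]
      exact ⟨hout, by omega, le_rfl, hrow⟩
    · rw [Function.update_of_ne hvi]
      refine hstored v ?_
      have : v.1 ≠ i := fun h => hvi (Fin.ext h)
      omega
  · intro v
    simp only [State.setN_xa]
    rw [wlow v (by omega), y1, hI.degs]
  · intro j hj
    simp only [State.setN_xa, w3]
    exact hC.fresh j (by rw [← Nat.succ_mul]; exact hj)

theorem RowsInv.sketch {n : ℕ} {G : WGraph n} {ℓ r : ℕ} {x : ℝ} {cs : Fin n → Fin n → ℕ}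
    {t : State} (h : RowsInv G ℓ r x n cs t) :
    StoresSketch G.deg (fun u => sparse x (2 * r) (cs u)) t := by
  have hsort : ∀ (u : Fin n) (p q : ℕ), InRow (t.na 1) u p → InRow (t.na 1) u q → p < q →
      t.na 1 p < t.na 1 q := fun u p q hp hq hpq =>
    (h.stored u u.2).2.2.2.sorted p q hp.1 hpq hq.2
  refine ⟨⟨h.a_zero, h.a_one, fun u => (h.stored u u.2).2.1, fun u p hp => ?_,
    fun u p q hp hq hpq => ?_, fun u v huv => ?_⟩, hsort, h.degs⟩
  · exact (h.stored u u.2).2.2.2.entry p hp.1 hp.2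
  · rcases lt_trichotomy p q with h1 | h1 | h1
    · exact absurd hpq (hsort u p q hp hq h1).ne
    · exact h1
    · exact absurd hpq (hsort u q p hq hp h1).ne'
  · exact (h.stored u u.2).2.2.2.all v huv

/-- All rows of the sketch are sampled and written. -/
def allRows : Prog := .seq (blk [.nconst 23 0, .nconst 34 0]) (.loop (.nlt 23 20) rowProg)

/-- The degrees and the alias tables of all vertices are computed. -/
def allAlias : Prog :=
  .seq (blk [.nconst 23 0]) (.loop (.nlt 23 20) (.seq aliasRow (blk [.nadd 23 23 21])))

theorem allAlias_ends {n : ℕ} {G : WGraph n} (hd : ∀ u, 0 < G.deg u) {s : State}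
    (h20 : s.nr 20 = n) (h21 : s.nr 21 = 1) (h22 : s.nr 22 = 0) (x22 : s.xr 22 = 1)
    (hrows : StoresRows n (s.na 0) (s.xa 0) G.A) :
    Ends [allAlias] s (200 * G.numEdges + 45 * n + 5) (fun t => Tables G t ∧
      ∀ u : Fin n, t.xa 1 u = G.deg u) := by
  set a := s.na 0 with ha
  set b := s.xa 0 with hb
  -- Blocks of different rows are disjoint, so building the table of row i preserves the earlier
  -- ones.
  have hmono : ∀ j i, i ≤ j → j < n → a (i + 1) ≤ a (j + 1) := by
    intro j i hij hj
    induction j, hij using Nat.le_induction with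
    | base => exact le_rfl
    | succ j hij ih =>
      exact (ih (by omega)).trans (hrows.mono ⟨j, by omega⟩)
  have hT : ∑ i ∈ Finset.range n, (44 + 100 * (a (i + 2) - a (i + 1)) + 1) =
      200 * G.numEdges + 45 * n := by
    have := sum_range_row_le hrows
    simp only [Finset.sum_add_distrib, ← Finset.mul_sum, this, Finset.sum_const, Finset.card_range,
      smul_eq_mul]
    ring
  refine Good.mono_time (T := 3 + (∑ i ∈ Finset.range n, (44 + 100 * (a (i + 2) - a (i + 1)) + 1) + 1)
    + 1) ?_ (by rw [hT]; omega)
  refine Good.seq (Good.blk_then (fun t => t.nr 23 = 0) rfl (by simp) fun t hF t23 => ?_)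
  have t20 := (hF.nr 20 rfl).trans h20
  have t21 := (hF.nr 21 rfl).trans h21
  have t22 := (hF.nr 22 rfl).trans h22
  have y22 := (hF.xr 22 rfl).trans x22
  have t0 := hF.na 0 rfl
  have y0 := hF.xa 0 rfl
  rw [← ha] at t0
  rw [← hb] at y0
  refine Good.mono (Ends.loop (s := t) n (B := fun i => 44 + 100 * (a (i + 2) - a (i + 1)))
    (fun i t' => t'.nr 23 = i ∧ (∀ u : Fin n, u.1 < i → t'.xa 1 u = G.deg u ∧
      AliasTable (a (u + 1)) (a (u + 2)) (fun p => b p * (((a (u + 2) - a (u + 1) : ℕ) : ℝ) / G.deg u))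
        (t'.xa 5) (t'.na 5))) ⟨t23, fun u hu => absurd hu (by omega)⟩ ?_ ?_).frame ?_
  · rintro i t1 hi hF1 ⟨u23, hdone⟩
    have u20 := (hF1.nr 20 rfl).trans t20
    have u21 := (hF1.nr 21 rfl).trans t21
    have u22 := (hF1.nr 22 rfl).trans t22
    have w22 := (hF1.xr 22 rfl).trans y22
    have u0 := (hF1.na 0 rfl).trans t0
    have w0 := (hF1.xa 0 rfl).trans y0
    refine ⟨by rw [Test.holds, u23, u20]; exact hi, ?_⟩
    set u : Fin n := ⟨i, hi⟩ with hu
    have hlt := row_lt hrows hd u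
    refine Good.mono_time (T := (40 + 100 * (a (u + 2) - a (u + 1))) + 3 + 1) ?_
      (by simp only [hu]; omega)
    refine Good.seq (Ends.comp (aliasRow_ends hlt u21 u22 w22 (by rw [u0, u23]) (by rw [u0, u23])
      (fun p h1 h2 => ?_)) fun t2 hF2 ht2 => ?_)
    · rw [w0, (hrows.colAt_eq (u := u) ⟨h1, h2⟩).2.1]
      exact lt_of_le_of_ne (G.nonneg _ _) (Ne.symm (hrows.colAt_eq (u := u) ⟨h1, h2⟩).2.2)
    · obtain ⟨v1, v2, v3⟩ := ht2
      rw [w0, hrows.sum_eq u] at v1 v2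
      rw [u23] at v1
      refine Good.blk (T := 0) rfl (Good.nil ⟨?_, fun v hv => ?_⟩ 0)
      · simp [hF2.nr 23 rfl, u23, hF2.nr 21 rfl, u21]
      · simp only [List.foldl, Instr.det, State.setN_xa, State.setN_na]
        rw [v1]
        by_cases hvu : v = u
        · subst hvu
          exact ⟨Function.update_self _ _ _, v2⟩
        · have hvi : v.1 < i := by
            have : v.1 ≠ i := fun h => hvu (Fin.ext h)
            omega
          have hdis : a (v + 2) ≤ a (i + 1) := hmono i (v + 1) (by omega) hi
          obtain ⟨h1, h2⟩ := hdone v hvi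
          refine ⟨by rw [Function.update_of_ne (by omega), h1], h2.congr (fun p h3 h4 => ?_)
            fun p h3 h4 => ?_⟩
          · refine (v3 p ?_).1
            simp only [hu]; omega
          · refine (v3 p ?_).2
            simp only [hu]; omega
  · rintro t1 hF1 ⟨u23, -⟩
    rw [Test.holds, u23, (hF1.nr 20 rfl).trans t20]
    omega
  · rintro _ t1 ⟨⟨-, h⟩, hF1⟩
    have u0 := (hF1.na 0 rfl).trans t0
    have w0 := (hF1.xa 0 rfl).trans y0
    exact ⟨⟨by rw [u0, w0]; exact hrows, fun u => by rw [u0, w0]; exact (h u u.2).2⟩,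
      fun u => (h u u.2).1⟩

/-! ### The parameters of the sketch -/

/-- The number of doublings that bring `ε` up to `1`. -/
def doublings (ε : ℝ) : ℕ := ⌈Real.logb 2 ε⁻¹⌉₊

/-- The number of visits of a walk. -/
def walkLen (ε ν : ℝ) : ℕ := ⌈2 * (doublings ε + 1) / ν⌉₊

/-- The number of walks from each vertex. -/
def numWalks (c n : ℕ) (ε ν : ℝ) : ℕ :=
  ⌈(walkLen ε ν / ε) ^ 2 * Nat.clog 2 n * (256 * (c + 3))⌉₊

/-- The numbers `log n`, `log (1 / ε)`, the length and the number of the walks and the threshold are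
computed, and the sketch is initialised. -/
def params (c : ℕ) : Prog :=
  .seq (blk [.nconst 21 1, .nconst 22 0, .nload 20 0 22, .xload 20 0 22, .xload 21 0 21,
    .xconst 22 1, .xconst 23 (1 / 2), .nconst 46 1, .xconst 36 0, .xconst 37 1, .xconst 24 0,
    .xadd 38 20 24]) <|
  .seq (.loop (.nlt 46 20) (blk [.nadd 46 46 46, .xadd 36 36 22])) <|
  .seq (.loop (.xlt 38 22) (blk [.xadd 38 38 38, .xadd 37 37 22])) <|
  .seq (blk [.xadd 39 37 37, .xdiv 39 39 21, .nconst 36 0, .xconst 40 0]) <|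
  .seq (.loop (.xlt 40 39) (blk [.nadd 36 36 21, .xcast 40 36])) <|
  .seq (blk [.xdiv 41 40 20, .xmul 41 41 41, .xmul 41 41 36, .xconst 42 (256 * (c + 3)),
    .xmul 41 41 42, .nconst 37 0, .xconst 43 0]) <|
  .seq (.loop (.xlt 43 41) (blk [.nadd 37 37 21, .xcast 43 37])) <|
  blk [.xadd 34 43 43, .xmul 33 43 20, .xconst 42 8, .xdiv 33 33 42, .nstore 1 22 20,
    .nadd 39 20 21, .nadd 39 39 21, .nstore 1 21 39]

/-- The machine has neither logarithms nor ceilings, so each parameter is found by a counting loop,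
which stops exactly at the ceiling of its bound. The time is the sum of the values found, which the
walks will dominate. -/
theorem params_ends {c n : ℕ} {ε ν : ℝ} {s : State} (h0 : s.na 0 0 = n) (hε : s.xa 0 0 = ε)
    (hν : s.xa 0 1 = ν) (hε0 : 0 < ε) : Ends [params c] s
      (6 * (Nat.clog 2 n + doublings ε + walkLen ε ν + numWalks c n ε ν) + 100) (fun t =>
        (t.nr 20 = n ∧ t.nr 21 = 1 ∧ t.nr 22 = 0 ∧ t.nr 36 = walkLen ε ν ∧
        t.nr 37 = numWalks c n ε ν ∧ t.nr 39 = n + 2) ∧ (t.xr 22 = 1 ∧ t.xr 23 = 1 / 2 ∧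
        t.xr 33 = numWalks c n ε ν * ε / 8 ∧ t.xr 34 = 2 * numWalks c n ε ν) ∧
        t.na 1 0 = n ∧ t.na 1 1 = n + 2) := by
  set K := Nat.clog 2 n with hK
  set e := doublings ε with he
  set ℓ := walkLen ε ν with hℓ
  set r := numWalks c n ε ν with hr
  refine Good.mono_time (T := 25 + (K * (5 + 1) + 1 + (e * (5 + 1) + 1 + (9 + (ℓ * (5 + 1) + 1 +
    (15 + (r * (5 + 1) + 1 + 17 + 1) + 1) + 1) + 1) + 1) + 1) + 1) ?_
    (by simp only [Nat.add_assoc, Nat.reduceAdd]; omega)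
  refine Good.seq (Good.blk_then (fun t => (t.nr 20 = n ∧ t.nr 21 = 1 ∧ t.nr 22 = 0 ∧
    t.nr 46 = 2 ^ 0) ∧ t.xr 20 = ε ∧ t.xr 21 = ν ∧ t.xr 22 = 1 ∧ t.xr 23 = 1 / 2 ∧
    t.xr 36 = (0 : ℕ) ∧ t.xr 37 = (0 : ℕ) + 1 ∧ t.xr 38 = 2 ^ 0 * ε) rfl (by simp [h0, hε, hν])
    fun t hF ht => ?_)
  clear hF
  obtain ⟨⟨t20, t21, t22, t46⟩, y20, y21, y22, y23, y36, y37, y38⟩ := ht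
  refine Good.seq (Ends.comp (Ends.loop_const K 5 (fun i t' => t'.nr 46 = 2 ^ i ∧
    t'.xr 36 = i) ⟨t46, y36⟩ ?_ ?_) fun t1 hF ht1 => ?_)
  · rintro i t1 hi hF ⟨u46, w36⟩
    refine ⟨?_, Good.blk (T := 0) rfl (Good.nil ?_ 0)⟩
    · rw [Test.holds, u46, (hF.nr 20 rfl).trans t20]
      exact (Nat.lt_clog_iff_pow_lt one_lt_two).1 hi
    · simp [u46, w36, (hF.xr 22 rfl).trans y22, pow_succ, mul_two]
  · rintro t1 hF ⟨u46, -⟩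
    rw [Test.holds, u46, (hF.nr 20 rfl).trans t20, not_lt]
    exact Nat.le_pow_clog one_lt_two n
  have u36 : t1.xr 36 = K := ht1.2
  replace t20 := (hF.nr 20 rfl).trans t20
  replace t21 := (hF.nr 21 rfl).trans t21
  replace t22 := (hF.nr 22 rfl).trans t22
  replace y20 := (hF.xr 20 rfl).trans y20
  replace y21 := (hF.xr 21 rfl).trans y21
  replace y22 := (hF.xr 22 rfl).trans y22
  replace y23 := (hF.xr 23 rfl).trans y23
  replace y37 := (hF.xr 37 rfl).trans y37
  replace y38 := (hF.xr 38 rfl).trans y38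
  clear hF ht1 y36
  have hdbl : ∀ i : ℕ, 2 ^ i * ε < 1 ↔ i < e := by
    intro i
    rw [he, doublings, Nat.lt_ceil, Real.lt_logb_iff_rpow_lt one_lt_two (inv_pos.2 hε0),
      Real.rpow_natCast, lt_inv_comm₀ (by positivity) hε0, ← one_div, lt_div_iff₀ (by positivity),
      mul_comm]
  refine Good.seq (Ends.comp (Ends.loop_const e 5 (fun i t' => t'.xr 38 = 2 ^ i * ε ∧
    t'.xr 37 = i + 1) ⟨y38, y37⟩ ?_ ?_) fun t2 hF ht2 => ?_)
  · rintro i t1 hi hF ⟨w38, w37⟩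
    refine ⟨?_, Good.blk (T := 0) rfl (Good.nil ?_ 0)⟩
    · rw [Test.holds, w38, (hF.xr 22 rfl).trans y22]
      exact (hdbl i).2 hi
    · simp [w38, w37, (hF.xr 22 rfl).trans y22, pow_succ]
      ring
  · rintro t1 hF ⟨w38, -⟩
    rw [Test.holds, w38, (hF.xr 22 rfl).trans y22, hdbl]
    exact lt_irrefl _
  have w37 : t2.xr 37 = e + 1 := ht2.2
  replace t20 := (hF.nr 20 rfl).trans t20
  replace t21 := (hF.nr 21 rfl).trans t21
  replace t22 := (hF.nr 22 rfl).trans t22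
  replace y20 := (hF.xr 20 rfl).trans y20
  replace y21 := (hF.xr 21 rfl).trans y21
  replace y22 := (hF.xr 22 rfl).trans y22
  replace y23 := (hF.xr 23 rfl).trans y23
  replace u36 := (hF.xr 36 rfl).trans u36
  clear hF ht2 y37 y38
  refine Good.seq (Good.blk_then (fun t => t.xr 39 = 2 * (e + 1) / ν ∧ t.nr 36 = 0 ∧
    t.xr 40 = (0 : ℕ)) rfl (by simp [w37, y21]; ring) fun t3 hF ht3 => ?_)
  obtain ⟨y39, t36, y40⟩ := ht3
  replace t20 := (hF.nr 20 rfl).trans t20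
  replace t21 := (hF.nr 21 rfl).trans t21
  replace t22 := (hF.nr 22 rfl).trans t22
  replace y20 := (hF.xr 20 rfl).trans y20
  replace y22 := (hF.xr 22 rfl).trans y22
  replace y23 := (hF.xr 23 rfl).trans y23
  replace u36 := (hF.xr 36 rfl).trans u36
  clear hF y21
  refine Good.seq (Ends.comp (Ends.loop_const ℓ 5 (fun i t' => t'.nr 36 = i ∧
    t'.xr 40 = i) ⟨t36, y40⟩ ?_ ?_) fun t4 hF ht4 => ?_)
  · rintro i t1 hi hF ⟨w36, w40⟩
    refine ⟨?_, Good.blk (T := 0) rfl (Good.nil ?_ 0)⟩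
    · rw [Test.holds, w40, (hF.xr 39 rfl).trans y39]
      exact Nat.lt_ceil.1 hi
    · simp [w36, (hF.nr 21 rfl).trans t21]
  · rintro t1 hF ⟨-, w40⟩
    rw [Test.holds, w40, (hF.xr 39 rfl).trans y39, not_lt]
    exact Nat.le_ceil _
  obtain ⟨v36, w40⟩ := ht4
  replace t20 := (hF.nr 20 rfl).trans t20
  replace t21 := (hF.nr 21 rfl).trans t21
  replace t22 := (hF.nr 22 rfl).trans t22
  replace y20 := (hF.xr 20 rfl).trans y20
  replace y22 := (hF.xr 22 rfl).trans y22
  replace y23 := (hF.xr 23 rfl).trans y23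
  replace u36 := (hF.xr 36 rfl).trans u36
  clear hF t36 y40 y39
  refine Good.seq (Good.blk_then (fun t => t.xr 41 = (ℓ / ε) ^ 2 * K * (256 * (c + 3)) ∧
    t.nr 37 = 0 ∧ t.xr 43 = (0 : ℕ)) rfl (by
      simp [w40, y20, u36]
      exact Or.inl (Or.inl (by ring))) fun t5 hF ht5 => ?_)
  obtain ⟨y41, t37, y43⟩ := ht5
  replace t20 := (hF.nr 20 rfl).trans t20
  replace t21 := (hF.nr 21 rfl).trans t21
  replace t22 := (hF.nr 22 rfl).trans t22
  replace y20 := (hF.xr 20 rfl).trans y20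
  replace y22 := (hF.xr 22 rfl).trans y22
  replace y23 := (hF.xr 23 rfl).trans y23
  replace v36 := (hF.nr 36 rfl).trans v36
  clear hF u36 w40
  refine Good.seq (Ends.comp (T' := 17) (Ends.loop_const r 5 (fun i t' => t'.nr 37 = i ∧
    t'.xr 43 = i) ⟨t37, y43⟩ ?_ ?_) fun t6 hF ht6 => ?_)
  · rintro i t1 hi hF ⟨w36, w40⟩
    refine ⟨?_, Good.blk (T := 0) rfl (Good.nil ?_ 0)⟩
    · rw [Test.holds, w40, (hF.xr 41 rfl).trans y41]
      exact Nat.lt_ceil.1 hi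
    · simp [w36, (hF.nr 21 rfl).trans t21]
  · rintro t1 hF ⟨-, w40⟩
    rw [Test.holds, w40, (hF.xr 41 rfl).trans y41, not_lt]
    exact Nat.le_ceil _
  obtain ⟨u37, w43⟩ := ht6
  replace t20 := (hF.nr 20 rfl).trans t20
  replace t21 := (hF.nr 21 rfl).trans t21
  replace t22 := (hF.nr 22 rfl).trans t22
  replace y20 := (hF.xr 20 rfl).trans y20
  replace y22 := (hF.xr 22 rfl).trans y22
  replace y23 := (hF.xr 23 rfl).trans y23
  replace v36 := (hF.nr 36 rfl).trans v36
  refine Good.blk (T := 0) rfl (Good.nil ?_ 0)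
  simp [t20, t21, t22, y20, y22, y23, v36, u37, w43]
  ring

/-! ### The sketch -/

/-- The program that computes the sketch. -/
def sketch (c : ℕ) : Prog := .seq (params c) (.seq allAlias allRows)

/-- A bound for the number of steps of `sketch`. -/
def sketchSteps (K e ℓ r n m : ℕ) : ℕ :=
  6 * (K + e + ℓ + r) + 200 * m + 45 * n + n * (r * (81 * ℓ + 13) + 49 * r + 41) + 120

theorem sketch_good {n c : ℕ} {G : WGraph n} {hd : ∀ u, 0 < G.deg u} {ε ν : ℝ} {a : ℕ → ℕ}
    {b : ℕ → ℝ} (hab : StoresInput G ε ν a b) (hε0 : 0 < ε) {ℓ r : ℕ} (hℓ : walkLen ε ν = ℓ)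
    (hr : numWalks c n ε ν = r) (hr0 : 0 < r)
    (hk : ∀ k : ℕ, k * (r * ε / 8) ≤ (r * ℓ : ℕ) → k * k ≤ r) :
    Good [sketch c] (startState a b)
      (sketchSteps (Nat.clog 2 n) (doublings ε) ℓ r n G.numEdges) (G.tablePMF hd ℓ r)
      (fun cs t => StoresSketch G.deg (fun u => sparse (r * ε / 8) (2 * r) (cs u)) t ∧
        t.na 0 = a) := by
  have hr1 : (0 : ℝ) < r := Nat.cast_pos.2 hr0
  -- The input array is intact by the frame rule; a batch still has to read the queried pairs from
  -- it.
  suffices H : Good [sketch c] (startState a b)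
      (sketchSteps (Nat.clog 2 n) (doublings ε) ℓ r n G.numEdges) (G.tablePMF hd ℓ r)
      (fun cs t => StoresSketch G.deg (fun u => sparse (r * ε / 8) (2 * r) (cs u)) t) from
    H.frame.mono fun cs t h => ⟨h.1, by rw [h.2.na 0 rfl]; simp [startState]⟩
  refine Good.mono_time (T := 6 * (Nat.clog 2 n + doublings ε + ℓ + r) + 100 + (200 * G.numEdges +
    45 * n + 5 + (5 + (∑ _l ∈ Finset.range n, (r * (81 * ℓ + 13) + 49 * r + 40 + 1) + 1) + 1) + 1)
    + 1) ?_
    (by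
      simp only [Finset.sum_const, Finset.card_range, smul_eq_mul, sketchSteps, Nat.add_assoc,
        Nat.reduceAdd]
      omega)
  refine Good.seq (Ends.comp (by
    have := params_ends (c := c) (s := startState a b) (n := n) (ε := ε) (ν := ν)
      (by simp [startState, hab.rows.size]) (by simp [startState, hab.eps])
      (by simp [startState, hab.gap]) hε0
    rwa [hℓ, hr] at this) fun t hF ht => ?_)
  obtain ⟨⟨t20, t21, t22, t36, t37, t39⟩, ⟨y22, y23, y33, y34⟩, t10, t11⟩ := ht
  have t0 : t.na 0 = a := by rw [hF.na 0 rfl]; simp [startState]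
  have y0 : t.xa 0 = b := by rw [hF.xa 0 rfl]; simp [startState]
  have y3 : t.xa 3 = 0 := by rw [hF.xa 3 rfl]; funext i; simp [startState]
  clear hF
  refine Good.seq (Ends.comp (allAlias_ends hd t20 t21 t22 y22 (by rw [t0, y0]; exact hab.rows))
    fun t1 hF ht1 => ?_)
  obtain ⟨hT, hdeg⟩ := ht1
  refine Good.seq (Good.blk_then (fun t => t.nr 23 = 0 ∧ t.nr 34 = 0) rfl (by simp)
    fun t2 hF2 ht2 => ?_)
  obtain ⟨u23, u34⟩ := ht2
  refine Good.mono (Good.loop n (κ := G.tableStep hd ℓ r) (RowsInv G ℓ r (r * ε / 8)) ?_ ?_ ?_)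
    fun cs t h => h.sketch
  · refine ⟨⟨hT.congr (hF2.na 0 rfl) (hF2.xa 0 rfl) (hF2.xa 5 rfl) (hF2.na 5 rfl), ?_, ?_, ?_, ?_,
      ?_, ?_, ?_, ?_⟩, ?_, ?_, ?_, ?_, ?_, ?_, ?_, ?_, ?_, ?_⟩
    · rw [hF2.nr 21 rfl, hF.nr 21 rfl, t21]
    · rw [hF2.nr 22 rfl, hF.nr 22 rfl, t22]
    · rw [u34, zero_mul]
    · rw [hF2.nr 36 rfl, hF.nr 36 rfl, t36]
    · rw [hF2.nr 37 rfl, hF.nr 37 rfl, t37]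
    · rw [hF2.xr 22 rfl, hF.xr 22 rfl, y22]
    · rw [hF2.xr 23 rfl, hF.xr 23 rfl, y23]
    · rw [hF2.xr 33 rfl, hF.xr 33 rfl, y33]
    · rw [hF2.nr 20 rfl, hF.nr 20 rfl, t20]
    · exact u23
    · rw [hF2.xr 34 rfl, hF.xr 34 rfl, y34]
    · rw [hF2.nr 39 rfl, hF.nr 39 rfl, t39]
    · rw [hF2.na 1 rfl, hF.na 1 rfl, t10]
    · rw [hF2.na 1 rfl, hF.na 1 rfl, t11]
    · rw [hF2.na 1 rfl, hF.na 1 rfl, hF2.nr 39 rfl, hF.nr 39 rfl, t39, zero_add, t11]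
    · exact fun u hu => absurd hu (by omega)
    · intro u; rw [hF2.xa 1 rfl, hdeg]
    · intro j _; rw [hF2.xa 3 rfl, hF.xa 3 rfl, y3]; rfl
  · intro i cs t' hi hF' hI
    exact ⟨by rw [Test.holds, hI.row, hI.size]; exact hi,
      rowProg_good hI hi hr0 (by positivity) hk⟩
  · intro cs t' hF' hI
    rw [Test.holds, hI.row, hI.size]
    exact lt_irrefl _

/-! ### Batches of queries -/

/-- The program that answers a list of queries. -/
def batch (c : ℕ) : Prog :=
  .seq (sketch c) <|
  .seq (blk [.nconst 51 1, .nconst 52 0, .nload 53 0 52, .nadd 53 53 51, .nload 54 0 53,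
    .nload 55 0 54, .nadd 54 54 51, .nconst 56 0]) <|
  .seq (.loop (.nlt 56 55) (.seq (blk [.nload 0 0 54, .nadd 54 54 51, .nload 1 0 54,
    .nadd 54 54 51]) (.seq query (blk [.xstore 7 56 0, .nadd 56 56 51])))) <|
  .seq (blk [.nconst 56 0]) <|
  .loop (.nlt 56 55) (blk [.xload 0 7 56, .xstore 1 56 0, .nadd 56 56 51])

/-- Given the table, the rest is deterministic, so the coupling with μ persists. Answers are
collected in array 7, because array 1 holds the sketch until the last query, and are copied at the
end. -/
theorem batch_good {n c s N : ℕ} {α : Type} {μ : PMF α} {d : Fin n → ℝ}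
    {σ : α → Fin n → Fin n → ℝ} {q : Fin s → Fin n × Fin n} {a : ℕ → ℕ} {b : ℕ → ℝ}
    (h0 : a 0 = n) (hq : StoresPairs n s q a)
    (h : Good [sketch c] (startState a b) N μ
      (fun x t => StoresSketch d (σ x) t ∧ t.na 0 = a)) :
    Good [batch c] (startState a b) (N + 30 + s * (160 * Nat.size n + 330)) μ
      (fun x t => ∀ i : Fin s, t.xa 1 i = estimate d (σ x) (q i).1 (q i).2) := by
  refine Good.mono_time (T := N + (17 + (s * (160 * Nat.size n + 316 + 1) + 1 +
    (3 + (s * (7 + 1) + 1) + 1) + 1) + 1) + 1) ?_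
    (by simp only [Nat.mul_add]; omega)
  have hμ : μ = μ.bind PMF.pure := (PMF.bind_pure μ).symm
  rw [hμ]
  refine Good.seq (Good.comp h fun x t _ ht => ?_)
  have hpure : (PMF.pure x : PMF α) = (PMF.pure ()).map fun _ => x := by rw [PMF.pure_map]
  rw [hpure]
  refine Good.map (Q := fun _ t => ∀ i : Fin s, t.xa 1 i = estimate d (σ x) (q i).1 (q i).2) ?_ _
    fun _ _ h => h
  obtain ⟨hS, ht0⟩ := ht
  refine Good.seq (Good.blk_then (fun t => t.nr 51 = 1 ∧ t.nr 54 = a (n + 1) + 1 ∧ t.nr 55 = s ∧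
    t.nr 56 = 0) rfl (by simp [ht0, h0, hq.count]) fun t1 hF1 ht1 => ?_)
  obtain ⟨u51, u54, u55, u56⟩ := ht1
  have u0 := (hF1.na 0 rfl).trans ht0
  have uS := hS.congr (hF1.na 1 rfl) (hF1.xa 1 rfl)
  refine Good.seq (Ends.comp (Ends.loop_const s (160 * Nat.size n + 316) (fun i t' =>
    t'.nr 56 = i ∧ t'.nr 54 = a (n + 1) + 1 + 2 * i ∧
    ∀ j : Fin s, j.1 < i → t'.xa 7 j = estimate d (σ x) (q j).1 (q j).2)
    ⟨u56, u54, fun j hj => absurd hj (by omega)⟩ ?_ ?_) fun t2 hF2 ht2 => ?_)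
  · rintro i t2 hi hF2 ⟨v56, v54, hdone⟩
    have v51 := (hF2.nr 51 rfl).trans u51
    have v0 := (hF2.na 0 rfl).trans u0
    have vS := uS.congr (hF2.na 1 rfl) (hF2.xa 1 rfl)
    refine ⟨by rw [Test.holds, v56, (hF2.nr 55 rfl).trans u55]; exact hi, ?_⟩
    refine Good.mono_time (T := 9 + (160 * Nat.size n + 300 + 5 + 1) + 1) ?_ (by omega)
    refine Good.seq (Good.blk_then (fun t => t.nr 0 = (q ⟨i, hi⟩).1 ∧ t.nr 1 = (q ⟨i, hi⟩).2 ∧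
      t.nr 54 = a (n + 1) + 1 + 2 * (i + 1)) rfl ?_ fun t3 hF3 ht3 => ?_)
    · have h1 := hq.left ⟨i, hi⟩
      have h2 := hq.right ⟨i, hi⟩
      simp only [List.foldl, Instr.det, State.setN_nr, State.setN_na, v0, v54, v51]
      refine ⟨by simpa using h1, ?_, ?_⟩
      · simp only [Nat.reduceEqDiff, if_true, if_false, ← h2]
        congr 1
        omega
      · simp
        omega
    obtain ⟨w0, w1, w54⟩ := ht3
    have wS := vS.congr (hF3.na 1 rfl) (hF3.xa 1 rfl)
    refine Good.seq (Ends.comp (T' := 5) (query_ends wS w0 w1) fun t4 hF4 ht4 => ?_)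
    refine Good.blk (T := 0) rfl (Good.nil ?_ 0)
    have z56 := (hF4.nr 56 rfl).trans ((hF3.nr 56 rfl).trans v56)
    have z51 := (hF4.nr 51 rfl).trans ((hF3.nr 51 rfl).trans v51)
    have z54 := (hF4.nr 54 rfl).trans w54
    have z7 := (hF4.xa 7 rfl).trans (hF3.xa 7 rfl)
    simp only [List.foldl, Instr.det, State.setN_nr, State.putX_nr, State.setN_xa, State.putX_xa,
      z56, z51, z54, ht4, z7]
    refine ⟨by simp, by simp, fun j hj => ?_⟩
    simp only [if_true]
    by_cases hji : j.1 = i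
    · rw [hji, Function.update_self]
      obtain rfl : j = ⟨i, hi⟩ := Fin.ext hji
      rfl
    · rw [Function.update_of_ne hji]
      exact hdone j (by omega)
  · rintro t2 hF2 ⟨v56, -⟩
    rw [Test.holds, v56, (hF2.nr 55 rfl).trans u55]
    exact lt_irrefl _
  obtain ⟨-, -, hdone⟩ := ht2
  refine Good.seq (Good.blk_then (fun t => t.nr 56 = 0) rfl (by simp) fun t3 hF3 v56 => ?_)
  have v51 := (hF3.nr 51 rfl).trans ((hF2.nr 51 rfl).trans u51)
  have v55 := (hF3.nr 55 rfl).trans ((hF2.nr 55 rfl).trans u55)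
  have v7 := hF3.xa 7 rfl
  refine Good.mono (Ends.loop_const s 7 (fun i t' => t'.nr 56 = i ∧ ∀ j : Fin s, j.1 < i →
    t'.xa 1 j = estimate d (σ x) (q j).1 (q j).2) ⟨v56, fun j hj => absurd hj (by omega)⟩ ?_ ?_)
    fun _ t h i => h.2 i i.2
  · rintro i t4 hi hF4 ⟨w56, hj⟩
    refine ⟨by rw [Test.holds, w56, (hF4.nr 55 rfl).trans v55]; exact hi, ?_⟩
    refine Good.blk (T := 0) rfl (Good.nil ?_ 0)
    have w7 := (hF4.xa 7 rfl).trans v7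
    simp only [List.foldl, Instr.det, State.setN_nr, State.putX_nr, State.setN_xa, State.putX_xa,
      State.setX_nr, State.setX_xa, State.setX_xr, w56, (hF4.nr 51 rfl).trans v51, w7]
    refine ⟨by simp, fun j hji => ?_⟩
    simp only [if_true]
    by_cases hj' : j.1 = i
    · rw [← hj', Function.update_self]
      exact hdone j j.2
    · rw [Function.update_of_ne hj']
      exact hj j (by omega)
  · rintro t4 hF4 ⟨w56, -⟩
    rw [Test.holds, w56, (hF4.nr 55 rfl).trans v55]
    exact lt_irrefl _

/-! ### Estimates for the parameters -/

section bounds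

variable {n c : ℕ} {W ε ν : ℝ}

theorem log_two_le_log (hn : 2 ≤ n) : Real.log 2 ≤ Real.log n :=
  Real.log_le_log two_pos (by exact_mod_cast hn)

/-- Since log n ≥ log 2, both k - 1 and 1 are at most log n / log 2, and 2 / log 2 < 3. -/
theorem le_three_mul_log (hn : 2 ≤ n) {k : ℕ} (hk : 2 ^ (k - 1) ≤ n) : (k : ℝ) ≤ 3 * Real.log n := by
  have h1 := log_two_le_log hn
  have h2 := Real.log_two_gt_d9
  have h3 : ((k - 1 : ℕ) : ℝ) * Real.log 2 ≤ Real.log n := by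
    rw [← Real.log_pow]
    exact Real.log_le_log (by positivity) (by exact_mod_cast hk)
  have h4 : (k : ℝ) ≤ (k - 1 : ℕ) + 1 := by
    have : k ≤ k - 1 + 1 := by omega
    exact_mod_cast this
  nlinarith [Nat.cast_nonneg (α := ℝ) (k - 1)]

theorem size_le_log (hn : 2 ≤ n) : (Nat.size n : ℝ) ≤ 3 * Real.log n := by
  refine le_three_mul_log hn ?_
  have : 0 < Nat.size n := Nat.size_pos.2 (by omega)
  exact Nat.lt_size.1 (by omega)

theorem clog_le_log (hn : 2 ≤ n) : (Nat.clog 2 n : ℝ) ≤ 3 * Real.log n := by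
  refine le_three_mul_log hn ?_
  have : 0 < Nat.clog 2 n := Nat.clog_pos one_lt_two hn
  exact ((Nat.lt_clog_iff_pow_lt one_lt_two).1 (by omega)).le

theorem log_le_clog : Real.log n ≤ Nat.clog 2 n := by
  rcases Nat.eq_zero_or_pos n with rfl | hn
  · simp
  have h1 : Real.log n ≤ Nat.clog 2 n * Real.log 2 := by
    rw [← Real.log_pow]
    exact Real.log_le_log (Nat.cast_pos.2 hn) (by exact_mod_cast Nat.le_pow_clog one_lt_two n)
  have h2 := Real.log_two_lt_d9
  nlinarith [Nat.cast_nonneg (α := ℝ) (Nat.clog 2 n)]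

theorem log_mul_div (hn : 2 ≤ n) (hW : 1 ≤ W) (hε : 0 < ε) :
    Real.log (n * W / ε) = Real.log (n * W) + Real.log ε⁻¹ := by
  have hn' : (0 : ℝ) < n := by exact_mod_cast (by omega : 0 < n)
  rw [div_eq_mul_inv, Real.log_mul (by positivity) (by positivity)]

theorem log_le_log_mul (hn : 2 ≤ n) (hW : 1 ≤ W) : Real.log n ≤ Real.log (n * W) := by
  have hn' : (0 : ℝ) < n := by exact_mod_cast (by omega : 0 < n)
  exact Real.log_le_log hn' (le_mul_of_one_le_right hn'.le hW)

theorem log_inv_nonneg (hε : 0 < ε) (hε1 : ε ≤ 1) : 0 ≤ Real.log ε⁻¹ :=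
  Real.log_nonneg ((one_le_inv₀ hε).2 hε1)

theorem doublings_le (hn : 2 ≤ n) (hW : 1 ≤ W) (hε : 0 < ε) (hε1 : ε ≤ 1) :
    (doublings ε + 1 : ℝ) ≤ 3 * Real.log (n * W / ε) := by
  have h0 := log_inv_nonneg hε hε1
  have h1 := log_two_le_log hn
  have h2 := Real.log_two_gt_d9
  have h3 := log_le_log_mul hn hW
  have h4 : (doublings ε : ℝ) < Real.logb 2 ε⁻¹ + 1 :=
    Nat.ceil_lt_add_one (Real.logb_nonneg one_lt_two ((one_le_inv₀ hε).2 hε1))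
  have h5 : Real.logb 2 ε⁻¹ * Real.log 2 = Real.log ε⁻¹ := by
    rw [Real.logb, div_mul_cancel₀ _ (by linarith)]
  rw [log_mul_div hn hW hε]
  nlinarith

theorem walkLen_ge (hν : 0 < ν) (hν2 : ν ≤ 2) : doublings ε + 1 ≤ walkLen ε ν := by
  have : (doublings ε + 1 : ℝ) ≤ walkLen ε ν := by
    refine le_trans ?_ (Nat.le_ceil _)
    rw [le_div_iff₀ hν]
    nlinarith [Nat.cast_nonneg (α := ℝ) (doublings ε)]
  exact_mod_cast this

theorem walkLen_le (hn : 2 ≤ n) (hW : 1 ≤ W) (hε : 0 < ε) (hε1 : ε ≤ 1) (hν : 0 < ν)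
    (hν2 : ν ≤ 2) : (walkLen ε ν : ℝ) ≤ 9 * Real.log (n * W / ε) / ν := by
  have h0 := log_inv_nonneg hε hε1
  have h1 := log_two_le_log hn
  have h2 := Real.log_two_gt_d9
  have h3 := log_le_log_mul hn hW
  have h4 := doublings_le hn hW hε hε1
  have h5 : (walkLen ε ν : ℝ) < 2 * (doublings ε + 1) / ν + 1 := Nat.ceil_lt_add_one (by positivity)
  refine h5.le.trans ?_
  rw [div_add_one hν.ne', div_le_div_iff_of_pos_right hν]
  have h6 : 2 ≤ 3 * Real.log (n * W / ε) := by
    rw [log_mul_div hn hW hε]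
    linarith
  linarith

/-- (1 - ν/2)^ℓ ≤ e^{-νℓ/2} ≤ e^{-(e+1)} ≤ 2^{-(e+1)} ≤ ε/2, where e in the exponents is the number
of doublings. -/
theorem pow_walkLen_le (hε : 0 < ε) (hν : 0 < ν) (hν2 : ν ≤ 2) :
    (1 - ν / 2) ^ walkLen ε ν ≤ ε / 2 := by
  have h1 : (1 - ν / 2) ^ walkLen ε ν ≤ Real.exp (-(ν / 2)) ^ walkLen ε ν := by
    refine pow_le_pow_left₀ (by linarith) ?_ _
    have := Real.add_one_le_exp (-(ν / 2))
    linarith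
  refine h1.trans ?_
  rw [← Real.exp_nat_mul]
  have h2 : (doublings ε + 1 : ℝ) ≤ walkLen ε ν * (ν / 2) := by
    have : 2 * (doublings ε + 1) / ν ≤ (walkLen ε ν : ℝ) := Nat.le_ceil _
    rw [div_le_iff₀ hν] at this
    linarith
  have h3 : Real.logb 2 ε⁻¹ ≤ doublings ε := Nat.le_ceil _
  have h4 := Real.log_two_lt_d9
  have h4' := Real.log_two_gt_d9
  have h5 : Real.log ε⁻¹ ≤ doublings ε * Real.log 2 := by
    rwa [Real.logb, div_le_iff₀ (by linarith)] at h3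
  rw [← Real.le_log_iff_exp_le (by positivity), Real.log_div hε.ne' two_ne_zero]
  rw [Real.log_inv] at h5
  nlinarith [Nat.cast_nonneg (α := ℝ) (doublings ε)]

theorem le_numWalks : (walkLen ε ν / ε) ^ 2 * Nat.clog 2 n * (256 * (c + 3)) ≤ numWalks c n ε ν :=
  Nat.le_ceil _

/-- Here (ℓ/ε)² ≥ 1 because ε ≤ 1 ≤ ℓ. Consequently rounding up at most doubles the number of walks,
and the loop computing log n is negligible. -/
theorem clog_le_numWalks (hε : 0 < ε) (hε1 : ε ≤ 1) (hν : 0 < ν) (hν2 : ν ≤ 2) :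
    256 * (Nat.clog 2 n : ℝ) ≤
      (walkLen ε ν / ε) ^ 2 * Nat.clog 2 n * (256 * (c + 3)) := by
  have h1 : (1 : ℝ) ≤ walkLen ε ν := by
    have := walkLen_ge (ε := ε) hν hν2
    exact_mod_cast (by omega : 1 ≤ walkLen ε ν)
  have h2 : (1 : ℝ) ≤ (walkLen ε ν / ε) ^ 2 :=
    one_le_pow₀ ((one_le_div hε).2 (hε1.trans h1))
  have h3 : (0 : ℝ) ≤ Nat.clog 2 n := Nat.cast_nonneg _
  have h4 : (0 : ℝ) ≤ c := Nat.cast_nonneg _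
  have h5 : (Nat.clog 2 n : ℝ) ≤ (walkLen ε ν / ε) ^ 2 * Nat.clog 2 n :=
    le_mul_of_one_le_left h3 h2
  nlinarith

theorem one_le_clog (hn : 2 ≤ n) : (1 : ℝ) ≤ Nat.clog 2 n := by
  exact_mod_cast Nat.clog_pos one_lt_two hn

theorem numWalks_pos (hn : 2 ≤ n) (hε : 0 < ε) (hε1 : ε ≤ 1) (hν : 0 < ν) (hν2 : ν ≤ 2) :
    Nat.clog 2 n ≤ numWalks c n ε ν ∧ 0 < numWalks c n ε ν := by
  have h1 := one_le_clog hn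
  have h2 := (clog_le_numWalks (c := c) (n := n) hε hε1 hν hν2).trans le_numWalks
  have h3 : (Nat.clog 2 n : ℝ) ≤ numWalks c n ε ν := by linarith
  have h4 : (0 : ℝ) < numWalks c n ε ν := by linarith
  exact ⟨by exact_mod_cast h3, by exact_mod_cast h4⟩

theorem numWalks_le (hn : 2 ≤ n) (hε : 0 < ε) (hε1 : ε ≤ 1) (hν : 0 < ν) (hν2 : ν ≤ 2) :
    (numWalks c n ε ν : ℝ) ≤
      2 * ((walkLen ε ν / ε) ^ 2 * Nat.clog 2 n * (256 * (c + 3))) := by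
  have h1 := one_le_clog hn
  have h2 := clog_le_numWalks (c := c) (n := n) hε hε1 hν hν2
  have h3 : (numWalks c n ε ν : ℝ) < _ + 1 := Nat.ceil_lt_add_one (by linarith)
  linarith

theorem log_le_numWalks :
    256 * (c + 3) * Real.log n * walkLen ε ν ^ 2 / ε ^ 2 ≤ numWalks c n ε ν := by
  refine le_trans ?_ le_numWalks
  have h := log_le_clog (n := n)
  have h0 : 0 ≤ ((walkLen ε ν : ℝ) / ε) ^ 2 * (256 * (c + 3)) := by positivity
  calc 256 * (c + 3) * Real.log n * walkLen ε ν ^ 2 / ε ^ 2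
      = (walkLen ε ν / ε) ^ 2 * (256 * (c + 3)) * Real.log n := by rw [div_pow]; ring
    _ ≤ (walkLen ε ν / ε) ^ 2 * (256 * (c + 3)) * Nat.clog 2 n :=
        mul_le_mul_of_nonneg_left h h0
    _ = _ := by ring

theorem le_of_mul_threshold_le (hε : 0 < ε) {k ℓ r : ℕ} (hr : 0 < r)
    (hk : (k : ℝ) * (r * ε / 8) ≤ (r * ℓ : ℕ)) : (k : ℝ) ≤ 8 * (ℓ / ε) := by
  have hr' : (0 : ℝ) < r := Nat.cast_pos.2 hr
  push_cast at hk
  rw [← mul_div_assoc, le_div_iff₀ hε]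
  nlinarith

/-- k² ≤ 64(ℓ/ε)², while r has the larger factor 256(c + 3). This makes sorting a row no more
expensive than sampling it. -/
theorem mul_self_le_numWalks (hn : 2 ≤ n) {k : ℕ}
    (hk : (k : ℝ) ≤ 8 * (walkLen ε ν / ε)) : k * k ≤ numWalks c n ε ν := by
  have h1 := one_le_clog hn
  have h2 : (k : ℝ) * k ≤ 64 * (walkLen ε ν / ε) ^ 2 := by
    calc (k : ℝ) * k ≤ 8 * (walkLen ε ν / ε) * (8 * (walkLen ε ν / ε)) :=
          mul_self_le_mul_self (Nat.cast_nonneg _) hk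
      _ = _ := by ring
  have h3 : (0 : ℝ) ≤ (walkLen ε ν / ε) ^ 2 := by positivity
  have h4 : ((k * k : ℕ) : ℝ) ≤ numWalks c n ε ν := by
    refine le_trans ?_ le_numWalks
    push_cast
    have h5 : ((walkLen ε ν : ℝ) / ε) ^ 2 ≤ (walkLen ε ν / ε) ^ 2 * Nat.clog 2 n :=
      le_mul_of_one_le_right h3 h1
    have h6 : (0 : ℝ) ≤ (walkLen ε ν / ε) ^ 2 * Nat.clog 2 n * c := by positivity
    nlinarith
  exact_mod_cast h4

theorem sketchSteps_le {K e ℓ r m : ℕ} (hn : 2 ≤ n) (hK : K ≤ r) (he : e + 1 ≤ ℓ) (hr : 0 < r) :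
    sketchSteps K e ℓ r n m + 30 ≤ 500 * (m + n * (r * ℓ)) := by
  have h1 : r ≤ r * ℓ := Nat.le_mul_of_pos_right r (by omega)
  have h2 : ℓ ≤ r * ℓ := Nat.le_mul_of_pos_left ℓ hr
  have h3 : 2 * (r * ℓ) ≤ n * (r * ℓ) := Nat.mul_le_mul_right _ hn
  have h4 : n * 1 ≤ n * (r * ℓ) := Nat.mul_le_mul_left n (by omega)
  have h5 : n * r ≤ n * (r * ℓ) := Nat.mul_le_mul_left n h1
  have h6 : n * (r * (81 * ℓ + 13) + 49 * r + 41) = 81 * (n * (r * ℓ)) + 62 * (n * r) + 41 * n := by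
    ring
  rw [sketchSteps, h6]
  omega

/-- The constant in the running times. -/
def timeConst (c : ℕ) : ℝ := 500 * 1119744 * (c + 3)

theorem timeConst_ge : 1000000 ≤ timeConst c := by
  have : (0 : ℝ) ≤ c := Nat.cast_nonneg _
  rw [timeConst]
  linarith

theorem sketchTime_ge {m : ℕ} (hn : 2 ≤ n) (hW : 1 ≤ W) (hε : 0 < ε) (hε1 : ε ≤ 1) (hν : 0 < ν)
    (hν2 : ν ≤ 2) :
    ((sketchSteps (Nat.clog 2 n) (doublings ε) (walkLen ε ν) (numWalks c n ε ν) n m + 30 : ℕ) : ℝ)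
      ≤ timeConst c * sketchTime n m W ε ν := by
  obtain ⟨h1, h2⟩ := numWalks_pos (c := c) hn hε hε1 hν hν2
  have h3 : ((sketchSteps (Nat.clog 2 n) (doublings ε) (walkLen ε ν) (numWalks c n ε ν) n m + 30 : ℕ)
      : ℝ) ≤ (500 * (m + n * (numWalks c n ε ν * walkLen ε ν)) : ℕ) :=
    Nat.cast_le.2 (sketchSteps_le hn h1 (walkLen_ge hν hν2) h2)
  refine h3.trans ?_
  have h4 := numWalks_le (c := c) hn hε hε1 hν hν2
  have h5 := walkLen_le hn hW hε hε1 hν hν2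
  have h6 := clog_le_log hn
  set Λ := Real.log (n * W / ε)
  have hc : (0 : ℝ) ≤ c := Nat.cast_nonneg _
  have hlog : 0 ≤ Real.log n := Real.log_natCast_nonneg n
  -- The constant is 512 · 9³ · 3: twice 256 from the number of walks, 9 from each factor ℓ, 3 from
  -- the rounded logarithm.
  have h7 : (numWalks c n ε ν * walkLen ε ν : ℝ) ≤
      1119744 * (c + 3) * ((ε ^ 2)⁻¹ * (ν ^ 3)⁻¹ * Real.log n * Λ ^ 3) := by
    calc (numWalks c n ε ν * walkLen ε ν : ℝ)
        ≤ 2 * ((walkLen ε ν / ε) ^ 2 * Nat.clog 2 n * (256 * (c + 3))) * walkLen ε ν :=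
          mul_le_mul_of_nonneg_right h4 (Nat.cast_nonneg _)
      _ = 512 * (c + 3) * (ε ^ 2)⁻¹ * ((walkLen ε ν) ^ 3 * Nat.clog 2 n) := by
          rw [div_pow, div_eq_mul_inv]; ring
      _ ≤ 512 * (c + 3) * (ε ^ 2)⁻¹ * ((9 * Λ / ν) ^ 3 * (3 * Real.log n)) := by
          have : (0 : ℝ) ≤ 9 * Λ / ν := (Nat.cast_nonneg _).trans h5
          gcongr
      _ = _ := by rw [div_pow, div_eq_mul_inv]; ring
  rw [sketchTime, timeConst]
  push_cast
  have h8 : (n : ℝ) * (numWalks c n ε ν * walkLen ε ν) ≤ n * (1119744 * (c + 3) *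
      ((ε ^ 2)⁻¹ * (ν ^ 3)⁻¹ * Real.log n * Λ ^ 3)) :=
    mul_le_mul_of_nonneg_left h7 (Nat.cast_nonneg _)
  have h9 : (0 : ℝ) ≤ m * (c + 2) := by positivity
  have h10 : (0 : ℝ) ≤ m := Nat.cast_nonneg _
  nlinarith

/-- The bound 8ℓ/ε involves log(nW/ε). If 1/ε ≤ n, then log(1/ε) ≤ log(nW) and the constant is 8 · 9
· 2; if 1/ε ≥ n, the trivial bound k ≤ n ≤ 1/ε is good enough. -/
theorem card_le_of_mul_le (hn : 2 ≤ n) (hW : 1 ≤ W) (hε : 0 < ε) (hε1 : ε ≤ 1) (hν : 0 < ν)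
    (hν2 : ν ≤ 2) {k : ℕ} (hkn : k ≤ n) (hk : (k : ℝ) ≤ 8 * (walkLen ε ν / ε)) :
    (k : ℝ) ≤ 144 * (ν⁻¹ * ε⁻¹ * Real.log (n * W)) := by
  have h1 := log_two_le_log hn
  have h2 := Real.log_two_gt_d9
  have h3 := log_le_log_mul hn hW
  have hn' : (0 : ℝ) < n := by exact_mod_cast (by omega : 0 < n)
  rcases le_total (n : ℝ) ε⁻¹ with h | h
  · have h4 : (k : ℝ) ≤ ε⁻¹ := (Nat.cast_le.2 hkn).trans h
    have h5 : 2⁻¹ ≤ ν⁻¹ := inv_anti₀ hν hν2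
    have h6 : 1 ≤ 144 * (ν⁻¹ * Real.log (n * W)) := by nlinarith
    have h7 : 0 < ε⁻¹ := inv_pos.2 hε
    nlinarith
  · have h4 : Real.log ε⁻¹ ≤ Real.log n := Real.log_le_log (inv_pos.2 hε) h
    have h5 := walkLen_le hn hW hε hε1 hν hν2
    rw [log_mul_div hn hW hε] at h5
    calc (k : ℝ) ≤ 8 * (walkLen ε ν / ε) := hk
      _ ≤ 8 * (9 * (Real.log (n * W) + Real.log (n * W)) / ν / ε) := by
          refine mul_le_mul_of_nonneg_left (div_le_div_of_nonneg_right (h5.trans ?_) hε.le)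
            (by norm_num)
          refine div_le_div_of_nonneg_right ?_ hν.le
          linarith
      _ = _ := by rw [div_eq_mul_inv, div_eq_mul_inv]; ring

theorem query_time_le (hn : 2 ≤ n) : (160 * Nat.size n + 330 : ℝ) ≤ timeConst c * Real.log n := by
  have h1 := log_two_le_log hn
  have h2 := Real.log_two_gt_d9
  have h3 := size_le_log hn
  have h4 := timeConst_ge (c := c)
  nlinarith

/-- Let Λ = log(nW/ε). The exponent collects 3k from ν⁻³, one from log n and three from Λ³. As Λ may
be below 1 but 2Λ ≥ 1, the factor 2^(3k+4) lets the power also absorb the terms m and s log n. -/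
theorem expander_time_le {κ : ℝ} {k m s : ℕ} (hn : 2 ≤ n) (hW : 1 ≤ W) (hε : 0 < ε) (hε1 : ε ≤ 1)
    (hκ : 0 < κ) (hν : κ / Real.log n ^ k ≤ ν) :
    sketchTime n m W ε ν + s * Real.log n ≤ (2 ^ (3 * k + 4) + (κ ^ 3)⁻¹) *
      Real.log (n * W / ε) ^ (3 * k + 4) * (m + n * (ε ^ 2)⁻¹ + s) := by
  have h0 := log_inv_nonneg hε hε1
  have h1 := log_two_le_log hn
  have h2 := Real.log_two_gt_d9
  have h3 := log_le_log_mul hn hW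
  have hΛ : Real.log n ≤ Real.log (n * W / ε) := by rw [log_mul_div hn hW hε]; linarith
  rw [sketchTime]
  set Λ := Real.log (n * W / ε)
  set l := Real.log n
  have hl : 0 < l := by linarith
  have hν0 : 0 < ν := (by positivity : 0 < κ / l ^ k).trans_le hν
  have h4 : 1 ≤ 2 ^ (3 * k + 4) * Λ ^ (3 * k + 4) := by
    rw [← mul_pow]
    exact one_le_pow₀ (by linarith)
  have h5 : Λ ≤ 2 ^ (3 * k + 4) * Λ ^ (3 * k + 4) := by
    rw [← mul_pow]
    calc Λ ≤ 2 * Λ := by linarith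
      _ ≤ (2 * Λ) ^ (3 * k + 4) := le_self_pow₀ (by linarith) (by omega)
  have h6 : (ν ^ 3)⁻¹ * l * Λ ^ 3 ≤ (κ ^ 3)⁻¹ * Λ ^ (3 * k + 4) := by
    have h7 : (ν ^ 3)⁻¹ ≤ (κ ^ 3)⁻¹ * l ^ (3 * k) := by
      calc (ν ^ 3)⁻¹ ≤ ((κ / l ^ k) ^ 3)⁻¹ :=
            inv_anti₀ (by positivity) (pow_le_pow_left₀ (by positivity) hν 3)
        _ = _ := by rw [div_pow, inv_div, ← pow_mul, mul_comm k 3, div_eq_inv_mul]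
    calc (ν ^ 3)⁻¹ * l * Λ ^ 3 ≤ (κ ^ 3)⁻¹ * Λ ^ (3 * k) * Λ * Λ ^ 3 := by
          have h8 : l ^ (3 * k) ≤ Λ ^ (3 * k) := pow_le_pow_left₀ hl.le hΛ _
          have h9 : (ν ^ 3)⁻¹ ≤ (κ ^ 3)⁻¹ * Λ ^ (3 * k) :=
            h7.trans (mul_le_mul_of_nonneg_left h8 (by positivity))
          have h10 : (0 : ℝ) ≤ Λ := by linarith
          gcongr
      _ = _ := by rw [pow_add]; ring
  have hm : (0 : ℝ) ≤ m := Nat.cast_nonneg _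
  have hs : (0 : ℝ) ≤ s := Nat.cast_nonneg _
  have hne : (0 : ℝ) ≤ n * (ε ^ 2)⁻¹ := by positivity
  have hk0 : 0 ≤ (κ ^ 3)⁻¹ * Λ ^ (3 * k + 4) := by
    have : (0 : ℝ) ≤ Λ := by linarith
    positivity
  have e1 := mul_le_mul_of_nonneg_left h4 hm
  have e2 := mul_le_mul_of_nonneg_left (hΛ.trans h5) hs
  have e3 := mul_le_mul_of_nonneg_left h6 hne
  have e4 := mul_nonneg hk0 hm
  have e5 := mul_nonneg hk0 hs
  have e6 := mul_nonneg (zero_le_one.trans h4) hne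
  linarith

end bounds

/-! ### Accuracy and sparsity of the stored vectors, and assembly. -/

/-- Dropping the small counts changes the frequencies by little. -/
theorem sparse_close {n r : ℕ} (hr : 0 < r) {ε y : ℝ} {cs : Fin n → ℕ} {v : Fin n}
    (h : |(cs v : ℝ) / (2 * r) - y| ≤ ε / 16) :
    |sparse (r * ε / 8) (2 * r) cs v - y| ≤ ε / 8 := by
  have hr' : (0 : ℝ) < r := Nat.cast_pos.2 hr
  have hε : 0 ≤ ε / 16 := (abs_nonneg _).trans h
  rw [sparse]
  -- A kept frequency is unchanged; a dropped one was below ε/16, so y is within ε/16 + ε/16 of 0.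
  split_ifs with hx
  · linarith
  · have h1 : (cs v : ℝ) / (2 * r) ≤ ε / 16 := by
      rw [div_le_iff₀ (by positivity)]
      linarith
    have h2 : (0 : ℝ) ≤ (cs v : ℝ) / (2 * r) := by positivity
    rw [abs_le] at h ⊢
    constructor <;> linarith

theorem nnz_sparse_mul_le {n r : ℕ} {x : ℝ} (hx : 0 < x) (hr : 0 < r) {cs : Fin n → ℕ} :
    nnz (sparse x (2 * r) cs) ≤ n ∧ (nnz (sparse x (2 * r) cs) : ℝ) * x ≤ (∑ v, cs v : ℕ) := by
  have hr' : (0 : ℝ) < r := Nat.cast_pos.2 hr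
  have h : nnz (sparse x (2 * r) cs) = (Finset.univ.filter fun v => x ≤ cs v).card := by
    rw [nnz, ← Set.ncard_coe_finset]
    congr 1
    ext v
    simp [sparse_ne_zero hx (show (0 : ℝ) < 2 * r by positivity)]
  rw [h]
  exact ⟨(Finset.card_le_univ _).trans_eq (Fintype.card_fin n), card_filter_mul_le⟩

/-- A connected graph on at least two vertices has an edge, and its weight lies between 1 and W. -/
theorem WGraph.one_le_weight {n : ℕ} {G : WGraph n} (hG : G.graph.Connected) (hn : 2 ≤ n) {W : ℝ}
    (hW : ∀ u v, G.graph.Adj u v → 1 ≤ G.A u v ∧ G.A u v ≤ W) : 1 ≤ W := by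
  have : Nontrivial (Fin n) := Fin.nontrivial_iff_two_le.2 hn
  obtain ⟨v, hv⟩ := hG.preconnected.exists_adj_of_nontrivial (⟨0, by omega⟩ : Fin n)
  exact (hW _ _ hv).1.trans (hW _ _ hv).2

/-- The running time and the coupling of the sketch with the numbers of visits. -/
theorem sketch_spec {n c : ℕ} (hn : 2 ≤ n) {G : WGraph n} (hG : G.graph.Connected) {ε : ℝ}
    (hε : 0 < ε) (hε1 : ε ≤ 1) {a : ℕ → ℕ} {b : ℕ → ℝ} (hab : StoresInput G ε (G.specGap hn) a b) :
    ∃ (μ : PMF (Fin n → Fin n → ℕ)) (σ : (Fin n → Fin n → ℕ) → Fin n → Fin n → ℝ),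
      Good [sketch c] (startState a b)
        (sketchSteps (Nat.clog 2 n) (doublings ε) (walkLen ε (G.specGap hn))
          (numWalks c n ε (G.specGap hn)) n G.numEdges) μ
        (fun cs t => StoresSketch G.deg (σ cs) t ∧ t.na 0 = a) ∧
      (∀ W : ℝ, 1 ≤ W → ∀ cs ∈ μ.support, ∀ u, (nnz (σ cs u) : ℝ) ≤
        144 * ((G.specGap hn)⁻¹ * ε⁻¹ * Real.log (n * W))) ∧
      1 - 1 / (n : ℝ) ^ c ≤ (μ.toOuterMeasure
        {cs | ∀ u v, Approx ε (G.effRes u v) (estimate G.deg (σ cs) u v)}).toReal := by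
  have hd : ∀ u, 0 < G.deg u := deg_pos hG hn
  have hν := specGap_pos hG hn
  have hν2 := specGap_le_two hG hn
  set ν := G.specGap hn
  set ℓ := walkLen ε ν with hℓ
  set r := numWalks c n ε ν with hr
  have hr0 : 0 < r := (numWalks_pos hn hε hε1 hν hν2).2
  have hℓ0 : 0 < ℓ := by have := walkLen_ge (ε := ε) hν hν2; omega
  have hr1 : (0 : ℝ) < r := Nat.cast_pos.2 hr0
  refine ⟨G.tablePMF hd ℓ r, fun cs u => sparse (r * ε / 8) (2 * r) (cs u),
    sketch_good hab hε rfl rfl hr0 fun k hk =>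
      mul_self_le_numWalks hn (le_of_mul_threshold_le hε hr0 hk), fun W hW cs hcs u => ?_, ?_⟩
  · obtain ⟨h1, h2⟩ := nnz_sparse_mul_le (x := r * ε / 8) (by positivity) hr0 (cs := cs u)
    rw [tablePMF_support hcs] at h2
    exact card_le_of_mul_le hn hW hε hε1 hν hν2 h1 (le_of_mul_threshold_le hε hr0 h2)
  · refine (table_accurate (hd := hd) hn c ℓ r hℓ0 hε hε1 log_le_numWalks).trans ?_
    refine ENNReal.toReal_mono ?_ (PMF.toOuterMeasure_mono _ ?_)
    · refine ne_top_of_le_ne_top ENNReal.one_ne_top ?_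
      rw [← (PMF.toOuterMeasure_apply_eq_one_iff (G.tablePMF hd ℓ r) (s := Set.univ)).2
        (Set.subset_univ _)]
      exact PMF.toOuterMeasure_mono _ fun x _ => Set.mem_univ _
    · rintro cs ⟨hcs, -⟩ u v
      exact approx_of_close hG hn (pow_walkLen_le hε hν hν2)
        (fun x y => sparse_close hr0 (hcs x y)) u v

/-- The batch program within any sufficient time. -/
theorem batch_spec {n c : ℕ} (hn : 2 ≤ n) {G : WGraph n} (hG : G.graph.Connected) {W ε : ℝ}
    (hW : 1 ≤ W) (hε : 0 < ε) (hε1 : ε ≤ 1) {s : ℕ} {q : Fin s → Fin n × Fin n} {a : ℕ → ℕ}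
    {b : ℕ → ℝ} (hab : StoresInput G ε (G.specGap hn) a b) (hq : StoresPairs n s q a) {T : ℝ}
    (hT : timeConst c * (sketchTime n G.numEdges W ε (G.specGap hn) + s * Real.log n) ≤ T) :
    Surely (batch c) (startState a b) T (fun _ => True) ∧
      1 - 1 / (n : ℝ) ^ c ≤ prob (batch c) (startState a b) T
        (fun t => ∀ i : Fin s, Approx ε (G.effRes (q i).1 (q i).2) (t.xa 1 i)) := by
  obtain ⟨μ, σ, h, -, hμ⟩ := sketch_spec (c := c) hn hG hε hε1 hab
  have hb := batch_good hab.rows.size hq h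
  have hN : ((sketchSteps (Nat.clog 2 n) (doublings ε) (walkLen ε (G.specGap hn))
      (numWalks c n ε (G.specGap hn)) n G.numEdges + 30 + s * (160 * Nat.size n + 330) : ℕ) : ℝ)
      ≤ T := by
    have h1 := sketchTime_ge (c := c) (m := G.numEdges) hn hW hε hε1 (specGap_pos hG hn)
      (specGap_le_two hG hn)
    have h2 := mul_le_mul_of_nonneg_left (query_time_le (c := c) hn) (Nat.cast_nonneg (α := ℝ) s)
    rw [Nat.cast_add]
    push_cast at h1 h2 ⊢
    linarith
  refine ⟨hb.surely hN fun _ _ _ _ => trivial, hμ.trans (hb.prob_ge hN fun cs t hcs _ ht i => ?_)⟩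
  rw [ht i]
  exact hcs _ _

end ResistanceSketch

end

open ResistanceSketch in
theorem theorem3p1 (c : ℕ) :
    ∃ (sketch query batch : Prog) (C : ℝ), 0 < C ∧
      -- the sketch: running time, sparsity, quality of the estimates
      (∀ (n : ℕ) (hn : 2 ≤ n) (G : WGraph n) (W ε : ℝ), G.graph.Connected →
        (∀ u v, G.graph.Adj u v → 1 ≤ G.A u v ∧ G.A u v ≤ W) → 0 < ε → ε ≤ 1 →
        ∀ (a : ℕ → ℕ) (b : ℕ → ℝ), StoresInput G ε (G.specGap hn) a b →
          Surely sketch (startState a b)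
            (C * sketchTime n G.numEdges W ε (G.specGap hn))
            (fun t => ∃ σ : Fin n → Fin n → ℝ, StoresSketch G.deg σ t ∧
              ∀ u, (nnz (σ u) : ℝ) ≤ C * ((G.specGap hn)⁻¹ * ε⁻¹ * Real.log (n * W))) ∧
          1 - 1 / (n : ℝ) ^ c ≤ prob sketch (startState a b)
            (C * sketchTime n G.numEdges W ε (G.specGap hn))
            (fun t => ∃ σ : Fin n → Fin n → ℝ, StoresSketch G.deg σ t ∧
              ∀ u v, Approx ε (G.effRes u v) (estimate G.deg σ u v))) ∧
      -- the query
      (∀ (n : ℕ) (_ : 2 ≤ n) (d : Fin n → ℝ) (σ : Fin n → Fin n → ℝ) (u v : Fin n) (t : State),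
        StoresSketch d σ t → t.nr 0 = u → t.nr 1 = v →
          Surely query t (C * Real.log n)
            (fun t' => t'.xr 0 = estimate d σ u v ∧ StoresSketch d σ t')) ∧
      -- answering `s` pairs
      (∀ (n : ℕ) (hn : 2 ≤ n) (G : WGraph n) (W ε : ℝ), G.graph.Connected →
        (∀ u v, G.graph.Adj u v → 1 ≤ G.A u v ∧ G.A u v ≤ W) → 0 < ε → ε ≤ 1 →
        ∀ (s : ℕ) (q : Fin s → Fin n × Fin n) (a : ℕ → ℕ) (b : ℕ → ℝ),
          StoresInput G ε (G.specGap hn) a b → StoresPairs n s q a →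
          Surely batch (startState a b)
            (C * (sketchTime n G.numEdges W ε (G.specGap hn) + s * Real.log n))
            (fun _ => True) ∧
          1 - 1 / (n : ℝ) ^ c ≤ prob batch (startState a b)
            (C * (sketchTime n G.numEdges W ε (G.specGap hn) + s * Real.log n))
            (fun t => ∀ i : Fin s, Approx ε (G.effRes (q i).1 (q i).2) (t.xa 1 i))) ∧
      -- answering `s` pairs on expanders
      (∀ (κ : ℝ) (k : ℕ), 0 < κ → ∃ (C' : ℝ) (k' : ℕ), 0 < C' ∧
        ∀ (n : ℕ) (hn : 2 ≤ n) (G : WGraph n) (W ε : ℝ), G.graph.Connected →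
        (∀ u v, G.graph.Adj u v → 1 ≤ G.A u v ∧ G.A u v ≤ W) → 0 < ε → ε ≤ 1 →
        κ / Real.log n ^ k ≤ G.specGap hn →
        ∀ (s : ℕ) (q : Fin s → Fin n × Fin n) (a : ℕ → ℕ) (b : ℕ → ℝ),
          StoresInput G ε (G.specGap hn) a b → StoresPairs n s q a →
          Surely batch (startState a b)
            (C' * Real.log (n * W / ε) ^ k' * (G.numEdges + n * (ε ^ 2)⁻¹ + s))
            (fun _ => True) ∧
          1 - 1 / (n : ℝ) ^ c ≤ prob batch (startState a b)
            (C' * Real.log (n * W / ε) ^ k' * (G.numEdges + n * (ε ^ 2)⁻¹ + s))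
            (fun t => ∀ i : Fin s, Approx ε (G.effRes (q i).1 (q i).2) (t.xa 1 i))) := by
  refine ⟨ResistanceSketch.sketch c, ResistanceSketch.query, ResistanceSketch.batch c, timeConst c,
    by linarith [timeConst_ge (c := c)], ?_, ?_, ?_, ?_⟩
  · intro n hn G W ε hG hGW hε hε1 a b hab
    have hW := WGraph.one_le_weight hG hn hGW
    have hT := sketchTime_ge (c := c) (m := G.numEdges) hn hW hε hε1 (WGraph.specGap_pos hG hn)
      (WGraph.specGap_le_two hG hn)
    obtain ⟨μ, σ, h, hnnz, hμ⟩ := sketch_spec (c := c) hn hG hε hε1 hab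
    -- The bound `sketchTime_ge` includes 30 steps for the overhead of the batch program; surplus
    -- time is harmless here.
    have h' := h.mono_time (Nat.le_add_right _ 30)
    refine ⟨h'.surely hT fun cs t hcs ht => ⟨σ cs, ht.1, fun u => (hnnz W hW cs hcs u).trans ?_⟩,
      hμ.trans (h'.prob_ge hT fun cs t hcs _ ht => ⟨σ cs, ht.1, hcs⟩)⟩
    have hlog : 0 ≤ Real.log (n * W) :=
      (Real.log_natCast_nonneg n).trans (log_le_log_mul hn hW)
    have hν := WGraph.specGap_pos hG hn
    exact mul_le_mul_of_nonneg_right (by linarith [timeConst_ge (c := c)]) (by positivity)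
  · intro n hn d σ u v t hS hu hv
    have hT := query_time_le (c := c) hn
    refine (query_ends hS hu hv).frame.surely (by push_cast; linarith)
      fun _ t' _ ht' => ⟨ht'.1, hS.congr (ht'.2.na 1 rfl) (ht'.2.xa 1 rfl)⟩
  · intro n hn G W ε hG hGW hε hε1 s q a b hab hq
    exact batch_spec hn hG (WGraph.one_le_weight hG hn hGW) hε hε1 hab hq le_rfl
  · intro κ k hκ
    have hc := timeConst_ge (c := c)
    refine ⟨timeConst c * (2 ^ (3 * k + 4) + (κ ^ 3)⁻¹), 3 * k + 4, by positivity, ?_⟩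
    intro n hn G W ε hG hGW hε hε1 hν s q a b hab hq
    have hW := WGraph.one_le_weight hG hn hGW
    refine batch_spec hn hG hW hε hε1 hab hq ?_
    have := mul_le_mul_of_nonneg_left
      (expander_time_le (m := G.numEdges) (s := s) hn hW hε hε1 hκ hν)
      (show 0 ≤ timeConst c by linarith)
    linarith
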